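/- Structures are finite, over finite signatures consisting of relation symbols and symbols for partial unary functions; an atomic formula is false if a term in it is undefined. A transduction is a composition of atomic operations: extension by a relation $\{\bar x : \varphi(\bar x)\}$ defined by a formula; restriction to the elements satisfying a formula $\psi(x)$ (a function becomes undefined where its value is removed); reduct (removal of a symbol); copying (disjoint union with a second, new copy, together with a unary predicate marking the new elements and a symmetric binary relation joining each element to its copy); function extension (adding the partial function mapping $x$ to the unique $y$ with $\varphi(x,y)$, undefined if there is no such $y$ or more than one); and unary lift (adding a unary predicate interpreted by a nondeterministically chosen member of $\sigma(\mathbb A)$, where $\sigma$ maps every structure $\mathbb A$ to a nonempty family of subsets of its universe). It is almost quantifier-free if all the formulas used are quantifier-free, and deterministic if it uses no unary lift. $\mathsf I(\mathbb A)$ denotes the set of possible outputs of $\mathsf I$ on $\mathbb A$, and $\mathsf I(\mathcal C)$ the class of all outputs on members of $\mathcal C$. A connection model with labels from $\Lambda$ of a graph $G$ is a finite rooted tree with leaf set $V(G)$, with a label $\lambda(x)\in\Lambda$ for each leaf $x$ and a symmetric relation $C(v)\subseteq\Lambda\times\Lambda$ for each non-leaf node $v$, such that distinct $x,y\in V(G)$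 are adjacent in $G$ if and only if $(\lambda(x),\lambda(y))\in C(v)$ for their least common ancestor $v$. A class of finite simple graphs has bounded shrubdepth if for some $h\in\mathbb N$ and some finite $\Lambda$ each of its graphs has a connection model of depth at most $h$ with labels from $\Lambda$. An SC-decomposition of depth $d$ of a graph $G$ is a rooted tree $t$ with leaf set $V(G)$, with sets $W_0,\dots,W_d$ of leaves, such that: if $d=0$, then $t$ has a single node; if $d\ge 1$, then the children $s$ of the root correspond bijectively to the connected components $C_s$ of the graph $G'$ obtained from $G$ by complementing the adjacency between distinct vertices of $W_0$, and the subtree rooted at $s$ with the restrictions of $W_1,\dots,W_d$ is an SC-decomposition of depth $d-1$ of $C_s$. Colored trees are structures consisting of the partial parent function of a rooted tree and of finitely many unary predicates; a graph is a structure with one binary relation. **Lemma.** Let $\mathcal B$ be a class of graphs of bounded shrubdepth. Then there are $d\in\mathbb N$, a class $\mathcal T$ of colored trees of height at most $d$ (over one fixed signature), an almost quantifier-free transduction $\mathsf T$ and a deterministic almost quantifier-free transduction $\mathsf B$ such that $\mathsf T(\mathcal B)\subseteq\mathcal T$, $\mathsf B(\mathcal T)\subseteq\mathcal B$ (up to isomorphism),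 $$\mathsf B(\mathsf T(G))=\{G\}\ \text{ for all } G\in\mathcal B,\qquad t\in\mathsf T(\mathsf B(t))\ \text{ for all } t\in\mathcal T$$ (the latter up to the names of the elements created by copying). Moreover, for every $G\in\mathcal B$, every $t\in\mathsf T(G)$ is an SC-decomposition of $G$ of depth $d$; its leaves are the vertices of $G$, and its other nodes are created by copying. -/

import Mathlib

namespace ShrubDepth

/-! ### Signatures, structures with partial unary functions, first-order logic -/

/-- A signature: finitely many relation symbols with arities, and finitely many unary function
symbols. -/
structure Sig where
  Rel : Type
  Func : Type
  arity : Rel → ℕ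
  [finRel : Finite Rel]
  [finFunc : Finite Func]

attribute [instance] Sig.finRel Sig.finFunc

/-- A structure over `S`: a finite universe, relations, and partial unary functions
(the value `none` means: undefined). -/
structure Str (S : Sig) where
  V : Type
  [fin : Finite V]
  rel : (R : S.Rel) → (Fin (S.arity R) → V) → Prop
  func : S.Func → V → Option V

attribute [instance] Str.fin

/-- Isomorphisms of structures. -/
structure Str.Iso {S : Sig} (A B : Str S) extends A.V ≃ B.V where
  rel_iff : ∀ (R : S.Rel) (v : Fin (S.arity R) → A.V),
    B.rel R (fun i => toEquiv (v i)) ↔ A.rel R v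
  func_eq : ∀ (f : S.Func) (x : A.V), B.func f (toEquiv x) = (A.func f x).map toEquiv

/-- Terms: finite compositions of function symbols applied to one of the variables `x₀, …, xₙ₋₁`. -/
inductive Term (S : Sig) (n : ℕ) : Type
  | var (i : Fin n) : Term S n
  | app (f : S.Func) (t : Term S n) : Term S n

/-- The value of a term; it is undefined as soon as one of the applications is undefined. -/
def Term.eval {S : Sig} (A : Str S) {n : ℕ} (v : Fin n → A.V) : Term S n → Option A.V
  | .var i => some (v i)
  | .app f t => (t.eval A v).bind (A.func f)

/-- First-order formulas with free variables among `x₀, …, xₙ₋₁`. The other connectives and the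
existential quantifier are the usual abbreviations. -/
inductive Formula (S : Sig) : ℕ → Type
  | falsum {n : ℕ} : Formula S n
  | rel {n : ℕ} (R : S.Rel) (ts : Fin (S.arity R) → Term S n) : Formula S n
  | eq {n : ℕ} (s t : Term S n) : Formula S n
  | dom {n : ℕ} (f : S.Func) (t : Term S n) : Formula S n
  | imp {n : ℕ} (φ ψ : Formula S n) : Formula S n
  | all {n : ℕ} (φ : Formula S (n + 1)) : Formula S n

/-- Satisfaction. An atomic formula is false if one of its terms is undefined. -/
def Formula.Holds {S : Sig} (A : Str S) : {n : ℕ} → Formula S n → (Fin n → A.V) → Prop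
  | _, .falsum, _ => False
  | _, .rel R ts, v => ∃ w : Fin (S.arity R) → A.V, (∀ i, (ts i).eval A v = some (w i)) ∧ A.rel R w
  | _, .eq s t, v => ∃ x : A.V, s.eval A v = some x ∧ t.eval A v = some x
  | _, .dom f t, v => ∃ x y : A.V, t.eval A v = some x ∧ A.func f x = some y
  | _, .imp φ ψ, v => φ.Holds A v → ψ.Holds A v
  | _, .all φ, v => ∀ x : A.V, φ.Holds A (Fin.snoc v x)

/-- Quantifier-free formulas. -/
def Formula.QuantifierFree {S : Sig} : {n : ℕ} → Formula S n → Prop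
  | _, .falsum => True
  | _, .rel _ _ => True
  | _, .eq _ _ => True
  | _, .dom _ _ => True
  | _, .imp φ ψ => φ.QuantifierFree ∧ ψ.QuantifierFree
  | _, .all _ => False

/-! ### The atomic operations on structures

A newly introduced symbol is always fresh: it is the symbol `none` of the enlarged signature. -/

/-- `S` with one more relation symbol, of arity `k`. -/
abbrev Sig.addRel (S : Sig) (k : ℕ) : Sig where
  Rel := Option S.Rel
  Func := S.Func
  arity R := R.elim k S.arity

/-- `S` with one more function symbol. -/
abbrev Sig.addFunc (S : Sig) : Sig where
  Rel := S.Rel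
  Func := Option S.Func
  arity := S.arity

/-- `S` without the relation symbol `R`. -/
abbrev Sig.dropRel (S : Sig) (R : S.Rel) : Sig where
  Rel := {R' : S.Rel // R' ≠ R}
  Func := S.Func
  arity R' := S.arity R'.1

/-- `S` without the function symbol `f`. -/
abbrev Sig.dropFunc (S : Sig) (f : S.Func) : Sig where
  Rel := S.Rel
  Func := {f' : S.Func // f' ≠ f}
  arity := S.arity

/-- A bijective renaming of the symbols of a signature. -/
structure Sig.Renaming (S S' : Sig) where
  rel : S.Rel ≃ S'.Rel
  func : S.Func ≃ S'.Func
  arity_eq : ∀ R : S'.Rel, S.arity (rel.symm R) = S'.arity R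

/-- Extension by a relation. -/
def Str.addRel {S : Sig} (A : Str S) {k : ℕ} (P : (Fin k → A.V) → Prop) : Str (S.addRel k) where
  V := A.V
  rel R := match R with
    | none => P
    | some R => A.rel R
  func := A.func

/-- Extension by a partial function. -/
def Str.addFunc {S : Sig} (A : Str S) (g : A.V → Option A.V) : Str S.addFunc where
  V := A.V
  rel := A.rel
  func f := match f with
    | none => g
    | some f => A.func f

open Classical in
/-- The partial function mapping `x` to the unique `y` with `P x y`; undefined if there is no such
`y`, or more than one. -/
noncomputable def uniqueValue {V : Type} (P : V → V → Prop) (x : V) : Option V :=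
  if h : ∃! y, P x y then some h.choose else none

open Classical in
/-- The induced substructure: a function becomes undefined where its value is removed. -/
noncomputable def Str.restrict {S : Sig} (A : Str S) (P : A.V → Prop) : Str S where
  V := {x : A.V // P x}
  rel R v := A.rel R (fun i => (v i).1)
  func f x := (A.func f x.1).bind (fun y => if h : P y then some ⟨y, h⟩ else none)

/-- Removal of a relation. -/
def Str.dropRel {S : Sig} (A : Str S) (R : S.Rel) : Str (S.dropRel R) where
  V := A.V
  rel R' := A.rel R'.1
  func := A.func

/-- Removal of a function. -/
def Str.dropFunc {S : Sig} (A : Str S) (f : S.Func) : Str (S.dropFunc f) where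
  V := A.V
  rel := A.rel
  func f' := A.func f'.1

/-- Renaming of symbols. -/
def Str.rename {S S' : Sig} (A : Str S) (e : S.Renaming S') : Str S' where
  V := A.V
  rel R v := A.rel (e.rel.symm R) (fun i => v (Fin.cast (e.arity_eq R) i))
  func f := A.func (e.func.symm f)

/-- The disjoint union of two copies of `A`. -/
def Str.double {S : Sig} (A : Str S) : Str S where
  V := A.V ⊕ A.V
  rel R v := (∃ w, A.rel R w ∧ v = fun i => Sum.inl (w i)) ∨
    (∃ w, A.rel R w ∧ v = fun i => Sum.inr (w i))
  func f x := match x with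
    | .inl x => (A.func f x).map Sum.inl
    | .inr x => (A.func f x).map Sum.inr

/-- Copying: two disjoint copies (the elements `inl x` are the original ones, the elements `inr x`
are new), with a unary predicate marking the new elements and a symmetric binary relation
connecting each element with its copy. -/
def Str.copy {S : Sig} (A : Str S) : Str ((S.addRel 1).addRel 2) :=
  (A.double.addRel (k := 1) (fun v => ∃ x : A.V, v 0 = Sum.inr x)).addRel (k := 2)
    (fun v => ∃ x : A.V, (v 0 = Sum.inl x ∧ v 1 = Sum.inr x) ∨ (v 0 = Sum.inr x ∧ v 1 = Sum.inl x))

/-! ### Transductions -/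

/-- Transductions with input signature `S` and output signature `S'`: compositions of atomic
operations. In a unary lift, `σ` maps each structure to a nonempty family of subsets of its
universe. The renaming of symbols only accounts for the names that the atomic operations give to the
symbols they introduce. -/
inductive Transduction : Sig → Sig → Type 1
  | extension {S : Sig} {k : ℕ} (φ : Formula S k) : Transduction S (S.addRel k)
  | restriction {S : Sig} (ψ : Formula S 1) : Transduction S S
  | reductRel {S : Sig} (R : S.Rel) : Transduction S (S.dropRel R)
  | reductFunc {S : Sig} (f : S.Func) : Transduction S (S.dropFunc f)
  | copying {S : Sig} : Transduction S ((S.addRel 1).addRel 2)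
  | funcExtension {S : Sig} (φ : Formula S 2) : Transduction S S.addFunc
  | unaryLift {S : Sig} (σ : (A : Str S) → Set (Set A.V)) (hσ : ∀ A, (σ A).Nonempty) :
      Transduction S (S.addRel 1)
  | rename {S S' : Sig} (e : S.Renaming S') : Transduction S S'
  | comp {S S' S'' : Sig} (I : Transduction S S') (J : Transduction S' S'') : Transduction S S''

/-- An output of an operation applied to `A`: a structure, together with the information which of
its elements are elements of `A` (`origin y = some x` means that `y` is the element `x` of `A`, and
`origin y = none` means that `y` was created by copying). -/
structure Output {S : Sig} (A : Str S) (S' : Sig) where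
  str : Str S'
  origin : str.V → Option A.V

/-- The set of possible outputs of a transduction on a given structure. -/
noncomputable def Transduction.outputs : {S S' : Sig} → Transduction S S' → (A : Str S) →
    Set (Output A S')
  | _, _, .extension φ, A => {⟨A.addRel (φ.Holds A), some⟩}
  | _, _, .restriction ψ, A => {⟨A.restrict (fun x => ψ.Holds A ![x]), fun x => some x.1⟩}
  | _, _, .reductRel R, A => {⟨A.dropRel R, some⟩}
  | _, _, .reductFunc f, A => {⟨A.dropFunc f, some⟩}
  | _, _, .copying, A => {⟨A.copy, Sum.elim some (fun _ => none)⟩}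
  | _, _, .funcExtension φ, A => {⟨A.addFunc (uniqueValue fun x y => φ.Holds A ![x, y]), some⟩}
  | _, _, .unaryLift σ _, A => {o | ∃ U ∈ σ A, o = ⟨A.addRel (k := 1) (fun v => v 0 ∈ U), some⟩}
  | _, _, .rename e, A => {⟨A.rename e, some⟩}
  | _, _, .comp I J, A => {o | ∃ o₁ ∈ I.outputs A, ∃ o₂ ∈ J.outputs o₁.str,
      o = ⟨o₂.str, fun x => (o₂.origin x).bind o₁.origin⟩}

/-- All formulas that parameterize atomic operations are quantifier-free. -/
def Transduction.AlmostQuantifierFree : {S S' : Sig} → Transduction S S' → Prop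
  | _, _, .extension φ => φ.QuantifierFree
  | _, _, .restriction ψ => ψ.QuantifierFree
  | _, _, .reductRel _ => True
  | _, _, .reductFunc _ => True
  | _, _, .copying => True
  | _, _, .funcExtension φ => φ.QuantifierFree
  | _, _, .unaryLift _ _ => True
  | _, _, .rename _ => True
  | _, _, .comp I J => I.AlmostQuantifierFree ∧ J.AlmostQuantifierFree

/-- No unary lift is used. -/
def Transduction.Deterministic : {S S' : Sig} → Transduction S S' → Prop
  | _, _, .unaryLift _ _ => False
  | _, _, .comp I J => I.Deterministic ∧ J.Deterministic
  | _, _, _ => True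

/-! ### Graphs -/

/-- Finite simple graphs. -/
structure FinGraph where
  V : Type
  [fin : Finite V]
  graph : SimpleGraph V

attribute [instance] FinGraph.fin

/-- The signature of graphs: one binary relation symbol. -/
abbrev graphSig : Sig where
  Rel := Unit
  Func := Empty
  arity _ := 2

/-- A graph as a structure. -/
def FinGraph.toStr (G : FinGraph) : Str graphSig where
  V := G.V
  rel _ v := G.graph.Adj (v (0 : Fin 2)) (v (1 : Fin 2))
  func f := f.elim

/-! ### Rooted trees, given by their partial parent function -/

section Trees

variable {N : Type} (p : N → Option N)

/-- The `k`-th ancestor of `x`, if it exists. -/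
def ancestor (k : ℕ) (x : N) : Option N := (fun o => o.bind p)^[k] (some x)

/-- `y` is an ancestor of `x` (every node is an ancestor of itself). -/
def IsAncestor (y x : N) : Prop := ∃ k, ancestor p k x = some y

/-- `p` is the parent function of a tree with root `r`. -/
def IsRootedTree (r : N) : Prop := p r = none ∧ ∀ x, IsAncestor p r x

/-- Every node of the tree with root `r` has depth (distance from the root) at most `h`. -/
def DepthAtMost (r : N) (h : ℕ) : Prop := ∀ x, ∃ k ≤ h, ancestor p k x = some r

/-- Nodes without children. -/
def IsLeaf (x : N) : Prop := ∀ y, p y ≠ some x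

/-- `z` is the least common ancestor of `x` and `y`: the deepest among their common ancestors. -/
def IsLCA (z x y : N) : Prop :=
  IsAncestor p z x ∧ IsAncestor p z y ∧
    ∀ w, IsAncestor p w x → IsAncestor p w y → IsAncestor p w z

end Trees

/-! ### Shrubdepth -/

/-- `G` has a connection model of depth at most `h` with labels from `Λ`: a finite rooted tree whose
leaves are (via `leaf`) the vertices of `G`, with a label `lab` for every leaf and a symmetric
relation `C z` on labels for every non-leaf node `z`, such that distinct vertices are adjacent if
and only if their labels are related at their least common ancestor. The relations `C z` at leaves
`z` are irrelevant. -/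
def HasConnectionModel (h : ℕ) (Λ : Type) (G : FinGraph) : Prop :=
  ∃ (N : Type) (_ : Finite N) (p : N → Option N) (r : N) (leaf : G.V → N) (lab : G.V → Λ)
    (C : N → Λ → Λ → Prop),
    IsRootedTree p r ∧ DepthAtMost p r h ∧
    Set.BijOn leaf Set.univ {x | IsLeaf p x} ∧
    (∀ z a b, C z a b → C z b a) ∧
    ∀ x y z, x ≠ y → IsLCA p z (leaf x) (leaf y) → (G.graph.Adj x y ↔ C z (lab x) (lab y))

/-- A class of graphs of bounded shrubdepth. -/
def BoundedShrubdepth (𝓑 : Set FinGraph) : Prop :=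
  ∃ (h : ℕ) (Λ : Type) (_ : Finite Λ), ∀ G ∈ 𝓑, HasConnectionModel h Λ G

/-! ### Colored trees and SC-decompositions -/

/-- The signature of trees colored with `n` colors: the parent function and `n` unary predicates. -/
abbrev treeSig (n : ℕ) : Sig where
  Rel := Fin n
  Func := Unit
  arity _ := 1

/-- The parent function of a colored tree. -/
def Str.parent {n : ℕ} (t : Str (treeSig n)) : t.V → Option t.V := t.func ()

/-- The set of nodes of color `i`. -/
def Str.color {n : ℕ} (t : Str (treeSig n)) (i : Fin n) : Set t.V := {x | t.rel i (fun _ => x)}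

/-- `t` is a colored rooted tree of height at most `h`. -/
def IsColoredTree {n : ℕ} (h : ℕ) (t : Str (treeSig n)) : Prop :=
  ∃ r, IsRootedTree t.parent r ∧ DepthAtMost t.parent r h

/-- The graph obtained from `G` by flipping the adjacency within `W`: the symmetric difference of
`G` and the clique on `W`. -/
def flipWithin {V : Type} (G : SimpleGraph V) (W : Set V) : SimpleGraph V :=
  symmDiff G { Adj := fun u v => u ≠ v ∧ u ∈ W ∧ v ∈ W
               symm := ⟨fun _ _ h => ⟨h.1.symm, h.2.2, h.2.1⟩⟩
               loopless := ⟨fun _ h => h.1 rfl⟩ }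

/-- In the tree with parent function `p`, the subtree rooted at `r`, with the sets
`W 0, …, W d`, is an SC-decomposition of depth `d` of the graph `G`, where `leaf` identifies the
vertices of `G` with the leaves of the subtree. For `d = 0` the subtree consists of `r` only.
For `d + 1`, the children `s` of `r` correspond to the connected components of the graph obtained
from `G` by flipping the adjacency within `W 0`, and the subtree rooted at `s`, with the
sets `W 1, …, W (d + 1)`, is an SC-decomposition of depth `d` of the corresponding component. -/
def IsSCSubtree {N : Type} (p : N → Option N) : (d : ℕ) → (Fin (d + 1) → Set N) → (r : N) →
    (V : Type) → SimpleGraph V → (V → N) → Prop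
  | 0, _, r, _, _, leaf =>
      Set.BijOn leaf Set.univ {x | IsLeaf p x ∧ IsAncestor p r x} ∧ IsLeaf p r
  | d + 1, W, r, _, G, leaf =>
      Set.BijOn leaf Set.univ {x | IsLeaf p x ∧ IsAncestor p r x} ∧
      ∃ e : {s : N // p s = some r} ≃ (flipWithin G (leaf ⁻¹' W 0)).ConnectedComponent,
        ∀ s, IsSCSubtree p d (fun i => W i.succ) s.1 (e s).supp
          ((flipWithin G (leaf ⁻¹' W 0)).induce (e s).supp) (fun v => leaf v.1)

/-- The colored tree `t` is an SC-decomposition of depth `d` of the graph `G`, where `leaf`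
identifies the vertices of `G` with the leaves of `t`. -/
def IsSCDecomposition (d : ℕ) (G : FinGraph) (t : Str (treeSig (d + 1))) (leaf : G.V → t.V) :
    Prop :=
  (∀ i, ∀ x ∈ t.color i, IsLeaf t.parent x) ∧
    ∃ r, IsRootedTree t.parent r ∧ IsSCSubtree t.parent d t.color r G.V G.graph leaf

end ShrubDepth

open ShrubDepth

/-! Reduction by flips. Every symmetric relation on a finite label set is a sum modulo 2 of
boundedly many squares `S × S` (`exists_oddCommon_iff`). In a connection model, boundedly many flips
therefore erase all edges whose ends have the same ancestor at one level and different ancestors at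
the next, for all nodes of that level at once. Doing this level by level (`flipReducible_of_layers`)
gives a uniform `d` such that `d` flips, each followed by passing to the connected components,
reduce every graph of the class to single vertices. The components of the successive levels form a
tree of height at most `d`; with the flipped sets as colors of the leaves it is an SC-decomposition
(`IsCompTree.isSCSubtree`).

From trees to graphs. Two vertices that are together at level `j` and apart at level `j + 1` are not
adjacent after `j + 1` flips, so they are adjacent in the graph exactly if an odd number of these
flips affected the pair (`IsCompDecomposition.treeAdj_iff`). This is a quantifier-free condition on
ancestors and colors.

From graphs to trees. The difficulty is to map each vertex to a representative of its component
without quantifiers. The graph whose components are the nodes of a given level is again layered: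
adjacency depends only on bounded labels and on the level at which the two vertices are separated
(`isLayered_compGraph`). In such a graph distances within components are bounded
(`IsLayered.dist_le`), and boundedly many colors single out one neighbor closer to the
representative, for every vertex (`IsLayered.exists_guide`, `IsLayered.exists_parents`). This
neighbor is the value of a function `f` with a quantifier-free definition, and the representative is
`f^[M] x`, the value of a term. Hence the graph of the next level has a quantifier-free definition
as well, and the construction continues. Finally `d` copies of the vertex set are made, and the
nodes are the fixed points of the representative functions.

Nondeterminism. The colors are guessed by unary lifts. Since `σ` is arbitrary, the guesses can be
confined to colorings from which the deterministic remainder builds a correct tree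
(`exists_coloring`). Deterministic transductions respect isomorphisms (`Transduction.outputs_iso`),
so being such a coloring is an invariant property. With the outputs of `T` on the class taken as the
class of trees, this yields `t ∈ T(B(t))`. -/

namespace ShrubDepth

/-! ### Naming the symbols of a signature in another one -/

/-- Every symbol of `S'` is a symbol of `S`. -/
structure Sig.Emb (S' S : Sig) where
  rel : S'.Rel → S.Rel
  func : S'.Func → S.Func
  arity_eq : ∀ R, S.arity (rel R) = S'.arity R

/-- The `S'`-structure obtained from an `S`-structure by reading every symbol of `S'` as a
symbol of `S`. -/
def Str.pull {S S' : Sig} (A : Str S) (m : S'.Emb S) : Str S' where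
  V := A.V
  rel R v := A.rel (m.rel R) (fun i => v (Fin.cast (m.arity_eq R) i))
  func f := A.func (m.func f)

def Term.map {S S' : Sig} (m : S'.Emb S) {n : ℕ} : Term S' n → Term S n
  | .var i => .var i
  | .app f t => .app (m.func f) (t.map m)

def Formula.map {S S' : Sig} (m : S'.Emb S) : {n : ℕ} → Formula S' n → Formula S n
  | _, .falsum => .falsum
  | _, .rel R ts => .rel (m.rel R) (fun i => (ts (Fin.cast (m.arity_eq R) i)).map m)
  | _, .eq s t => .eq (s.map m) (t.map m)
  | _, .dom f t => .dom (m.func f) (t.map m)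
  | _, .imp φ ψ => .imp (φ.map m) (ψ.map m)
  | _, .all φ => .all (φ.map m)

theorem Term.eval_map {S S' : Sig} (m : S'.Emb S) (A : Str S) {n : ℕ} (v : Fin n → A.V)
    (t : Term S' n) : (t.map m).eval A v = t.eval (A.pull m) v := by
  induction t with
  | var i => rfl
  | app f t ih => simp only [Term.map, Term.eval, ih]; rfl

theorem Formula.holds_map {S S' : Sig} (m : S'.Emb S) (A : Str S) {n : ℕ} (φ : Formula S' n)
    (v : Fin n → A.V) : (φ.map m).Holds A v ↔ φ.Holds (A.pull m) v := by
  induction φ with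
  | falsum => rfl
  | rel R ts =>
    simp only [Formula.map, Formula.Holds, Term.eval_map]
    constructor
    · rintro ⟨w, h, hw⟩
      exact ⟨fun i => w (Fin.cast (m.arity_eq R).symm i), fun i => h (Fin.cast (m.arity_eq R).symm i),
        hw⟩
    · rintro ⟨w, h, hw⟩
      exact ⟨_, fun i => h _, hw⟩
  | eq s t => simp only [Formula.map, Formula.Holds, Term.eval_map]; rfl
  | dom f t => simp only [Formula.map, Formula.Holds, Term.eval_map]; rfl
  | imp φ ψ hφ hψ => simp only [Formula.map, Formula.Holds, hφ, hψ]
  | all φ hφ => simp only [Formula.map, Formula.Holds, hφ]; rfl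

theorem Formula.quantifierFree_map {S S' : Sig} (m : S'.Emb S) {n : ℕ} (φ : Formula S' n) :
    (φ.map m).QuantifierFree ↔ φ.QuantifierFree := by
  induction φ with
  | imp φ ψ hφ hψ => simp only [Formula.map, Formula.QuantifierFree, hφ, hψ]
  | _ => rfl

/-! ### Properties definable by quantifier-free formulas -/

/-- `P` is defined by a quantifier-free formula. -/
def QFDef (S : Sig) (k : ℕ) (P : (A : Str S) → (Fin k → A.V) → Prop) : Prop :=
  ∃ φ : Formula S k, φ.QuantifierFree ∧ ∀ A v, φ.Holds A v ↔ P A v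

namespace QFDef

variable {S : Sig} {k : ℕ} {P Q : (A : Str S) → (Fin k → A.V) → Prop}

theorem congr (h : QFDef S k P) (hPQ : ∀ A v, P A v ↔ Q A v) : QFDef S k Q := by
  obtain ⟨φ, hφ, h⟩ := h
  exact ⟨φ, hφ, fun A v => (h A v).trans (hPQ A v)⟩

theorem false : QFDef S k (fun _ _ => False) := ⟨.falsum, trivial, fun _ _ => Iff.rfl⟩

theorem imp (hP : QFDef S k P) (hQ : QFDef S k Q) : QFDef S k (fun A v => P A v → Q A v) := by
  obtain ⟨φ, hφ, h⟩ := hP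
  obtain ⟨ψ, hψ, h'⟩ := hQ
  exact ⟨.imp φ ψ, ⟨hφ, hψ⟩, fun A v => by simp only [Formula.Holds, h, h']⟩

theorem not (hP : QFDef S k P) : QFDef S k (fun A v => ¬ P A v) := hP.imp false

theorem true : QFDef S k (fun _ _ => True) := false.not.congr fun _ _ => not_false_iff

theorem and (hP : QFDef S k P) (hQ : QFDef S k Q) : QFDef S k (fun A v => P A v ∧ Q A v) :=
  (hP.imp hQ.not).not.congr fun _ _ => by tauto

theorem or (hP : QFDef S k P) (hQ : QFDef S k Q) : QFDef S k (fun A v => P A v ∨ Q A v) :=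
  (hP.not.imp hQ).congr fun A v => by tauto

theorem xor (hP : QFDef S k P) (hQ : QFDef S k Q) : QFDef S k (fun A v => Xor (P A v) (Q A v)) :=
  (hP.and hQ.not).or (hQ.and hP.not)

theorem const (p : Prop) : QFDef S k (fun _ _ => p) := by
  by_cases h : p
  · exact true.congr fun _ _ => by simp [h]
  · exact false.congr fun _ _ => by simp [h]

/-- The index set does not depend on the structure, so this existential is a finite disjunction and
not a quantifier over elements. -/
theorem exists_finite {ι : Type} [Finite ι] {P : ι → (A : Str S) → (Fin k → A.V) → Prop}
    (h : ∀ i, QFDef S k (P i)) : QFDef S k (fun A v => ∃ i, P i A v) := by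
  classical
  cases nonempty_fintype ι
  have key : ∀ s : Finset ι, QFDef S k (fun A v => ∃ i ∈ s, P i A v) := by
    intro s
    induction s using Finset.induction_on with
    | empty => exact false.congr fun A v => by simp
    | insert a s _ ih => exact ((h a).or ih).congr fun A v => by simp
  exact (key Finset.univ).congr fun A v => by simp

theorem rel (R : S.Rel) (s : Fin (S.arity R) → Fin k) :
    QFDef S k (fun A v => A.rel R (fun i => v (s i))) := by
  refine ⟨.rel R (fun i => .var (s i)), trivial, fun A v => ?_⟩
  simp only [Formula.Holds, Term.eval, Option.some.injEq]
  constructor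
  · rintro ⟨w, h, hw⟩
    rwa [show (fun i => v (s i)) = w from funext h]
  · exact fun h => ⟨_, fun _ => rfl, h⟩

theorem eq (s t : Term S k) :
    QFDef S k (fun A v => ∃ x, s.eval A v = some x ∧ t.eval A v = some x) :=
  ⟨.eq s t, trivial, fun _ _ => Iff.rfl⟩

theorem var_eq (i j : Fin k) : QFDef S k (fun A v => v i = v j) :=
  (eq (.var i) (.var j)).congr fun A v => by simp [Term.eval, eq_comm]

theorem func_eq (f : S.Func) (i j : Fin k) : QFDef S k (fun A v => A.func f (v i) = some (v j)) :=
  (eq (.app f (.var i)) (.var j)).congr fun A v => by simp [Term.eval]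

theorem map {S' : Sig} {P : (A : Str S') → (Fin k → A.V) → Prop} (h : QFDef S' k P)
    (m : S'.Emb S) : QFDef S k (fun A v => P (A.pull m) v) := by
  obtain ⟨φ, hφ, h⟩ := h
  exact ⟨φ.map m, (φ.quantifierFree_map m).2 hφ, fun A v => (φ.holds_map m A v).trans (h _ _)⟩

end QFDef

/-- The term applying the function symbol `f` `n` times to the variable `x i`. -/
def Term.iter {S : Sig} {k : ℕ} (f : S.Func) (i : Fin k) : ℕ → Term S k
  | 0 => .var i
  | n + 1 => .app f (Term.iter f i n)

theorem Term.eval_iter {S : Sig} {k : ℕ} (f : S.Func) (i : Fin k) (n : ℕ) (A : Str S)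
    (v : Fin k → A.V) : (Term.iter f i n).eval A v = ancestor (A.func f) n (v i) := by
  induction n with
  | zero => rfl
  | succ n ih => rw [Term.iter, Term.eval, ih, ancestor, ancestor, Function.iterate_succ_apply']

/-! ### Operations realized by deterministic almost quantifier-free transductions -/

/-- `T` is a deterministic almost quantifier-free transduction whose only output on `A` is
`F A`. -/
def Realizes {S S' : Sig} (T : Transduction S S') (F : (A : Str S) → Output A S') : Prop :=
  T.AlmostQuantifierFree ∧ T.Deterministic ∧ ∀ A, T.outputs A = {F A}

/-- `F` is realized by a deterministic almost quantifier-free transduction. -/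
def Realizable {S S' : Sig} (F : (A : Str S) → Output A S') : Prop :=
  ∃ T : Transduction S S', Realizes T F

theorem Realizes.comp {S S' S'' : Sig} {T : Transduction S S'} {J : Transduction S' S''}
    {F : (A : Str S) → Output A S'} {H : (A : Str S') → Output A S''} (hT : Realizes T F)
    (hJ : Realizes J H) : Realizes (T.comp J) (fun A => ⟨(H (F A).str).str,
      fun x => ((H (F A).str).origin x).bind (F A).origin⟩) := by
  refine ⟨⟨hT.1, hJ.1⟩, ⟨hT.2.1, hJ.2.1⟩, fun A => ?_⟩
  ext o
  simp only [Transduction.outputs, hT.2.2, hJ.2.2, Set.mem_singleton_iff, exists_eq_left,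
    Set.mem_ofPred_eq]

theorem Realizable.comp {S S' S'' : Sig} {F : (A : Str S) → Output A S'}
    {H : (A : Str S') → Output A S''} (hF : Realizable F) (hH : Realizable H) :
    Realizable (fun A => (⟨(H (F A).str).str,
      fun x => ((H (F A).str).origin x).bind (F A).origin⟩ : Output A S'')) := by
  obtain ⟨T, hT⟩ := hF
  obtain ⟨J, hJ⟩ := hH
  exact ⟨_, hT.comp hJ⟩

theorem Realizable.congr {S S' : Sig} {F H : (A : Str S) → Output A S'} (hF : Realizable F)
    (h : ∀ A, F A = H A) : Realizable H := by
  obtain rfl : F = H := funext h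
  exact hF

/-- Induction on the number of symbols of `S`: a symbol outside the range of `m` is removed by a
reduct, and when none is left, `m` is a renaming. Injectivity is needed because a symbol cannot be
duplicated by these operations. -/
theorem realizable_pull {S S' : Sig} (m : S'.Emb S) (hr : m.rel.Injective)
    (hf : m.func.Injective) : Realizable (fun A : Str S => ⟨A.pull m, some⟩) := by
  generalize hn : Nat.card S.Rel + Nat.card S.Func = n
  induction n using Nat.strong_induction_on generalizing S with
  | h n ih =>
    by_cases hR : m.rel.Surjective
    · by_cases hF : m.func.Surjective
      · exact ⟨.rename ⟨(Equiv.ofBijective _ ⟨hr, hR⟩).symm, (Equiv.ofBijective _ ⟨hf, hF⟩).symm,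
          m.arity_eq⟩, trivial, trivial, fun A => rfl⟩
      · obtain ⟨f, hf'⟩ := not_forall.1 hF
        have hc : Nat.card {f' // f' ≠ f} < Nat.card S.Func :=
          Finite.card_subtype_lt (x := f) (by simp)
        obtain ⟨T, h1, h2, h3⟩ := ih (Nat.card S.Rel + Nat.card {f' // f' ≠ f}) (by omega)
          (S := S.dropFunc f)
          ⟨m.rel, fun g => ⟨m.func g, fun h => hf' ⟨g, h⟩⟩, m.arity_eq⟩ hr
          (fun a b h => hf (congrArg Subtype.val h)) rfl
        refine ⟨.comp (.reductFunc f) T, ⟨trivial, h1⟩, ⟨trivial, h2⟩, fun A => ?_⟩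
        ext o
        simp only [Transduction.outputs, h3, Set.mem_singleton_iff, exists_eq_left,
          Set.mem_ofPred_eq]
        rfl
    · obtain ⟨R, hR'⟩ := not_forall.1 hR
      have hc : Nat.card {R' // R' ≠ R} < Nat.card S.Rel :=
        Finite.card_subtype_lt (x := R) (by simp)
      obtain ⟨T, h1, h2, h3⟩ := ih (Nat.card {R' // R' ≠ R} + Nat.card S.Func) (by omega)
        (S := S.dropRel R)
        ⟨fun g => ⟨m.rel g, fun h => hR' ⟨g, h⟩⟩, m.func, m.arity_eq⟩
        (fun a b h => hr (congrArg Subtype.val h)) hf rfl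
      refine ⟨.comp (.reductRel R) T, ⟨trivial, h1⟩, ⟨trivial, h2⟩, fun A => ?_⟩
      ext o
      simp only [Transduction.outputs, h3, Set.mem_singleton_iff, exists_eq_left,
        Set.mem_ofPred_eq]
      rfl

/-- `S` with relation symbols `ι` added. -/
abbrev Sig.sumRel (S : Sig) (ι : Type) [Finite ι] (a : ι → ℕ) : Sig where
  Rel := S.Rel ⊕ ι
  Func := S.Func
  arity := Sum.elim S.arity a

/-- `S` with function symbols `ι` added. -/
abbrev Sig.sumFunc (S : Sig) (ι : Type) [Finite ι] : Sig where
  Rel := S.Rel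
  Func := S.Func ⊕ ι
  arity := S.arity

def Str.sumRel {S : Sig} (A : Str S) {ι : Type} [Finite ι] {a : ι → ℕ}
    (P : (i : ι) → (Fin (a i) → A.V) → Prop) : Str (S.sumRel ι a) where
  V := A.V
  rel R := match R with
    | .inl R => A.rel R
    | .inr i => P i
  func := A.func

def Str.sumFunc {S : Sig} (A : Str S) {ι : Type} [Finite ι]
    (g : ι → A.V → Option A.V) : Str (S.sumFunc ι) where
  V := A.V
  rel := A.rel
  func := Sum.elim A.func g

theorem Output.mk_congr {S S' : Sig} {A : Str S} {V : Type} [Finite V]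
    {r r' : (R : S'.Rel) → (Fin (S'.arity R) → V) → Prop} {f f' : S'.Func → V → Option V}
    (o : V → Option A.V) (hr : ∀ R v, r R v ↔ r' R v) (hf : ∀ g x, f g x = f' g x) :
    (⟨⟨V, r, f⟩, o⟩ : Output A S') = ⟨⟨V, r', f'⟩, o⟩ := by
  obtain rfl : r = r' := by ext R v; exact hr R v
  obtain rfl : f = f' := by ext1 g; ext1 x; exact hf g x
  rfl

theorem realizable_addRel {S : Sig} {k : ℕ} {P : (A : Str S) → (Fin k → A.V) → Prop}
    (h : QFDef S k P) : Realizable (fun A => ⟨A.addRel (P A), some⟩) := by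
  obtain ⟨φ, hφ, h⟩ := h
  refine ⟨.extension φ, hφ, trivial, fun A => ?_⟩
  rw [Transduction.outputs, show φ.Holds A = P A from funext fun v => propext (h A v)]

theorem realizable_addFunc {S : Sig} {P : (A : Str S) → (Fin 2 → A.V) → Prop}
    (h : QFDef S 2 P) :
    Realizable (fun A => ⟨A.addFunc (uniqueValue fun x y => P A ![x, y]), some⟩) := by
  obtain ⟨φ, hφ, h⟩ := h
  refine ⟨.funcExtension φ, hφ, trivial, fun A => ?_⟩
  rw [Transduction.outputs, show φ.Holds A = P A from funext fun v => propext (h A v)]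

theorem realizable_restrict {S : Sig} {P : (A : Str S) → A.V → Prop}
    (h : QFDef S 1 (fun A v => P A (v 0))) :
    Realizable (fun A => ⟨A.restrict (P A), fun x => some x.1⟩) := by
  obtain ⟨φ, hφ, h⟩ := h
  refine ⟨.restriction φ, hφ, trivial, fun A => ?_⟩
  rw [Transduction.outputs, show (fun x => φ.Holds A ![x]) = P A from
    funext fun v => propext (h A _)]

theorem rel_cast_congr {ι V : Type} {a : ι → ℕ} (P : (i : ι) → (Fin (a i) → V) → Prop) {i j : ι}
    (h : i = j) (e : a i = a j) (v : Fin (a j) → V) :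
    P i (fun l => v (Fin.cast e l)) ↔ P j v := by
  subst h
  rfl

/-- The relations are added one at a time. Each defining formula mentions only symbols of `S`, which
are still present with the same meaning when its turn comes. -/
theorem realizable_sumRel {S : Sig} (ι : Type) [hι : Finite ι] (a : ι → ℕ)
    (P : (i : ι) → (A : Str S) → (Fin (a i) → A.V) → Prop) (h : ∀ i, QFDef S (a i) (P i)) :
    Realizable (fun A : Str S => ⟨A.sumRel (fun i => P i A), some⟩) := by
  refine @Finite.induction_empty_option (fun ι => ∀ (_ : Finite ι) (a : ι → ℕ)
    (P : (i : ι) → (A : Str S) → (Fin (a i) → A.V) → Prop), (∀ i, QFDef S (a i) (P i)) →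
      Realizable (fun A : Str S =>
        (⟨A.sumRel (fun i => P i A), some⟩ : Output A (S.sumRel ι a)))) ?_ ?_ ?_ ι hι hι a P h
  · intro α β e ih _ a P h
    have := Finite.of_equiv _ e.symm
    let m : (S.sumRel β a).Emb (S.sumRel α (fun i => a (e i))) :=
      ⟨Sum.map id e.symm, id, by rintro (R | i) <;> simp⟩
    refine ((ih this (fun i => a (e i)) (fun i => P (e i)) (fun i => h _)).comp
      (realizable_pull m ?_ fun _ _ h => h)).congr fun A => ?_
    · exact Sum.map_injective.2 ⟨fun _ _ h => h, e.symm.injective⟩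
    · refine Output.mk_congr _ ?_ fun g x => rfl
      rintro (R | i) v
      · rfl
      · exact rel_cast_congr (fun i => P i A) (e.apply_symm_apply i) _ v
  · intro _ a P h
    let m : (S.sumRel PEmpty a).Emb S :=
      ⟨Sum.elim id PEmpty.elim, id, by rintro (R | ⟨⟨⟩⟩); rfl⟩
    refine (realizable_pull m ?_ fun _ _ h => h).congr fun A => ?_
    · rintro (R | ⟨⟨⟩⟩) (R' | ⟨⟨⟩⟩) h; exact congrArg _ h
    · refine Output.mk_congr _ ?_ fun g x => rfl
      rintro (R | ⟨⟨⟩⟩) v; rfl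
  · intro α _ ih _ a P h
    let m : (S.sumRel (Option α) a).Emb ((S.sumRel α (fun i => a (some i))).addRel (a none)) :=
      ⟨Sum.elim (fun R => some (.inl R)) (fun o => o.elim none (fun i => some (.inr i))), id,
        by rintro (R | _ | i) <;> rfl⟩
    refine (((ih inferInstance (fun i => a (some i)) (fun i => P (some i)) (fun i => h _)).comp
      (realizable_addRel ((h none).map (S := S.sumRel α (fun i => a (some i)))
        ⟨Sum.inl, id, fun _ => rfl⟩))).comp (realizable_pull m ?_ fun _ _ h => h)).congr
          fun A => ?_
    · rintro (R | _ | i) (R' | _ | i') h <;> simp_all [m]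
    · refine Output.mk_congr _ ?_ fun g x => rfl
      rintro (R | _ | i) v <;> rfl

theorem realizable_sumFunc {S : Sig} (ι : Type) [hι : Finite ι]
    (P : ι → (A : Str S) → (Fin 2 → A.V) → Prop) (h : ∀ i, QFDef S 2 (P i)) :
    Realizable (fun A : Str S =>
      ⟨A.sumFunc (fun i => uniqueValue fun x y => P i A ![x, y]), some⟩) := by
  refine @Finite.induction_empty_option (fun ι => ∀ (_ : Finite ι)
    (P : ι → (A : Str S) → (Fin 2 → A.V) → Prop), (∀ i, QFDef S 2 (P i)) →
      Realizable (fun A : Str S =>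
        (⟨A.sumFunc (fun i => uniqueValue fun x y => P i A ![x, y]), some⟩ :
          Output A (S.sumFunc ι)))) ?_ ?_ ?_ ι hι hι P h
  · intro α β e ih _ P h
    have := Finite.of_equiv _ e.symm
    let m : (S.sumFunc β).Emb (S.sumFunc α) := ⟨id, Sum.map id e.symm, fun _ => rfl⟩
    refine ((ih this (fun i => P (e i)) (fun i => h _)).comp
      (realizable_pull m (fun _ _ h => h) ?_)).congr fun A => ?_
    · exact Sum.map_injective.2 ⟨fun _ _ h => h, e.symm.injective⟩
    · refine Output.mk_congr _ (fun R v => Iff.rfl) ?_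
      rintro (R | i) v
      · rfl
      · simp [Str.sumFunc, m]
  · intro _ P h
    let m : (S.sumFunc PEmpty).Emb S := ⟨id, Sum.elim id PEmpty.elim, fun _ => rfl⟩
    refine (realizable_pull m (fun _ _ h => h) ?_).congr fun A => ?_
    · rintro (R | ⟨⟨⟩⟩) (R' | ⟨⟨⟩⟩) h; exact congrArg _ h
    · refine Output.mk_congr _ (fun R v => Iff.rfl) ?_
      rintro (R | ⟨⟨⟩⟩) v; rfl
  · intro α _ ih _ P h
    let m : (S.sumFunc (Option α)).Emb (S.sumFunc α).addFunc :=
      ⟨id, Sum.elim (fun R => some (.inl R)) (fun o => o.elim none (fun i => some (.inr i))),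
        fun _ => rfl⟩
    refine (((ih inferInstance (fun i => P (some i)) (fun i => h _)).comp
      (realizable_addFunc ((h none).map (S := S.sumFunc α) ⟨id, Sum.inl, fun _ => rfl⟩))).comp
        (realizable_pull m (fun _ _ h => h) ?_)).congr fun A => ?_
    · rintro (R | _ | i) (R' | _ | i') h <;> simp_all [m]
    · refine Output.mk_congr _ (fun R v => Iff.rfl) ?_
      rintro (R | _ | i) v <;> rfl

/-- Quantifier-free interpretations with unchanged universe. -/
theorem realizable_interp {S S' : Sig}
    {r : (A : Str S) → (R : S'.Rel) → (Fin (S'.arity R) → A.V) → Prop}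
    {f : (A : Str S) → S'.Func → (Fin 2 → A.V) → Prop}
    (hr : ∀ R, QFDef S (S'.arity R) (fun A => r A R)) (hf : ∀ g, QFDef S 2 (fun A => f A g)) :
    Realizable (fun A : Str S =>
      (⟨⟨A.V, r A, fun g => uniqueValue fun x y => f A g ![x, y]⟩, some⟩ : Output A S')) := by
  -- All new symbols are added next to the old ones before any old one is dropped, so every symbol
  -- is redefined in terms of the original structure.
  refine (((realizable_sumRel S'.Rel S'.arity _ hr).comp (realizable_sumFunc S'.Func _
    fun g => (hf g).map (S := S.sumRel S'.Rel S'.arity) ⟨Sum.inl, id, fun _ => rfl⟩)).comp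
    (realizable_pull (S' := S') ⟨Sum.inr, Sum.inr, fun _ => rfl⟩ Sum.inr_injective
      Sum.inr_injective)).congr fun A => rfl

theorem uniqueValue_eq {V : Type} {P : V → V → Prop} {x : V} {o : Option V}
    (h : ∀ y, P x y ↔ o = some y) : uniqueValue P x = o := by
  unfold uniqueValue
  split_ifs with hx
  · exact ((h _).1 hx.choose_spec.1).symm
  · cases o with
    | none => rfl
    | some y => exact absurd ⟨y, (h y).2 rfl, fun z hz => by simpa using ((h z).1 hz).symm⟩ hx

/-! ### Invariance under isomorphisms -/

namespace Str.Iso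

variable {S : Sig}

def refl (A : Str S) : A.Iso A := ⟨Equiv.refl _, fun _ _ => Iff.rfl, fun f x => by simp⟩

def symm {A B : Str S} (e : A.Iso B) : B.Iso A where
  toEquiv := e.toEquiv.symm
  rel_iff R v := by rw [← e.rel_iff]; simp
  func_eq f x := by
    have := e.func_eq f (e.toEquiv.symm x)
    rw [Equiv.apply_symm_apply] at this
    simp [this, Function.comp_def]

def trans {A B C : Str S} (e : A.Iso B) (e' : B.Iso C) : A.Iso C where
  toEquiv := e.toEquiv.trans e'.toEquiv
  rel_iff R v := (e'.rel_iff R _).trans (e.rel_iff R v)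
  func_eq f x := by simp [e'.func_eq, e.func_eq, Function.comp_def]

variable {A B : Str S} (e : A.Iso B)

theorem term_eval {n : ℕ} (v : Fin n → A.V) (t : Term S n) :
    t.eval B (fun i => e.toEquiv (v i)) = (t.eval A v).map e.toEquiv := by
  induction t with
  | var i => rfl
  | app f t ih =>
    simp only [Term.eval, ih]
    cases t.eval A v with
    | none => rfl
    | some x => simp [e.func_eq]

theorem holds_iff {n : ℕ} (φ : Formula S n) (v : Fin n → A.V) :
    φ.Holds B (fun i => e.toEquiv (v i)) ↔ φ.Holds A v := by
  induction φ with
  | falsum => rfl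
  | rel R ts =>
    simp only [Formula.Holds, e.term_eval]
    constructor
    · rintro ⟨w, h, hw⟩
      refine ⟨fun i => e.toEquiv.symm (w i), fun i => ?_, ?_⟩
      · obtain ⟨a, ha, ha'⟩ := Option.map_eq_some_iff.1 (h i)
        simp [ha, ← ha']
      · rw [← e.rel_iff]; simpa using hw
    · rintro ⟨w, h, hw⟩
      exact ⟨fun i => e.toEquiv (w i), fun i => by simp [h], (e.rel_iff R w).2 hw⟩
  | eq s t =>
    simp only [Formula.Holds, e.term_eval]
    constructor
    · rintro ⟨x, h, h'⟩
      obtain ⟨a, ha, rfl⟩ := Option.map_eq_some_iff.1 h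
      obtain ⟨b, hb, hb'⟩ := Option.map_eq_some_iff.1 h'
      exact ⟨a, ha, by rw [hb, e.toEquiv.injective hb']⟩
    · rintro ⟨x, h, h'⟩
      exact ⟨e.toEquiv x, by simp [h], by simp [h']⟩
  | dom f t =>
    simp only [Formula.Holds, e.term_eval]
    constructor
    · rintro ⟨x, y, h, h'⟩
      obtain ⟨a, ha, rfl⟩ := Option.map_eq_some_iff.1 h
      rw [e.func_eq] at h'
      obtain ⟨b, hb, hb'⟩ := Option.map_eq_some_iff.1 h'
      exact ⟨a, b, ha, hb⟩
    · rintro ⟨x, y, h, h'⟩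
      exact ⟨e.toEquiv x, e.toEquiv y, by simp [h], by simp [e.func_eq, h']⟩
  | imp φ ψ hφ hψ => simp only [Formula.Holds, hφ, hψ]
  | all φ hφ =>
    simp only [Formula.Holds]
    rw [← e.toEquiv.forall_congr_right]
    refine forall_congr' fun x => ?_
    rw [← hφ]
    refine iff_of_eq (congrArg _ (funext fun i => ?_))
    refine Fin.lastCases ?_ (fun j => ?_) i <;> simp

end Str.Iso

theorem uniqueValue_map {V W : Type} (e : V ≃ W) {P : V → V → Prop} {Q : W → W → Prop}
    (h : ∀ x y, Q (e x) (e y) ↔ P x y) (x : V) :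
    uniqueValue Q (e x) = (uniqueValue P x).map e := by
  by_cases hx : ∃! y, P x y
  · obtain ⟨y, hy, hy'⟩ := hx
    rw [uniqueValue_eq (o := some (e y)), uniqueValue_eq (o := some y), Option.map_some]
    · exact fun z => ⟨fun hz => by rw [hy' z hz], by rintro ⟨⟩; exact hy⟩
    · intro z
      obtain ⟨z, rfl⟩ := e.surjective z
      rw [h, Option.some.injEq, e.apply_eq_iff_eq]
      exact ⟨fun hz => (hy' z hz).symm, by rintro rfl; exact hy⟩
  · have hx' : ¬ ∃! y, Q (e x) y := by
      rintro ⟨y, hy, hy'⟩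
      obtain ⟨y, rfl⟩ := e.surjective y
      exact hx ⟨y, (h _ _).1 hy, fun z hz => e.injective (hy' _ ((h _ _).2 hz))⟩
    simp [uniqueValue, hx, hx']

open Classical in
theorem map_bind_dite {V W : Type} (e : V ≃ W) {P : V → Prop} {Q : W → Prop}
    (h : ∀ x, P x ↔ Q (e x)) (o : Option V) :
    ((o.map e).bind fun y => if h : Q y then some (⟨y, h⟩ : {y // Q y}) else none) =
      (o.bind fun y => if h : P y then some (⟨y, h⟩ : {y // P y}) else none).map
        (e.subtypeEquiv h) := by
  cases o with
  | none => rfl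
  | some y =>
    by_cases hy : P y
    · have hy' := (h y).1 hy
      simp [hy, hy']
    · have hy' := mt (h y).2 hy
      simp [hy, hy']

/-- Isomorphism of outputs, over an isomorphism of the inputs. -/
def Output.Equivalent {S S' : Sig} {A B : Str S} (θ : A.V ≃ B.V) (o : Output A S')
    (o' : Output B S') : Prop :=
  ∃ e : o.str.Iso o'.str, ∀ x, o'.origin (e.toEquiv x) = (o.origin x).map θ

/-- Only a unary lift can distinguish isomorphic structures, since its `σ` need not be invariant.
Every other operation is given by formulas or by a canonical construction. -/
theorem Transduction.outputs_iso {S S' : Sig} (T : Transduction S S') (hT : T.Deterministic)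
    {A B : Str S} (θ : A.Iso B) {o : Output A S'} (ho : o ∈ T.outputs A) :
    ∃ o' ∈ T.outputs B, o.Equivalent θ.toEquiv o' := by
  induction T with
  | extension φ =>
    obtain rfl := ho
    refine ⟨_, rfl, ⟨θ.toEquiv, ?_, θ.func_eq⟩, fun x => rfl⟩
    rintro (_ | R) v
    · exact θ.holds_iff φ v
    · exact θ.rel_iff R v
  | restriction ψ =>
    obtain rfl := ho
    have h : ∀ x, ψ.Holds A ![x] ↔ ψ.Holds B ![θ.toEquiv x] := fun x => by
      rw [← θ.holds_iff ψ]
      refine iff_of_eq (congrArg _ (funext fun i => ?_))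
      fin_cases i; rfl
    refine ⟨_, rfl, ⟨θ.toEquiv.subtypeEquiv h, ?_, ?_⟩, fun x => rfl⟩
    · exact fun R v => θ.rel_iff R _
    · intro f x
      change (B.func f (θ.toEquiv x.1)).bind _ = ((A.func f x.1).bind _).map _
      rw [θ.func_eq]
      exact map_bind_dite θ.toEquiv h (A.func f x.1)
  | reductRel R =>
    obtain rfl := ho
    exact ⟨_, rfl, ⟨θ.toEquiv, fun R' v => θ.rel_iff _ v, θ.func_eq⟩, fun x => rfl⟩
  | reductFunc f =>
    obtain rfl := ho
    exact ⟨_, rfl, ⟨θ.toEquiv, θ.rel_iff, fun f' x => θ.func_eq _ x⟩, fun x => rfl⟩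
  | @copying S₀ =>
    obtain rfl := ho
    refine ⟨_, rfl, ⟨Equiv.sumCongr θ.toEquiv θ.toEquiv, ?_, ?_⟩, ?_⟩
    · have hl : ∀ (x : A.V ⊕ A.V) (y : B.V),
          Equiv.sumCongr θ.toEquiv θ.toEquiv x = .inl y ↔ x = .inl (θ.toEquiv.symm y) := by
        rintro (x | x) y <;> simp [Equiv.eq_symm_apply]
      have hr : ∀ (x : A.V ⊕ A.V) (y : B.V),
          Equiv.sumCongr θ.toEquiv θ.toEquiv x = .inr y ↔ x = .inr (θ.toEquiv.symm y) := by
        rintro (x | x) y <;> simp [Equiv.eq_symm_apply]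
      have hR : ∀ (R : S₀.Rel) w, A.rel R (fun i => θ.toEquiv.symm (w i)) ↔ B.rel R w :=
        fun R w => by rw [← θ.rel_iff]; simp
      rintro (_ | _ | R) (v : Fin _ → A.V ⊕ A.V)
      · change (∃ x : B.V, _) ↔ ∃ x : A.V, _
        rw [← θ.toEquiv.symm.exists_congr_right]
        exact exists_congr fun x => or_congr (and_congr (hl _ _) (hr _ _))
          (and_congr (hr _ _) (hl _ _))
      · change (∃ x : B.V, _) ↔ ∃ x : A.V, _
        rw [← θ.toEquiv.symm.exists_congr_right]
        exact exists_congr fun x => hr _ _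
      · refine or_congr ?_ ?_
        · rw [← (Equiv.arrowCongr (Equiv.refl _) θ.toEquiv.symm).exists_congr_right]
          exact exists_congr fun w => and_congr (hR _ _).symm
            (funext_iff.trans ((forall_congr' fun i => hl _ _).trans funext_iff.symm))
        · rw [← (Equiv.arrowCongr (Equiv.refl _) θ.toEquiv.symm).exists_congr_right]
          exact exists_congr fun w => and_congr (hR _ _).symm
            (funext_iff.trans ((forall_congr' fun i => hr _ _).trans funext_iff.symm))
    · rintro f (x | x)
      · change (B.func f (θ.toEquiv x)).map Sum.inl = ((A.func f x).map Sum.inl).map _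
        rw [θ.func_eq]; cases A.func f x <;> rfl
      · change (B.func f (θ.toEquiv x)).map Sum.inr = ((A.func f x).map Sum.inr).map _
        rw [θ.func_eq]; cases A.func f x <;> rfl
    · rintro (x | x) <;> rfl
  | funcExtension φ =>
    obtain rfl := ho
    refine ⟨_, rfl, ⟨θ.toEquiv, θ.rel_iff, ?_⟩, fun x => rfl⟩
    rintro (_ | f) x
    · refine uniqueValue_map θ.toEquiv (P := fun x y => φ.Holds A ![x, y])
        (Q := fun x y => φ.Holds B ![x, y]) (fun x y => ?_) x
      rw [← θ.holds_iff φ]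
      refine iff_of_eq (congrArg _ (funext fun i => ?_))
      fin_cases i <;> rfl
    · exact θ.func_eq f x
  | unaryLift σ hσ => exact hT.elim
  | rename e =>
    obtain rfl := ho
    exact ⟨_, rfl, ⟨θ.toEquiv, fun R' v => θ.rel_iff _ _, fun f x => θ.func_eq _ x⟩, fun x => rfl⟩
  | comp I J hI hJ =>
    obtain ⟨o₁, h₁, o₂, h₂, rfl⟩ := ho
    obtain ⟨o₁', h₁', e₁, he₁⟩ := hI hT.1 θ h₁
    obtain ⟨o₂', h₂', e₂, he₂⟩ := hJ hT.2 e₁ h₂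
    refine ⟨_, ⟨o₁', h₁', o₂', h₂', rfl⟩, e₂, fun x => ?_⟩
    simp only [he₂]
    cases o₂.origin x with
    | none => rfl
    | some y => exact he₁ y

theorem Transduction.exists_outputs_eq {S S' : Sig} (T : Transduction S S')
    (hT : T.Deterministic) (A : Str S) : ∃ o, T.outputs A = {o} := by
  induction T with
  | unaryLift σ hσ => exact hT.elim
  | comp I J hI hJ =>
    obtain ⟨o₁, h₁⟩ := hI hT.1 A
    obtain ⟨o₂, h₂⟩ := hJ hT.2 o₁.str
    exact ⟨⟨o₂.str, fun x => (o₂.origin x).bind o₁.origin⟩, by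
      ext o
      simp only [Transduction.outputs, h₁, Set.mem_singleton_iff, exists_eq_left, h₂,
        Set.mem_ofPred_eq]⟩
  | _ => exact ⟨_, rfl⟩

/-- Up to isomorphism, `o` is an output of `T` on `A`. -/
def Produces {S S' : Sig} (T : Transduction S S') (A : Str S) (o : Output A S') : Prop :=
  ∃ o' ∈ T.outputs A, o'.Equivalent (Equiv.refl _) o

theorem Output.Equivalent.rfl' {S S' : Sig} {A : Str S} (o : Output A S') :
    o.Equivalent (Equiv.refl _) o := ⟨.refl _, fun x => by simp [Str.Iso.refl]⟩

theorem Output.Equivalent.trans {S S' : Sig} {A B C : Str S} {θ : A.V ≃ B.V} {η : B.V ≃ C.V}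
    {o : Output A S'} {o' : Output B S'} {o'' : Output C S'} (h : o.Equivalent θ o')
    (h' : o'.Equivalent η o'') : o.Equivalent (θ.trans η) o'' := by
  obtain ⟨e, he⟩ := h
  obtain ⟨e', he'⟩ := h'
  refine ⟨e.trans e', fun x => ?_⟩
  change o''.origin (e'.toEquiv (e.toEquiv x)) = _
  rw [he', he, Option.map_map]
  rfl

theorem Realizes.produces {S S' : Sig} {T : Transduction S S'} {F : (A : Str S) → Output A S'}
    (h : Realizes T F) (A : Str S) : Produces T A (F A) :=
  ⟨_, by rw [h.2.2 A]; exact rfl, .rfl' _⟩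

theorem Produces.trans {S S' : Sig} {T : Transduction S S'} {A : Str S} {o o' : Output A S'}
    (h : Produces T A o) (h' : o.Equivalent (Equiv.refl _) o') : Produces T A o' := by
  obtain ⟨o₁, h₁, h₂⟩ := h
  exact ⟨o₁, h₁, h₂.trans h'⟩

/-- The second transduction really runs on an isomorphic copy of `o.str`. Determinism of `J` makes
its output there isomorphic to `o₂`. -/
theorem Produces.comp {S S' S'' : Sig} {T : Transduction S S'} {J : Transduction S' S''}
    {A : Str S} {o : Output A S'} {o₂ : Output o.str S''} (hT : Produces T A o)
    (hJ : Produces J o.str o₂) (hdet : J.Deterministic) :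
    Produces (T.comp J) A ⟨o₂.str, fun x => (o₂.origin x).bind o.origin⟩ := by
  obtain ⟨o', ho', e, he⟩ := hT
  obtain ⟨o₃, ho₃, e₃, he₃⟩ := hJ
  obtain ⟨o₄, ho₄, e₄, he₄⟩ := J.outputs_iso hdet e.symm ho₃
  refine ⟨_, ⟨o', ho', o₄, ho₄, rfl⟩, e₄.symm.trans e₃, fun x => ?_⟩
  obtain ⟨x, rfl⟩ := e₄.toEquiv.surjective x
  have h3 := he₃ x
  have h4 := he₄ x
  have : (e₄.symm.trans e₃).toEquiv (e₄.toEquiv x) = e₃.toEquiv x :=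
    congrArg e₃.toEquiv (e₄.toEquiv.symm_apply_apply x)
  simp only [this, h3, h4]
  cases o₃.origin x with
  | none => rfl
  | some y =>
    have := he (e.toEquiv.symm y)
    rw [Equiv.apply_symm_apply] at this
    exact this

/-! ### Copies of the vertex set and the tree of fixed points -/

/-- The signature with `d + 1` unary predicates and `d + 1` functions. -/
abbrev repSig (d : ℕ) : Sig where
  Rel := Fin (d + 1)
  Func := Fin (d + 1)
  arity _ := 1

def repStr {d : ℕ} {V : Type} [Finite V] (W : Fin (d + 1) → Set V) (g : Fin (d + 1) → V → V) :
    Str (repSig d) where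
  V := V
  rel l v := v (0 : Fin 1) ∈ W l
  func k x := some (g k x)

/-- The signature for copies of `repSig d`-structures: a unary predicate for each copy, and
a function mapping each element to the element of the original structure it is a copy of. -/
abbrev levelSig (d : ℕ) (κ : Type) [Finite κ] : Sig where
  Rel := Fin (d + 1) ⊕ Option κ
  Func := Option (Fin (d + 1))
  arity _ := 1

/-- The level `none` is the base level, consisting of the original elements. Colors and the
functions `g k` are present on every level, and the function symbol `none` projects to the base. -/
def levelStr {d : ℕ} {V : Type} [Finite V] (κ : Type) [Finite κ] (W : Fin (d + 1) → Set V)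
    (g : Fin (d + 1) → V → V) : Str (levelSig d κ) where
  V := V × Option κ
  rel R v := match R with
    | .inl l => (v (0 : Fin 1)).1 ∈ W l
    | .inr k => (v (0 : Fin 1)).2 = k
  func f x := match f with
    | none => some (x.1, none)
    | some k => some (g k x.1, x.2)

theorem Str.restrict_func {S : Sig} {A : Str S} {P : A.V → Prop} {f : S.Func} {x : {x // P x}}
    {y : A.V} (hy : P y) (h : A.func f x.1 = some y) :
    (A.restrict P).func f x = some (⟨y, hy⟩ : {x // P x}) := by
  simp [Str.restrict, h, hy]

theorem realizes_copying (S : Sig) : Realizes (.copying (S := S))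
    (fun A => ⟨A.copy, Sum.elim some (fun _ => none)⟩) := ⟨trivial, trivial, fun _ => rfl⟩

theorem Str.copy_rel_inl {S : Sig} (A : Str S) (R : S.Rel) (hR : S.arity R ≠ 0)
    (w : Fin (S.arity R) → A.V) :
    A.copy.rel (some (some R)) (fun i => .inl (w i)) ↔ A.rel R w := by
  constructor
  · rintro (⟨w', h, h'⟩ | ⟨w', h, h'⟩)
    · rwa [show w = w' from funext fun i => Sum.inl_injective (congrFun h' i)]
    · cases congrFun h' ⟨0, Nat.pos_of_ne_zero hR⟩
  · exact fun h => .inl ⟨w, h, rfl⟩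

theorem Str.copy_rel_inr {S : Sig} (A : Str S) (R : S.Rel) (hR : S.arity R ≠ 0)
    (w : Fin (S.arity R) → A.V) :
    A.copy.rel (some (some R)) (fun i => .inr (w i)) ↔ A.rel R w := by
  constructor
  · rintro (⟨w', h, h'⟩ | ⟨w', h, h'⟩)
    · cases congrFun h' ⟨0, Nat.pos_of_ne_zero hR⟩
    · rwa [show w = w' from funext fun i => Sum.inr_injective (congrFun h' i)]
  · exact fun h => .inr ⟨w, h, rfl⟩

section Step

variable {d : ℕ} {κ : Type} [Finite κ]

/-- The elements kept after copying: the original ones, and the copies of elements of the base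
level. -/
def keepCopy (A : Str (((levelSig d κ).addRel 1).addRel 2)) (x : A.V) : Prop :=
  ¬ A.rel (some none) (fun _ => x) ∨ A.rel (some (some (.inr none))) (fun _ => x)

theorem qfDef_keepCopy : QFDef (((levelSig d κ).addRel 1).addRel 2) 1
    (fun A v => keepCopy A (v 0)) :=
  (QFDef.rel (S := ((levelSig d κ).addRel 1).addRel 2) (some none) (fun _ => 0)).not.or
    (QFDef.rel (S := ((levelSig d κ).addRel 1).addRel 2) (some (some (.inr none))) (fun _ => 0))

def stepRel (A : Str (((levelSig d κ).addRel 1).addRel 2)) :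
    (R : (levelSig d (Option κ)).Rel) → (Fin 1 → A.V) → Prop
  | .inl l, v => A.rel (some (some (.inl l))) (fun _ => v 0)
  | .inr none, v => ¬ A.rel (some none) (fun _ => v 0) ∧
      A.rel (some (some (.inr none))) (fun _ => v 0)
  | .inr (some none), v => A.rel (some none) (fun _ => v 0)
  | .inr (some (some k)), v => A.rel (some (some (.inr (some k)))) (fun _ => v 0)

def stepFunc (A : Str (((levelSig d κ).addRel 1).addRel 2)) :
    Option (Fin (d + 1)) → (Fin 2 → A.V) → Prop
  | none, v => (¬ A.rel (some none) (fun _ => v 0) ∧ A.func none (v 0) = some (v 1)) ∨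
      (A.rel (some none) (fun _ => v 0) ∧ A.rel none v)
  | some k, v => A.func (some k) (v 0) = some (v 1)

theorem qfDef_stepRel (R : (levelSig d (Option κ)).Rel) :
    QFDef (((levelSig d κ).addRel 1).addRel 2) 1 (fun A => stepRel A R) := by
  have h := QFDef.rel (S := ((levelSig d κ).addRel 1).addRel 2) (k := 1)
  rcases R with l | _ | _ | k
  · exact h (some (some (.inl l))) (fun _ => 0)
  · exact (h (some none) (fun _ => 0)).not.and (h (some (some (.inr none))) (fun _ => 0))
  · exact h (some none) (fun _ => 0)
  · exact h (some (some (.inr (some k)))) (fun _ => 0)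

theorem qfDef_stepFunc (f : Option (Fin (d + 1))) :
    QFDef (((levelSig d κ).addRel 1).addRel 2) 2 (fun A => stepFunc A f) := by
  have h := QFDef.rel (S := ((levelSig d κ).addRel 1).addRel 2) (k := 2)
  have h' := QFDef.func_eq (S := ((levelSig d κ).addRel 1).addRel 2) (k := 2)
  rcases f with _ | k
  · exact ((h (some none) (fun _ => 0)).not.and (h' none 0 1)).or
      ((h (some none) (fun _ => 0)).and (h none id))
  · exact h' (some k) 0 1

/-- Copying doubles all levels. Only the copy of the base level is kept, so exactly one level is
added; it is numbered `some none`, and the relation created by copying provides its projection to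
the base. -/
theorem exists_step : ∃ T : Transduction (levelSig d κ) (levelSig d (Option κ)),
    T.AlmostQuantifierFree ∧ T.Deterministic ∧
    ∀ (V : Type) [Finite V] (W : Fin (d + 1) → Set V) (g : Fin (d + 1) → V → V),
      Produces T (levelStr κ W g) ⟨levelStr (Option κ) W g,
        fun x => x.2.elim (some (x.1, none)) (fun k => k.elim none (fun k => some (x.1, some k)))⟩ := by
  obtain ⟨R, hR⟩ := realizable_restrict (qfDef_keepCopy (d := d) (κ := κ))
  obtain ⟨I, hI⟩ := realizable_interp (S' := levelSig d (Option κ))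
    (qfDef_stepRel (d := d) (κ := κ)) qfDef_stepFunc
  have H := ((realizes_copying (levelSig d κ)).comp hR).comp hI
  refine ⟨_, H.1, H.2.1, fun V _ W g => (H.produces _).trans ?_⟩
  clear H hI I
  let toF : {z : (V × Option κ) ⊕ (V × Option κ) // keepCopy (levelStr κ W g).copy z} →
      V × Option (Option κ) := fun z => match z.1 with
    | .inl (x, none) => (x, none)
    | .inl (x, some k) => (x, some (some k))
    | .inr (x, _) => (x, some none)
  have hm : ∀ x, ¬ (levelStr κ W g).copy.rel (some none) (fun _ => .inl x) := by
    rintro x ⟨y, hy⟩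
    cases hy
  have hL := fun x R => (levelStr κ W g).copy_rel_inl R one_ne_zero (fun _ => x)
  have hR := fun x R => (levelStr κ W g).copy_rel_inr R one_ne_zero (fun _ => x)
  have hk1 : ∀ x, keepCopy (levelStr κ W g).copy (.inl x) := fun x => .inl (hm x)
  have hk2 : ∀ x, keepCopy (levelStr κ W g).copy (.inr (x, none)) :=
    fun x => .inr ((Str.copy_rel_inr _ _ (by simp) _).2 rfl)
  have hk3 : ∀ x k, ¬ keepCopy (levelStr κ W g).copy (.inr (x, some k)) := by
    rintro x k (h | h)
    · exact h ⟨_, rfl⟩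
    · cases (Str.copy_rel_inr _ _ (by simp) _).1 h
  let e : {z : (V × Option κ) ⊕ (V × Option κ) // keepCopy (levelStr κ W g).copy z} ≃
      V × Option (Option κ) :=
    { toFun := toF
      invFun := fun z => match z with
        | (x, none) => ⟨.inl (x, none), hk1 _⟩
        | (x, some none) => ⟨.inr (x, none), hk2 _⟩
        | (x, some (some k)) => ⟨.inl (x, some k), hk1 _⟩
      left_inv := by
        rintro ⟨⟨x, _ | k⟩ | ⟨x, _ | k⟩, h⟩
        · rfl
        · rfl
        · rfl
        · exact (hk3 _ _ h).elim
      right_inv := by rintro ⟨x, _ | _ | k⟩ <;> rfl }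
  refine ⟨⟨e, ?_, ?_⟩, ?_⟩
  · intro R v
    obtain ⟨z, rfl⟩ : ∃ z, v = fun _ => z := ⟨v (0 : Fin 1), funext fun i => by
      rw [Subsingleton.elim i (0 : Fin 1)]⟩
    change (levelStr (Option κ) W g).rel R (fun _ => e z) ↔
      stepRel ((levelStr κ W g).copy.restrict (keepCopy _)) R (fun _ => z)
    obtain ⟨⟨x, _ | k⟩ | ⟨x, _ | k⟩, h⟩ := z
    · rcases R with l | _ | _ | k'
      · exact (hL (x, none) (.inl l)).symm
      · exact iff_of_true rfl ⟨hm _, (hL _ _).2 rfl⟩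
      · exact iff_of_false (by rintro ⟨⟩) (hm _)
      · exact iff_of_false (by rintro ⟨⟩) (fun h => by cases (hL _ _).1 h)
    · rcases R with l | _ | _ | k'
      · exact (hL (x, some k) (.inl l)).symm
      · exact iff_of_false (by rintro ⟨⟩) (fun h => by cases (hL _ _).1 h.2)
      · exact iff_of_false (by rintro ⟨⟩) (hm _)
      · exact Option.some_inj.trans (hL (x, some k) (.inr (some k'))).symm
    · rcases R with l | _ | _ | k'
      · exact (hR (x, none) (.inl l)).symm
      · exact iff_of_false (by rintro ⟨⟩) (fun h => h.1 ⟨_, rfl⟩)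
      · exact iff_of_true rfl ⟨_, rfl⟩
      · exact iff_of_false (by rintro ⟨⟩) (fun h => by cases (hR _ _).1 h)
    · exact (hk3 _ _ h).elim
  · intro f z
    change (levelStr (Option κ) W g).func f (e z) = (uniqueValue (fun x y => stepFunc
      ((levelStr κ W g).copy.restrict (keepCopy _)) f ![x, y]) z).map e
    rcases f with _ | i
    · have hu : ∀ x h, uniqueValue (fun x y => stepFunc
          ((levelStr κ W g).copy.restrict (keepCopy _)) none ![x, y]) ⟨.inl x, h⟩ =
            some ⟨.inl (x.1, none), hk1 _⟩ := fun x h => uniqueValue_eq fun w => by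
        refine (or_iff_left fun h => hm x h.1).trans ((and_iff_right (hm x)).trans ?_)
        change Str.func _ none _ = some w ↔ _
        exact iff_of_eq (congrArg (· = some w) (Str.restrict_func (hk1 _) rfl))
      obtain ⟨⟨x, _ | k⟩ | ⟨x, _ | k⟩, h⟩ := z
      · exact (congrArg (Option.map e) (hu _ h)).symm
      · exact (congrArg (Option.map e) (hu _ h)).symm
      · refine (congrArg (Option.map e) (uniqueValue_eq (o := some ⟨.inl (x, none), hk1 _⟩)
          fun w => ?_)).symm
        · refine (or_iff_right fun h => h.1 ⟨_, rfl⟩).trans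
            ((and_iff_right (by exact ⟨_, rfl⟩)).trans ⟨?_, ?_⟩)
          · rintro ⟨y, ⟨h1, h2⟩ | ⟨h1, h2⟩⟩
            · cases h1
            · refine congrArg some (Subtype.ext ?_)
              exact (congrArg Sum.inl (Sum.inr_injective h1)).trans (show w.1 = _ from h2).symm
          · rintro ⟨⟩
            exact ⟨_, .inr ⟨rfl, rfl⟩⟩
      · exact (hk3 _ _ h).elim
    · have hu : ∀ z w (hw : keepCopy (levelStr κ W g).copy w),
          (levelStr κ W g).copy.func (some i) z.1 = some w → uniqueValue (fun x y => stepFunc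
            ((levelStr κ W g).copy.restrict (keepCopy _)) (some i) ![x, y]) z = some ⟨w, hw⟩ :=
        fun z w hw h => uniqueValue_eq fun w' => by
          change Str.func _ (some i) _ = some w' ↔ _
          exact iff_of_eq (congrArg (· = some w') (Str.restrict_func hw h))
      obtain ⟨⟨x, _ | k⟩ | ⟨x, _ | k⟩, h⟩ := z
      · exact (congrArg (Option.map e) (hu _ (.inl (g i x, none)) (hk1 _) rfl)).symm
      · exact (congrArg (Option.map e) (hu _ (.inl (g i x, some k)) (hk1 _) rfl)).symm
      · exact (congrArg (Option.map e) (hu _ (.inr (g i x, none)) (hk2 _) rfl)).symm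
      · exact (hk3 _ _ h).elim
  · rintro ⟨⟨x, _ | k⟩ | ⟨x, _ | k⟩, h⟩
    · rfl
    · rfl
    · rfl
    · exact (hk3 _ _ h).elim

end Step

/-- The index type `κ` is an iterated `Option`, and `ε` numbers the levels. That the base level gets
number `0` matters later: it becomes the level of the leaves. -/
theorem exists_copies (d n : ℕ) : ∃ (κ : Type) (_ : Finite κ) (ε : Option κ ≃ Fin (n + 1))
    (T : Transduction (repSig d) (levelSig d κ)), ε none = 0 ∧
    T.AlmostQuantifierFree ∧ T.Deterministic ∧
    ∀ (V : Type) [Finite V] (W : Fin (d + 1) → Set V) (g : Fin (d + 1) → V → V),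
      Produces T (repStr W g)
        ⟨levelStr κ W g, fun x => x.2.elim (some x.1) (fun _ => none)⟩ := by
  induction n with
  | zero =>
    have hr : ∀ R : (levelSig d Empty).Rel, QFDef (repSig d) 1 (fun A v =>
        R.elim (fun l => A.rel l (fun _ => v 0)) (fun _ => True)) := by
      rintro (l | k)
      · exact .rel (S := repSig d) l _
      · exact .true
    have hf : ∀ f : (levelSig d Empty).Func, QFDef (repSig d) 2 (fun A v =>
        f.elim (v 0 = v 1) (fun k => A.func k (v 0) = some (v 1))) := by
      rintro (_ | k)
      · exact .var_eq 0 1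
      · exact .func_eq (S := repSig d) k 0 1
    obtain ⟨T, hT⟩ := realizable_interp (S' := levelSig d Empty) hr hf
    refine ⟨Empty, inferInstance, (Equiv.ofUnique (Option Empty) (Fin 1)), T, rfl, hT.1, hT.2.1,
      fun V _ W g => (hT.produces _).trans
        ⟨⟨(Equiv.prodUnique V (Option Empty)).symm, ?_, ?_⟩, fun x => rfl⟩⟩
    · rintro (l | _ | ⟨⟨⟩⟩) v
      · change _ ↔ v 0 ∈ W l
        rfl
      · exact iff_of_true rfl trivial
    · rintro (_ | k) x
      · exact (congrArg (Option.map (Equiv.prodUnique V (Option Empty)).symm)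
          (uniqueValue_eq (P := fun x y : V => x = y) (o := some x)
            fun y => Option.some_inj.symm)).symm
      · exact (congrArg (Option.map (Equiv.prodUnique V (Option Empty)).symm)
          (uniqueValue_eq (P := fun x y : V => some (g k x) = some y) (o := some (g k x))
            fun y => Iff.rfl)).symm
  | succ n ih =>
    obtain ⟨κ, _, ε, T, hε, h1, h2, h3⟩ := ih
    obtain ⟨J, hJ1, hJ2, hJ3⟩ := exists_step (d := d) (κ := κ)
    -- The base keeps number `0`, the new level gets number `1`, and the other levels move up by
    -- one. All levels are copies of the base, so their order is immaterial.
    refine ⟨Option κ, inferInstance, (Equiv.optionCongr ε).trans (finSuccEquiv _).symm, T.comp J,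
      by simp, ⟨h1, hJ1⟩, ⟨h2, hJ2⟩, fun V _ W g => ?_⟩
    refine ((h3 V W g).comp (hJ3 V W g) hJ2).trans ⟨.refl _, ?_⟩
    rintro ⟨x, _ | _ | k⟩ <;> rfl

/-- The tree of height `d` whose nodes at distance `k` from the leaves are the fixed points of
`g k`, where the colors are put on the leaves. -/
noncomputable def treeStr {d : ℕ} {V : Type} [Finite V] (W : Fin (d + 1) → Set V)
    (g : Fin (d + 1) → V → V) : Str (treeSig (d + 1)) where
  V := {x : V × Fin (d + 1) // g x.2 x.1 = x.1}
  rel l v := (v (0 : Fin 1)).1.1 ∈ W l ∧ (v (0 : Fin 1)).1.2 = 0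
  func _ := uniqueValue fun x y => y.1.2.val = x.1.2.val + 1 ∧ g y.1.2 x.1.1 = y.1.1

section Tree

variable {d : ℕ} {κ : Type} [Finite κ] (ε : Option κ ≃ Fin (d + 1))

/-- On level `k`, only the representatives for that level survive, which leaves one node for each
component. -/
def keepNode (A : Str (levelSig d κ)) (x : A.V) : Prop :=
  ∃ k, A.rel (.inr k) (fun _ => x) ∧ A.func (some (ε k)) x = some x

theorem qfDef_keepNode : QFDef (levelSig d κ) 1 (fun A v => keepNode ε A (v 0)) :=
  .exists_finite fun k => .and (.rel (S := levelSig d κ) (.inr k) _) (.func_eq _ 0 0)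

/-- The comparison takes place on the base level. All of it survives the restriction, whereas on
another level the value of a representative function may have been removed. -/
def parentRel (A : Str (levelSig d κ)) (v : Fin 2 → A.V) : Prop :=
  ∃ k k', (ε k').val = (ε k).val + 1 ∧ A.rel (.inr k) (fun _ => v 0) ∧
    A.rel (.inr k') (fun _ => v 1) ∧ ∃ x,
      Term.eval A v (.app (some (ε k')) (.app none (.var 0))) = some x ∧
      Term.eval A v (.app none (.var 1)) = some x

theorem qfDef_parentRel : QFDef (levelSig d κ) 2 (parentRel ε) :=
  .exists_finite fun k => .exists_finite fun k' => .and (.const _) (.and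
    (.rel (S := levelSig d κ) (.inr k) _) (.and (.rel (S := levelSig d κ) (.inr k') _)
      (.eq _ _)))

theorem exists_tree (d : ℕ) : ∃ T : Transduction (repSig d) (treeSig (d + 1)),
    T.AlmostQuantifierFree ∧ T.Deterministic ∧
    ∀ (V : Type) [Finite V] (W : Fin (d + 1) → Set V) (g : Fin (d + 1) → V → V),
      (∀ x, g 0 x = x) →
      Produces T (repStr W g)
        ⟨treeStr W g, fun x => if x.1.2 = 0 then some x.1.1 else none⟩ := by
  obtain ⟨κ, _, ε, T, hε, h1, h2, h3⟩ := exists_copies d d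
  obtain ⟨R, hR⟩ := realizable_restrict (qfDef_keepNode ε)
  obtain ⟨I, hI⟩ := realizable_interp (S' := treeSig (d + 1)) (S := levelSig d κ)
    (r := fun A l v => A.rel (.inl l) v ∧ A.rel (.inr none) v) (f := fun A _ => parentRel ε A)
    (fun l => .and (.rel (S := levelSig d κ) (.inl l) id) (.rel (S := levelSig d κ) (.inr none) id))
    (fun _ => qfDef_parentRel ε)
  have H := hR.comp hI
  refine ⟨T.comp (R.comp I), ⟨h1, H.1⟩, ⟨h2, H.2.1⟩, fun V _ W g h0 =>
    ((h3 V W g).comp (H.produces _) H.2.1).trans ?_⟩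
  clear H hI I hR R h1 h2 h3 T
  have hkeep : ∀ x : V × Option κ, keepNode ε (levelStr κ W g) x ↔ g (ε x.2) x.1 = x.1 := by
    intro x
    constructor
    · rintro ⟨k, h, h'⟩
      obtain rfl : x.2 = k := h
      exact congrArg Prod.fst (Option.some_injective _ h')
    · intro h
      exact ⟨x.2, rfl, congrArg some (Prod.ext h rfl)⟩
  let e : {x : V × Option κ // keepNode ε (levelStr κ W g) x} ≃
      {x : V × Fin (d + 1) // g x.2 x.1 = x.1} :=
    (Equiv.prodCongr (Equiv.refl V) ε).subtypeEquiv hkeep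
  have hbase : ∀ x : V, keepNode ε (levelStr κ W g) (x, none) := fun x =>
    (hkeep _).2 (by rw [hε, h0])
  have hdown : ∀ x, ((levelStr κ W g).restrict (keepNode ε _)).func none x =
      some ⟨(x.1.1, none), hbase _⟩ := fun x => Str.restrict_func (hbase _) rfl
  have hrep : ∀ k x, ((levelStr κ W g).restrict (keepNode ε _)).func (some k)
      ⟨(x, none), hbase x⟩ = some ⟨(g k x, none), hbase _⟩ :=
    fun k x => Str.restrict_func (hbase _) rfl
  have hbind : ∀ k x, (((levelStr κ W g).restrict (keepNode ε _)).func none x).bind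
      (((levelStr κ W g).restrict (keepNode ε _)).func (some k)) =
        some ⟨(g k x.1.1, none), hbase _⟩ := fun k x =>
    (congrArg (Option.bind · _) (hdown x)).trans (hrep _ _)
  refine ⟨⟨e, ?_, ?_⟩, ?_⟩
  · intro l v
    refine and_congr Iff.rfl ?_
    change ε _ = 0 ↔ _ = none
    rw [← hε, ε.apply_eq_iff_eq]
  · intro f x
    refine uniqueValue_map e (P := fun x y =>
      parentRel ε ((levelStr κ W g).restrict (keepNode ε _)) ![x, y])
      (Q := fun x y => y.1.2.val = x.1.2.val + 1 ∧ g y.1.2 x.1.1 = y.1.1) (fun x y => ?_) x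
    constructor
    · rintro ⟨h, h'⟩
      refine ⟨x.1.2, y.1.2, h, rfl, rfl, ⟨(y.1.1, none), hbase _⟩, ?_, ?_⟩
      · exact (hbind _ x).trans (congrArg some (Subtype.ext (Prod.ext h' rfl)))
      · exact hdown y
    · rintro ⟨k, k', h, h1, h2, z, h3, h4⟩
      obtain rfl : x.1.2 = k := h1
      obtain rfl : y.1.2 = k' := h2
      refine ⟨h, ?_⟩
      have h5 := ((hbind _ x).symm.trans h3).trans (h4.symm.trans (hdown y))
      exact congrArg (fun z => z.1.1) (Option.some_injective _ h5)
  · rintro ⟨⟨x, _ | k⟩, h⟩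
    · exact if_pos hε
    · exact if_neg fun h => by cases ε.injective (h.trans hε.symm)

end Tree

/-! ### Computing representatives level by level from colors -/

/-- The number of indices `l < m` such that `x` and `y` are both in `W l` is odd. -/
def OddCommon {V : Type} (W : ℕ → Set V) : ℕ → V → V → Prop
  | 0, _, _ => False
  | m + 1, x, y => Xor (OddCommon W m x y) (x ∈ W m ∧ y ∈ W m)

/-- Graphs with `n` colors and `i` functions. -/
abbrev colSig (n i : ℕ) : Sig where
  Rel := Option (Fin n)
  Func := Fin i
  arity R := R.elim 2 (fun _ => 1)

def colStr {n i : ℕ} {V : Type} [Finite V] (E : V → V → Prop) (U : Fin n → Set V)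
    (F : Fin i → V → Option V) : Str (colSig n i) where
  V := V
  rel R := match R with
    | none => fun v => E (v (0 : Fin 2)) (v (1 : Fin 2))
    | some c => fun v => v (0 : Fin 1) ∈ U c
  func := F

theorem ancestor_total {V : Type} (f : V → V) (M : ℕ) (x : V) :
    ancestor (fun x => some (f x)) M x = some (f^[M] x) := by
  induction M with
  | zero => rfl
  | succ M ih =>
    rw [ancestor, Function.iterate_succ_apply', Function.iterate_succ_apply']
    rw [ancestor] at ih
    rw [ih]
    rfl

theorem exists_ancestor_total {V : Type} (f : V → V) (M : ℕ) (x y : V) :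
    (∃ z, ancestor (fun x => some (f x)) M x = some z ∧
      ancestor (fun x => some (f x)) M y = some z) ↔ f^[M] x = f^[M] y := by
  simp [ancestor_total, eq_comm]

theorem exists_ancestor_eq {V : Type} (f : V → V) (M : ℕ) (x y : V) :
    (∃ z, ancestor (fun x => some (f x)) M x = some z ∧ some y = some z) ↔ f^[M] x = y := by
  simp [ancestor_total, eq_comm]

section Levels

variable {n : ℕ} (M : ℕ) {Q : Type} [Finite Q] (cW cR : ℕ → Fin n) (cX cU : ℕ → Q → Fin n)

def Str.hasColor {i : ℕ} (A : Str (colSig n i)) (c : Fin n) (x : A.V) : Prop :=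
  A.rel (some c) (fun _ => x)

theorem qfDef_hasColor {i k : ℕ} (c : Fin n) (j : Fin k) :
    QFDef (colSig n i) k (fun A v => A.hasColor c (v j)) :=
  .rel (S := colSig n i) (some c) _

theorem qfDef_oddCommon {i k : ℕ} (m : ℕ) (j j' : Fin k) :
    QFDef (colSig n i) k (fun A v =>
      OddCommon (fun l => {x | A.hasColor (cW l) x}) m (v j) (v j')) := by
  induction m with
  | zero => exact .false
  | succ m ih => exact ih.xor ((qfDef_hasColor _ _).and (qfDef_hasColor _ _))

/-- Equality after `M` applications of the last function (if there is one). -/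
def sameRep : {i : ℕ} → (A : Str (colSig n i)) → (Fin 2 → A.V) → Prop
  | 0, _, _ => True
  | _ + 1, A, v => ∃ z, (Term.iter (Fin.last _) 0 M).eval A v = some z ∧
      (Term.iter (Fin.last _) 1 M).eval A v = some z

theorem qfDef_sameRep (i : ℕ) : QFDef (colSig n i) 2 (sameRep M) := by
  cases i with
  | zero => exact .true
  | succ i => exact .eq _ _

/-- The color `cR i` is meant for the representatives of level `i`, `cX i q` for the vertices guided
by `q`, and `cU i q` for their possible targets. Level `0` is the complete graph, so there the only
condition on an edge is that its ends differ; for larger `i`, the ends must have the same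
representative at the previous level and be adjacent after `i` flips. -/
def nextGraph {i : ℕ} (A : Str (colSig n i)) (v : Fin 2 → A.V) : Prop :=
  (A.hasColor (cR i) (v 0) ∧ v 0 = v 1) ∨ (¬ A.hasColor (cR i) (v 0) ∧ ∃ q,
    A.hasColor (cX i q) (v 0) ∧ A.hasColor (cU i q) (v 1) ∧ v 0 ≠ v 1 ∧
      (i = 0 ∨ sameRep M A v ∧ Xor (A.rel none v)
        (OddCommon (fun l => {x | A.hasColor (cW l) x}) i (v 0) (v 1))))

theorem qfDef_nextGraph (i : ℕ) :
    QFDef (colSig n i) 2 (fun A v => nextGraph M cW cR cX cU A v) :=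
  ((qfDef_hasColor _ _).and (.var_eq 0 1)).or ((qfDef_hasColor _ _).not.and
    (.exists_finite fun _ => (qfDef_hasColor _ _).and ((qfDef_hasColor _ _).and
      ((QFDef.var_eq 0 1).not.and ((QFDef.const _).or ((qfDef_sameRep M i).and
        (.xor (.rel (S := colSig n i) none id) (qfDef_oddCommon cW i 0 1))))))))

/-- The graph of the `j`-th function that is computed from the colors `U`, where `φ` are the
functions computed before. -/
def LevelGraph {V : Type} (E : V → V → Prop) (U : Fin n → Set V) (φ : ℕ → V → V) (j : ℕ)
    (x y : V) : Prop :=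
  (x ∈ U (cR j) ∧ x = y) ∨ (x ∉ U (cR j) ∧ ∃ q, x ∈ U (cX j q) ∧ y ∈ U (cU j q) ∧ x ≠ y ∧
    (j = 0 ∨ (φ (j - 1))^[M] x = (φ (j - 1))^[M] y ∧
      Xor (E x y) (OddCommon (fun l => U (cW l)) j x y)))

/-- The representative of the previous level is the value of a term, an `M`-fold iterate of the
function added last. Each new function therefore needs a single quantifier-free function extension.
-/
theorem exists_levels (i : ℕ) : ∃ T : Transduction (colSig n 0) (colSig n i),
    T.AlmostQuantifierFree ∧ T.Deterministic ∧
    ∀ (V : Type) [Finite V] (E : V → V → Prop) (U : Fin n → Set V) (φ : ℕ → V → V)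
      (F : Fin 0 → V → Option V),
      (∀ j < i, ∀ x y, LevelGraph M cW cR cX cU E U φ j x y ↔ φ j x = y) →
      Produces T (colStr E U F) ⟨colStr E U (fun (j : Fin i) x => some (φ j x)), some⟩ := by
  induction i with
  | zero =>
    obtain ⟨T, hT⟩ := realizable_pull (S := colSig n 0) ⟨id, id, fun _ => rfl⟩
      (fun _ _ h => h) (fun _ _ h => h)
    exact ⟨T, hT.1, hT.2.1, fun V _ E U φ F _ =>
      (hT.produces _).trans ⟨⟨Equiv.refl V, fun R v => Iff.rfl, fun f => f.elim0⟩, fun _ => rfl⟩⟩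
  | succ i ih =>
    obtain ⟨T, h1, h2, h3⟩ := ih
    obtain ⟨J, hJ⟩ := realizable_interp (S := colSig n i) (S' := colSig n (i + 1))
      (r := fun A R v => A.rel R v)
      (f := fun A g v => if h : g.val < i then A.func ⟨g, h⟩ (v 0) = some (v 1) else
        nextGraph M cW cR cX cU A v) (fun R => .rel (S := colSig n i) R id) (fun g => by
          by_cases h : g.val < i
          · simp only [h, dite_true]
            exact .func_eq (S := colSig n i) _ _ _
          · simp only [h, dite_false]
            exact qfDef_nextGraph M cW cR cX cU i)
    refine ⟨T.comp J, ⟨h1, hJ.1⟩, ⟨h2, hJ.2.1⟩, fun V _ E U φ F hφ => ?_⟩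
    refine ((h3 V E U φ F fun j hj => hφ j (by omega)).comp (hJ.produces _) hJ.2.1).trans ?_
    refine ⟨⟨Equiv.refl V, by rintro (_ | c) v <;> rfl, fun g x => ?_⟩, fun _ => rfl⟩
    refine (Eq.trans (congrArg (Option.map (Equiv.refl V)) (uniqueValue_eq (V := V) (x := x)
      (P := fun x y => if h : g.val < i then some (φ g x) = some y else nextGraph M cW cR cX cU
        (colStr E U fun (j : Fin i) x => some (φ j x)) ![x, y]) (o := some (φ g x))
      fun y => ?_)) (by rfl)).symm
    rw [Option.some_inj]
    by_cases h : g.val < i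
    · rw [dif_pos h]
    · obtain rfl : g = Fin.last i := Fin.ext (by have := g.2; simp; omega)
      rw [dif_neg h, Fin.val_last]
      refine Iff.trans ?_ (hφ i (by omega) x y)
      refine or_congr Iff.rfl (and_congr Iff.rfl (exists_congr fun q => and_congr Iff.rfl
        (and_congr Iff.rfl (and_congr Iff.rfl ?_))))
      cases i with
      | zero => exact iff_of_true (.inl rfl) (.inl rfl)
      | succ i =>
        refine or_congr Iff.rfl (and_congr ?_ Iff.rfl)
        simp only [sameRep, Term.eval_iter]
        exact exists_ancestor_total (φ i) M x y

open Classical in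
/-- The tree of height `d` computed from the functions `φ` is produced from the colored graph. -/
theorem exists_treeOfColors (d : ℕ) : ∃ T : Transduction (colSig n 0) (treeSig (d + 1)),
    T.AlmostQuantifierFree ∧ T.Deterministic ∧
    ∀ (V : Type) [Finite V] (E : V → V → Prop) (U : Fin n → Set V) (φ : ℕ → V → V)
      (F : Fin 0 → V → Option V),
      (∀ j < d, ∀ x y, LevelGraph M cW cR cX cU E U φ j x y ↔ φ j x = y) →
      Produces T (colStr E U F)
        ⟨treeStr (fun l : Fin (d + 1) => U (cW l))
          (fun k => if k.val = 0 then id else (φ (d - k))^[M]),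
          fun x => if x.1.2 = 0 then some x.1.1 else none⟩ := by
  obtain ⟨T, h1, h2, h3⟩ := exists_levels M cW cR cX cU d
  obtain ⟨I, hI⟩ := realizable_interp (S := colSig n d) (S' := repSig d)
    (r := fun A l v => A.hasColor (cW l) (v (0 : Fin 1)))
    -- The index `k` is the distance from the leaves, so it refers to level `d - k`. At level `d`
    -- components are single vertices; hence the identity serves for `k = 0`, and only `φ 0, …, φ (d
    -- - 1)` are computed.
    (f := fun A k v => if h : k.val = 0 then v 0 = v 1 else ∃ z,
      (Term.iter (⟨d - k, by omega⟩ : Fin d) 0 M).eval A v = some z ∧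
        Term.eval A v (.var 1) = some z)
    (fun l => qfDef_hasColor _ _) (fun k => by
      by_cases h : k.val = 0
      · simp only [h, dite_true]
        exact .var_eq _ _
      · simp only [h, dite_false]
        exact .eq _ _)
  obtain ⟨J, hJ1, hJ2, hJ3⟩ := exists_tree d
  refine ⟨(T.comp I).comp J, ⟨⟨h1, hI.1⟩, hJ1⟩, ⟨⟨h2, hI.2.1⟩, hJ2⟩, fun V _ E U φ F hφ => ?_⟩
  have key : Produces (T.comp I) (colStr E U F)
      ⟨repStr (fun l : Fin (d + 1) => U (cW l))
        (fun k => if k.val = 0 then id else (φ (d - k))^[M]), some⟩ := by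
    refine ((h3 V E U φ F hφ).comp (hI.produces _) hI.2.1).trans ?_
    refine ⟨⟨Equiv.refl V, fun R v => Iff.rfl, fun k x => ?_⟩, fun _ => rfl⟩
    refine (Eq.trans (congrArg (Option.map (Equiv.refl V)) (uniqueValue_eq (V := V)
      (x := x) (P := fun x y => if h : k.val = 0 then x = y else ∃ z,
        (Term.iter (⟨d - k, by omega⟩ : Fin d) 0 M).eval
          (colStr E U fun (j : Fin d) x => some (φ j x)) ![x, y] = some z ∧ some y = some z)
      (o := some ((if k.val = 0 then id else (φ (d - k))^[M] : V → V) x)) fun y => ?_))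
        (by rfl)).symm
    by_cases h : k.val = 0
    · rw [dif_pos h, if_pos h, Option.some_inj]
      exact Iff.rfl
    · rw [dif_neg h, if_neg h, Option.some_inj, Term.eval_iter]
      exact exists_ancestor_eq (φ (d - k)) M x y
  refine (key.comp (hJ3 V _ _ fun x => by simp) hJ2).trans ⟨.refl _, fun x => ?_⟩
  change (if x.1.2 = 0 then some x.1.1 else none) =
    Option.map id ((if x.1.2 = 0 then some x.1.1 else none).bind some)
  simp

end Levels

/-! ### Guessing a coloring with a prescribed property -/

/-- The expansion of a graph by the colors `U`. -/
def Str.colored {n : ℕ} (A : Str graphSig) (U : Fin n → Set A.V) : Str (colSig n 0) :=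
  colStr (fun x y => A.rel () ![x, y]) U (fun i => i.elim0)

/-- The expansion of a colored graph by one more color. -/
def Str.addColor {n : ℕ} (X : Str (colSig n 0)) (U : Set X.V) : Str (colSig (n + 1) 0) :=
  colStr (fun x y => X.rel none ![x, y])
    (Fin.snoc (α := fun _ => Set X.V) (fun c => {x | X.hasColor c x}) U) (fun i => i.elim0)

theorem realizable_addColor (n : ℕ) : ∃ I : Transduction ((colSig n 0).addRel 1) (colSig (n + 1) 0),
    I.AlmostQuantifierFree ∧ ∀ (X : Str (colSig n 0)) (U : Set X.V),
      I.outputs (X.addRel (k := 1) (fun v => v 0 ∈ U)) = {⟨X.addColor U, some⟩} := by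
  obtain ⟨I, hI⟩ := realizable_interp (S := (colSig n 0).addRel 1) (S' := colSig (n + 1) 0)
    (r := fun A R => match R with
      | none => fun v => A.rel (some none) v
      | some c => fun v => Fin.lastCases (motive := fun _ => Prop) (A.rel none v)
          (fun c => A.rel (some (some c)) v) c)
    (f := fun _ i => i.elim0) (fun R => by
      rcases R with _ | c
      · exact .rel (S := (colSig n 0).addRel 1) (some none) id
      · refine Fin.lastCases ?_ (fun c => ?_) c
        · simp only [Fin.lastCases_last]
          exact .rel (S := (colSig n 0).addRel 1) none id
        · simp only [Fin.lastCases_castSucc]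
          exact .rel (S := (colSig n 0).addRel 1) (some (some c)) id) (fun i => i.elim0)
  refine ⟨I, hI.1, fun X U => ?_⟩
  rw [hI.2.2]
  refine congrArg _ (Output.mk_congr _ ?_ fun i => i.elim0)
  rintro (_ | c) v
  · change X.rel none v ↔ X.rel none ![v (0 : Fin 2), v (1 : Fin 2)]
    refine iff_of_eq (congrArg _ (funext fun i => ?_))
    change Fin 2 at i
    fin_cases i <;> rfl
  · refine Fin.lastCases ?_ (fun c => ?_) c
    · simp only [Fin.lastCases_last, Fin.snoc_last]
      rfl
    · simp only [Fin.lastCases_castSucc, Fin.snoc_castSucc]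
      change X.rel (some c) v ↔ X.rel (some c) (fun _ => v (0 : Fin 1))
      refine iff_of_eq (congrArg _ (funext fun i => ?_))
      exact congrArg v (Subsingleton.elim (α := Fin 1) _ _)

/-- Colors are guessed one after another. Because `σ` may be any nonempty family, each guess can be
limited to sets that still extend to a good coloring, so no branch ends in a bad one and every good
one is reached. -/
theorem exists_coloring (n : ℕ) (Good : Str (colSig n 0) → Prop) :
    ∃ T : Transduction graphSig (colSig n 0), T.AlmostQuantifierFree ∧
      ∀ A : Str graphSig, (∃ U, Good (A.colored U)) →
        T.outputs A = {o | ∃ U, Good (A.colored U) ∧ o = ⟨A.colored U, some⟩} := by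
  classical
  induction n with
  | zero =>
    let m : (colSig 0 0).Emb graphSig := ⟨fun _ => (), fun i => i.elim0, fun R => by
      rcases R with _ | c
      · rfl
      · exact c.elim0⟩
    obtain ⟨T, hT⟩ := realizable_pull m
      (by rintro (_ | c) (_ | c'); exacts [fun _ => rfl, c'.elim0, c.elim0, c.elim0])
      (fun i => i.elim0)
    refine ⟨T, hT.1, fun A ⟨U, hU⟩ => ?_⟩
    have h : ∀ U : Fin 0 → Set A.V,
        (⟨A.pull m, some⟩ : Output A (colSig 0 0)) = ⟨A.colored U, some⟩ := fun U => by
      refine Output.mk_congr _ ?_ fun i => i.elim0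
      rintro (_ | c) v
      · refine iff_of_eq (congrArg _ (funext fun i => ?_))
        change Fin 2 at i
        fin_cases i <;> rfl
      · exact c.elim0
    rw [hT.2.2]
    ext o
    constructor
    · rintro rfl
      exact ⟨U, hU, h U⟩
    · rintro ⟨U', -, rfl⟩
      exact (h U').symm
  | succ n ih =>
    -- The first `n` colors are required only to be completable by one more color.
    obtain ⟨T, hT, hT'⟩ := ih (fun X => ∃ U, Good (X.addColor U))
    obtain ⟨I, hI, hI'⟩ := realizable_addColor n
    -- The value `Set.univ` only ensures nonemptiness on structures without a completion.
    let σ : (X : Str (colSig n 0)) → Set (Set X.V) := fun X =>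
      if (∃ U, Good (X.addColor U)) then {U | Good (X.addColor U)} else Set.univ
    have hσ : ∀ X, (σ X).Nonempty := fun X => by
      by_cases h : ∃ U, Good (X.addColor U)
      · obtain ⟨U, hU⟩ := h
        refine ⟨U, ?_⟩
        simp only [σ, if_pos (show ∃ U, Good (X.addColor U) from ⟨U, hU⟩)]
        exact hU
      · simp only [σ, if_neg h]
        exact Set.univ_nonempty
    have hsnoc : ∀ (A : Str graphSig) (U : Fin n → Set A.V) (U' : Set A.V),
        (A.colored U).addColor U' = A.colored (Fin.snoc (α := fun _ => Set A.V) U U') :=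
      fun A U U' => rfl
    refine ⟨T.comp ((Transduction.unaryLift σ hσ).comp I), ⟨hT, trivial, hI⟩, fun A ⟨U, hU⟩ => ?_⟩
    have hU' : A.colored U = (A.colored (Fin.init U)).addColor (U (Fin.last n)) := by
      rw [hsnoc, Fin.snoc_init_self]
    have hA := hT' A ⟨Fin.init U, U (Fin.last n), hU' ▸ hU⟩
    ext o
    constructor
    · rintro ⟨o₁, h₁, o₂, ⟨o₃, ⟨U₃, hU₃, rfl⟩, o₄, h₄, rfl⟩, rfl⟩
      rw [hA] at h₁
      obtain ⟨U₁, hU₁, rfl⟩ := h₁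
      simp only [hI', Set.mem_singleton_iff] at h₄
      subst h₄
      simp only [σ, if_pos hU₁] at hU₃
      exact ⟨_, hU₃, rfl⟩
    · rintro ⟨U₁, hU₁, rfl⟩
      have h1 : A.colored U₁ = (A.colored (Fin.init U₁)).addColor (U₁ (Fin.last n)) := by
        rw [hsnoc, Fin.snoc_init_self]
      have h2 : ∃ U, Good ((A.colored (Fin.init U₁)).addColor U) := ⟨_, h1 ▸ hU₁⟩
      refine ⟨⟨A.colored (Fin.init U₁), some⟩, ?_, ⟨(A.colored (Fin.init U₁)).addColor
        (U₁ (Fin.last n)), some⟩, ⟨_, ⟨U₁ (Fin.last n), ?_, rfl⟩,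
          ⟨(A.colored (Fin.init U₁)).addColor (U₁ (Fin.last n)), some⟩, ?_, rfl⟩, ?_⟩
      · rw [hA]
        exact ⟨_, h2, rfl⟩
      · have h3 : Good ((A.colored (Fin.init U₁)).addColor (U₁ (Fin.last n))) := h1 ▸ hU₁
        simp only [σ, if_pos h2]
        exact h3
      · exact (Set.ext_iff.1 (hI' (A.colored (Fin.init U₁)) (U₁ (Fin.last n))) _).2 rfl
      · exact Output.mk_congr (S' := colSig (n + 1) 0) (V := A.V) _
          (fun R v => iff_of_eq (congrArg (fun U => (A.colored U).rel R v)
            (Fin.snoc_init_self U₁).symm)) fun i => i.elim0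

/-! ### From connection models to iterated flips -/

section Flips

variable {V : Type}

theorem flipWithin_adj (G : SimpleGraph V) (W : Set V) (x y : V) :
    (flipWithin G W).Adj x y ↔ x ≠ y ∧ Xor (G.Adj x y) (x ∈ W ∧ y ∈ W) := by
  have : G.Adj x y → x ≠ y := fun h => h.ne
  simp only [flipWithin, symmDiff, SimpleGraph.sup_adj, SimpleGraph.sdiff_adj, Xor]
  tauto

theorem flipWithin_empty (G : SimpleGraph V) : flipWithin G ∅ = G := by
  ext x y
  have : G.Adj x y → x ≠ y := fun h => h.ne
  simp only [flipWithin_adj, Set.mem_empty_iff_false, Xor]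
  tauto

/-- The graph obtained by flipping within `W 0, …, W (n - 1)`. -/
def flips (G : SimpleGraph V) (W : ℕ → Set V) : ℕ → SimpleGraph V
  | 0 => G
  | n + 1 => flipWithin (flips G W n) (W n)

theorem flips_adj (G : SimpleGraph V) (W : ℕ → Set V) (n : ℕ) (x y : V) :
    (flips G W n).Adj x y ↔ x ≠ y ∧ Xor (G.Adj x y) (OddCommon W n x y) := by
  have : G.Adj x y → x ≠ y := fun h => h.ne
  induction n with
  | zero => simp only [flips, OddCommon, Xor]; tauto
  | succ n ih =>
    simp only [flips, flipWithin_adj, ih, OddCommon, Xor]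
    tauto

theorem OddCommon.congr {V' : Type} {W : ℕ → Set V} {W' : ℕ → Set V'} {n : ℕ} {x y : V}
    {x' y' : V'} (hx : ∀ l < n, x ∈ W l ↔ x' ∈ W' l) (hy : ∀ l < n, y ∈ W l ↔ y' ∈ W' l) :
    OddCommon W n x y ↔ OddCommon W' n x' y' := by
  induction n with
  | zero => rfl
  | succ n ih =>
    rw [OddCommon, OddCommon, ih (fun l hl => hx l (by omega)) (fun l hl => hy l (by omega)),
      hx n (by omega), hy n (by omega)]

/-- The first `n` sets alone determine `OddCommon W n`, so the set with index `n` is free to be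
replaced by `S`. -/
theorem exists_oddCommon_xor {W : ℕ → Set V} (n : ℕ) (S : Set V) :
    ∃ W' : ℕ → Set V, ∀ x y, OddCommon W' (n + 1) x y ↔
      Xor (OddCommon W n x y) (x ∈ S ∧ y ∈ S) := by
  refine ⟨Function.update W n S, fun x y => ?_⟩
  rw [OddCommon, Function.update_self, OddCommon.congr (W' := W) (x' := x) (y' := y)]
  all_goals
    intro l hl
    rw [Function.update_of_ne hl.ne]

/-- Every symmetric relation on a finite set is a sum modulo 2 of squares. -/
theorem exists_oddCommon_iff (Λ : Type) [Finite Λ] : ∃ n, ∀ D : Λ → Λ → Prop,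
    (∀ a b, D a b → D b a) → ∃ S : ℕ → Set Λ, ∀ a b, OddCommon S n a b ↔ D a b := by
  classical
  cases nonempty_fintype Λ
  suffices key : ∀ s : Finset (Λ × Λ), ∃ n, ∀ D : Λ → Λ → Prop, (∀ a b, D a b → D b a) →
      (∀ a b, D a b → (a, b) ∈ s) → ∃ S : ℕ → Set Λ, ∀ a b, OddCommon S n a b ↔ D a b by
    obtain ⟨n, hn⟩ := key Finset.univ
    exact ⟨n, fun D hD => hn D hD fun _ _ _ => Finset.mem_univ _⟩
  intro s
  induction s using Finset.induction_on with
  | empty =>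
    exact ⟨0, fun D _ hD => ⟨fun _ => ∅, fun a b => ⟨False.elim, fun h => by simpa using hD a b h⟩⟩⟩
  | insert p s _ ih =>
    obtain ⟨a, b⟩ := p
    obtain ⟨n, hn⟩ := ih
    refine ⟨n + 3, fun D hD hs => ?_⟩
    obtain ⟨S, hS⟩ := hn (fun x y => D x y ∧ ¬ (x = a ∧ y = b) ∧ ¬ (x = b ∧ y = a))
      (fun x y ⟨h1, h2, h3⟩ => ⟨hD _ _ h1, fun h => h3 h.symm, fun h => h2 h.symm⟩)
      (fun x y ⟨h1, h2, _⟩ => by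
        have := hs x y h1
        rw [Finset.mem_insert, Prod.mk.injEq] at this
        exact this.resolve_left h2)
    -- For `a ≠ b`, the pairs `(a, b)` and `(b, a)` are the sum of the squares of `{a, b}`, `{a}`
    -- and `{b}`; for `a = b` the first square suffices. The condition `D a b` empties the sets when
    -- the pair is absent from `D`, so that the number `n + 3` does not depend on `D`.
    obtain ⟨S₁, h₁⟩ := exists_oddCommon_xor (W := S) n {x | D a b ∧ (x = a ∨ x = b)}
    obtain ⟨S₂, h₂⟩ := exists_oddCommon_xor (W := S₁) (n + 1) {x | D a b ∧ a ≠ b ∧ x = a}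
    obtain ⟨S₃, h₃⟩ := exists_oddCommon_xor (W := S₂) (n + 2) {x | D a b ∧ a ≠ b ∧ x = b}
    refine ⟨S₃, fun x y => ?_⟩
    rw [h₃, h₂, h₁, hS]
    simp only [Set.mem_ofPred_eq, Xor]
    have hba := hD a b
    have hab' := hD b a
    clear hS h₁ h₂ h₃ hs hn hD
    by_cases hab : D a b
    · by_cases h : a = b <;> by_cases hx : x = a <;> by_cases hx' : x = b <;>
        by_cases hy : y = a <;> by_cases hy' : y = b <;> simp_all
    · have hba' : ¬ D b a := fun h => hab (hab' h)
      by_cases hx : x = a <;> by_cases hx' : x = b <;>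
        by_cases hy : y = a <;> by_cases hy' : y = b <;> simp_all

/-- Connectedness by edges of `E` within `r`. -/
def conn (r : V → V → Prop) (E : SimpleGraph V) : V → V → Prop :=
  Relation.ReflTransGen fun x y => r x y ∧ E.Adj x y

/-- Within `r`, the graph `E` can be reduced to single vertices by `n` flips, where we restrict to
the connected components after each flip. -/
def FlipReducible : ℕ → (V → V → Prop) → SimpleGraph V → Prop
  | 0, r, _ => ∀ x y, r x y → x = y
  | n + 1, r, E => ∃ W, FlipReducible n (conn r (flipWithin E W)) (flipWithin E W)

theorem conn_mono {r r' : V → V → Prop} (h : ∀ x y, r x y → r' x y) (E : SimpleGraph V)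
    {x y : V} (hxy : conn r E x y) : conn r' E x y :=
  Relation.ReflTransGen.mono (fun _ _ h' => ⟨h _ _ h'.1, h'.2⟩) _ _ hxy

theorem conn_le {r : V → V → Prop} (hr : ∀ x, r x x) (ht : ∀ x y z, r x y → r y z → r x z)
    {E : SimpleGraph V} {x y : V} (h : conn r E x y) : r x y := by
  induction h with
  | refl => exact hr _
  | tail _ h ih => exact ht _ _ _ ih h.1

theorem FlipReducible.mono {n : ℕ} {r r' : V → V → Prop} {E : SimpleGraph V}
    (h : FlipReducible n r' E) (hr : ∀ x y, r x y → r' x y) : FlipReducible n r E := by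
  induction n generalizing r r' E with
  | zero => exact fun x y hxy => h x y (hr x y hxy)
  | succ n ih =>
    obtain ⟨W, hW⟩ := h
    exact ⟨W, ih hW fun x y => conn_mono hr _⟩

/-- Several flips may be made before components are taken: passing to components in between only
shrinks `r`, which preserves reducibility. -/
theorem FlipReducible.of_flips {m n : ℕ} {r : V → V → Prop} (hr : ∀ x, r x x)
    (ht : ∀ x y z, r x y → r y z → r x z) {E : SimpleGraph V} {W : ℕ → Set V}
    (h : FlipReducible m r (flips E W n)) : FlipReducible (m + n) r E := by
  induction n generalizing m with
  | zero => exact h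
  | succ n ih =>
    rw [show m + (n + 1) = m + 1 + n by omega]
    exact ih ⟨W n, h.mono fun x y => conn_le hr ht⟩

/-- Passing to components costs one flip, within the empty set. -/
theorem FlipReducible.of_conn {n : ℕ} {r : V → V → Prop} {E : SimpleGraph V}
    (h : FlipReducible n (conn r E) E) : FlipReducible (n + 1) r E :=
  ⟨∅, by rwa [flipWithin_empty]⟩

/-- A graph whose adjacencies are determined, level by level of the chain of equivalence relations
`anc j`, by labels of the vertices, is reducible by a bounded number of flips. -/
theorem flipReducible_of_layers {Λ N : Type} {n h : ℕ}
    (hn : ∀ D : Λ → Λ → Prop,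
      (∀ a b, D a b → D b a) → ∃ S : ℕ → Set Λ, ∀ a b, OddCommon S n a b ↔ D a b)
    (anc : ℕ → V → N) (lab : V → Λ)
    (hanc : ∀ j x y, anc (j + 1) x = anc (j + 1) y → anc j x = anc j y)
    (hinj : ∀ x y, anc h x = anc h y → x = y) (k j : ℕ) (hjk : j + k = h)
    (r : V → V → Prop) (hr : ∀ x, r x x) (ht : ∀ x y z, r x y → r y z → r x z)
    (hrj : ∀ x y, r x y → anc j x = anc j y) (E : SimpleGraph V) (C : ℕ → V → Λ → Λ → Prop)
    (hC : ∀ l x a b, C l x a b → C l x b a)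
    (hC' : ∀ l ≥ j, ∀ x y, anc l x = anc l y → C l x = C l y)
    (hE : ∀ l ≥ j, ∀ x y, r x y → anc l x = anc l y → anc (l + 1) x ≠ anc (l + 1) y →
      (E.Adj x y ↔ C l x (lab x) (lab y))) : FlipReducible (k * (n + 1)) r E := by
  induction k generalizing j r E C with
  | zero =>
    rw [Nat.zero_mul]
    obtain rfl : j = h := by omega
    exact fun x y hxy => hinj x y (hrj x y hxy)
  | succ k ih =>
    have hn' : ∀ D : {D : Λ → Λ → Prop // ∀ a b, D a b → D b a},
        ∃ S : ℕ → Set Λ, ∀ a b, OddCommon S n a b ↔ D.1 a b := fun D => hn D.1 D.2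
    choose S hS using hn'
    -- The relation `C j x` is the same for all `x` with the same ancestor at level `j`. One global
    -- sequence of sets can thus follow a different decomposition into squares below each of these
    -- ancestors.
    let W : ℕ → Set V := fun l => {x | lab x ∈ S ⟨C j x, hC j x⟩ l}
    have hle : ∀ l ≥ j, ∀ x y, anc l x = anc l y → anc j x = anc j y := by
      intro l hl
      induction l, hl using Nat.le_induction with
      | base => exact fun x y h => h
      | succ l _ ihl => exact fun x y h => ihl x y (hanc l x y h)
    have hW : ∀ x y, r x y → (OddCommon W n x y ↔ C j x (lab x) (lab y)) := by
      intro x y hxy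
      have hxy' : C j y = C j x := (hC' j le_rfl x y (hrj x y hxy)).symm
      refine Iff.trans ?_ (hS ⟨C j x, hC j x⟩ _ _)
      refine OddCommon.congr (fun l _ => Iff.rfl) (fun l _ => ?_)
      simp only [W, Set.mem_ofPred_eq, hxy']
    -- One level costs `n` flips for its relation and one empty flip for taking components.
    rw [show (k + 1) * (n + 1) = k * (n + 1) + 1 + n by ring]
    refine FlipReducible.of_flips hr ht (W := W) (FlipReducible.of_conn ?_)
    -- The flips also affect pairs that are separated only further down; `Xor` with `C j` accounts
    -- for this in the relations of the deeper levels.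
    refine ih (j + 1) (by omega) _ (fun x => .refl) (fun x y z => .trans) ?_ _
      (fun l x a b => Xor (C l x a b) (C j x a b)) ?_ ?_ ?_
    · intro x y hxy
      induction hxy with
      | refl => rfl
      | @tail y z _ h ih =>
        refine ih.trans ?_
        -- An edge between different ancestors at level `j + 1` would be one that the flips have
        -- just erased.
        by_contra hne
        have h' := h.2
        rw [flips_adj, hW _ _ h.1, hE j le_rfl _ _ h.1 (hrj _ _ h.1) hne] at h'
        exact h'.2.elim (fun h => h.2 h.1) (fun h => h.2 h.1)
    · intro l x a b
      have h1 : C l x a b ↔ C l x b a := ⟨hC _ _ _ _, hC _ _ _ _⟩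
      have h2 : C j x a b ↔ C j x b a := ⟨hC _ _ _ _, hC _ _ _ _⟩
      rw [h1, h2]
      exact id
    · intro l hl x y hxy
      rw [hC' l (by omega) x y hxy, hC' j le_rfl x y (hle l (by omega) x y hxy)]
    · intro l hl x y hxy h1 h2
      have hxy' := conn_le hr ht hxy
      have hne : x ≠ y := by rintro rfl; exact h2 rfl
      rw [flips_adj, hW _ _ hxy', hE l (by omega) x y hxy' h1 h2]
      exact and_iff_right hne

/-- Vertices are adjacent in the graph at level `i + 1` if they are connected at level `i` and
adjacent after `i + 1` flips. -/
def compGraph (G : SimpleGraph V) (W : ℕ → Set V) : ℕ → SimpleGraph V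
  | 0 => ⊤
  | i + 1 =>
    { Adj := fun x y => (compGraph G W i).Reachable x y ∧ (flips G W (i + 1)).Adj x y
      symm := ⟨fun _ _ h => ⟨h.1.symm, h.2.symm⟩⟩
      loopless := ⟨fun _ h => h.2.ne rfl⟩ }

theorem flips_congr {G : SimpleGraph V} {W W' : ℕ → Set V} {i : ℕ} (h : ∀ l < i, W l = W' l) :
    flips G W i = flips G W' i := by
  induction i with
  | zero => rfl
  | succ i ih => rw [flips, flips, ih fun l hl => h l (by omega), h i (by omega)]

theorem compGraph_congr {G : SimpleGraph V} {W W' : ℕ → Set V} {i : ℕ}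
    (h : ∀ l < i, W l = W' l) : compGraph G W i = compGraph G W' i := by
  induction i with
  | zero => rfl
  | succ i ih =>
    ext x y
    simp only [compGraph]
    rw [ih fun l hl => h l (by omega), flips_congr h]

/-- The sets supplied successively by `FlipReducible` are collected into one sequence. Writing the
next set at position `i` is harmless, because level `i` depends only on the sets with smaller index.
-/
theorem FlipReducible.exists_compGraph_eq_bot {G : SimpleGraph V} {n i : ℕ} {W : ℕ → Set V}
    (h : FlipReducible n (compGraph G W i).Reachable (flips G W i)) :
    ∃ W', compGraph G W' (i + n) = ⊥ := by
  induction n generalizing i W with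
  | zero =>
    refine ⟨W, ?_⟩
    ext x y
    simp only [Nat.add_zero, SimpleGraph.bot_adj, iff_false]
    exact fun h' => h'.ne (h x y h'.reachable)
  | succ n ih =>
    obtain ⟨S, hS⟩ := h
    have h1 : ∀ l < i, Function.update W i S l = W l := fun l hl =>
      Function.update_of_ne hl.ne _ _
    have h2 : flips G (Function.update W i S) (i + 1) = flipWithin (flips G W i) S := by
      rw [flips, flips_congr h1, Function.update_self]
    rw [show i + (n + 1) = i + 1 + n by omega]
    refine ih (W := Function.update W i S) ?_
    rw [h2]
    refine hS.mono fun x y hxy => ?_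
    rw [SimpleGraph.reachable_iff_reflTransGen] at hxy
    refine Relation.ReflTransGen.mono (fun a b hab => ?_) _ _ hxy
    have hab' := hab
    simp only [compGraph, h2, compGraph_congr h1] at hab'
    exact hab'

end Flips

/-! ### Depth and ancestors in rooted trees -/

section Ancestors

variable {N : Type} {p : N → Option N}

theorem ancestor_zero (x : N) : ancestor p 0 x = some x := rfl

theorem ancestor_succ (k : ℕ) (x : N) : ancestor p (k + 1) x = (ancestor p k x).bind p := by
  rw [ancestor, Function.iterate_succ_apply', ancestor]

theorem ancestor_add (m n : ℕ) (x : N) :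
    ancestor p (m + n) x = (ancestor p m x).bind (ancestor p n) := by
  induction n with
  | zero =>
    cases h : ancestor p m x with
    | none => rfl
    | some y => rfl
  | succ n ih =>
    rw [← Nat.add_assoc, ancestor_succ, ih, Option.bind_assoc]
    simp only [ancestor_succ]

theorem ancestor_one (x : N) : ancestor p 1 x = p x := rfl

theorem ancestor_succ' (k : ℕ) (x : N) : ancestor p (k + 1) x = (p x).bind (ancestor p k) := by
  rw [Nat.add_comm, ancestor_add, ancestor_one]

theorem IsAncestor.refl (x : N) : IsAncestor p x x := ⟨0, rfl⟩

theorem IsAncestor.trans {x y z : N} (h : IsAncestor p x y) (h' : IsAncestor p y z) :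
    IsAncestor p x z := by
  obtain ⟨k, h⟩ := h
  obtain ⟨l, h'⟩ := h'
  exact ⟨l + k, by rw [ancestor_add, h', Option.bind_some, h]⟩

theorem ancestor_root_unique {r : N} (hr : p r = none) {k l : ℕ} {x : N}
    (hk : ancestor p k x = some r) (hl : ancestor p l x = some r) : k = l := by
  have key : ∀ {k l : ℕ}, k < l → ancestor p k x = some r → ancestor p l x ≠ some r := by
    intro k l hkl hk
    obtain ⟨m, rfl⟩ := Nat.exists_eq_add_of_lt hkl
    rw [show k + m + 1 = k + (m + 1) by omega, ancestor_add, hk, Option.bind_some,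
      ancestor_succ', hr]
    simp
  rcases lt_trichotomy k l with h | h | h
  · exact (key h hk hl).elim
  · exact h
  · exact (key h hl hk).elim

/-- In a rooted tree, the depth of nodes, and ancestors of each depth. -/
theorem IsRootedTree.exists_depth {r : N} (h : IsRootedTree p r) : ∃ dep : N → ℕ,
    (∀ x k, ancestor p k x = some r ↔ k = dep x) ∧
    (∀ x y k, ancestor p k x = some y → dep x = k + dep y) := by
  choose dep hdep using h.2
  have h1 : ∀ x k, ancestor p k x = some r ↔ k = dep x := fun x k =>
    ⟨fun hk => ancestor_root_unique h.1 hk (hdep x), by rintro rfl; exact hdep x⟩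
  refine ⟨dep, h1, fun x y k hk => ((h1 _ _).1 ?_).symm⟩
  rw [ancestor_add, hk, Option.bind_some, hdep]

/-- Leaves may have different depths. The minimum in `dep (anc j x) = min j (dep x)` makes `anc j x`
equal to `x` once `j` exceeds the depth of `x`, so `anc` is total. -/
theorem IsRootedTree.exists_anc {r : N} (h : IsRootedTree p r) : ∃ (dep : N → ℕ) (anc : ℕ → N → N),
    (∀ x k, ancestor p k x = some r ↔ k = dep x) ∧
    (∀ j x, IsAncestor p (anc j x) x ∧ dep (anc j x) = min j (dep x)) ∧
    (∀ w z x, IsAncestor p w x → IsAncestor p z x → dep w ≤ dep z → IsAncestor p w z) ∧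
    (∀ w z x, IsAncestor p w x → IsAncestor p z x → dep w = dep z → w = z) ∧
    (∀ w x, IsAncestor p w x → dep w ≤ dep x) := by
  obtain ⟨dep, h1, h2⟩ := h.exists_depth
  have h3 : ∀ j x, ∃ z, IsAncestor p z x ∧ dep z = min j (dep x) := by
    intro j x
    have hx := (h1 x (dep x)).2 rfl
    obtain ⟨m, hm⟩ : ∃ m, dep x = m + min j (dep x) := ⟨dep x - min j (dep x), by omega⟩
    rw [hm, ancestor_add] at hx
    obtain ⟨z, hz, -⟩ := Option.bind_eq_some_iff.1 hx
    have := h2 x z m hz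
    exact ⟨z, ⟨m, hz⟩, by omega⟩
  choose anc hanc using h3
  have h4 : ∀ w z x, IsAncestor p w x → IsAncestor p z x → dep w ≤ dep z → IsAncestor p w z := by
    rintro w z x ⟨k, hk⟩ ⟨l, hl⟩ hle
    have hk' := h2 _ _ _ hk
    have hl' := h2 _ _ _ hl
    obtain ⟨m, rfl⟩ : ∃ m, k = l + m := ⟨k - l, by omega⟩
    rw [ancestor_add, hl, Option.bind_some] at hk
    exact ⟨m, hk⟩
  refine ⟨dep, anc, h1, hanc, h4, ?_, ?_⟩
  · intro w z x hw hz hwz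
    obtain ⟨k, hk⟩ := h4 w z x hw hz hwz.le
    have := h2 _ _ _ hk
    obtain rfl : k = 0 := by omega
    exact (Option.some_injective _ hk).symm
  · rintro w x ⟨k, hk⟩
    have := h2 _ _ _ hk
    omega

end Ancestors

/-- The layers of a connection model. -/
theorem HasConnectionModel.exists_layers {h : ℕ} {Λ : Type} {G : FinGraph}
    (hG : HasConnectionModel h Λ G) : ∃ (N : Type) (anc : ℕ → G.V → N) (lab : G.V → Λ)
      (C : N → Λ → Λ → Prop),
      (∀ x y, anc 0 x = anc 0 y) ∧ (∀ j x y, anc (j + 1) x = anc (j + 1) y → anc j x = anc j y) ∧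
      (∀ x y, anc h x = anc h y → x = y) ∧ (∀ z a b, C z a b → C z b a) ∧
      ∀ l x y, anc l x = anc l y → anc (l + 1) x ≠ anc (l + 1) y →
        (G.graph.Adj x y ↔ C (anc l x) (lab x) (lab y)) := by
  obtain ⟨N, _, p, r, leaf, lab, C, htree, hdepth, hleaf, hC, hadj⟩ := hG
  obtain ⟨dep, anc, h1, h2, h3, h4, h5⟩ := htree.exists_anc
  have hinj : Function.Injective leaf := fun x y hxy =>
    hleaf.injOn (Set.mem_univ _) (Set.mem_univ _) hxy
  have hself : ∀ j x, dep x ≤ j → anc j x = x := fun j x hj =>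
    h4 _ _ x (h2 j x).1 (.refl x) (by rw [(h2 j x).2]; omega)
  have hh : ∀ x, dep x ≤ h := fun x => by
    obtain ⟨k, hk, hk'⟩ := hdepth x
    rwa [← (h1 x k).1 hk']
  -- If the truncation at the depth of a leaf is effective for one of two agreeing leaves, then it
  -- is so for both, and they coincide.
  have hsome : ∀ j x y, anc j (leaf x) = anc j (leaf y) → (x = y ∨ dep (anc j (leaf x)) = j ∧
      j ≤ dep (leaf x) ∧ j ≤ dep (leaf y)) := by
    intro j x y hxy
    have hx := (h2 j (leaf x)).2
    have hy := (h2 j (leaf y)).2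
    rw [← hxy] at hy
    by_cases hj : j ≤ dep (leaf x) ∧ j ≤ dep (leaf y)
    · exact .inr ⟨by omega, hj⟩
    · have e1 : dep (leaf x) ≤ j := by omega
      have e2 : dep (leaf y) ≤ j := by omega
      rw [hself j _ e1, hself j _ e2] at hxy
      exact .inl (hinj hxy)
  refine ⟨N, fun j x => anc j (leaf x), lab, C, ?_, ?_, ?_, hC, ?_⟩ <;> beta_reduce
  · intro x y
    have hr : ∀ x, anc 0 x = r := fun x => by
      have := (h1 (anc 0 x) 0).2 (by rw [(h2 0 x).2]; simp)
      exact Option.some_injective _ this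
    rw [hr, hr]
  · intro j x y hxy
    rcases hsome _ _ _ hxy with rfl | ⟨hz, hx, hy⟩
    · rfl
    · have ex := h2 j (leaf x)
      have ey := h2 j (leaf y)
      have hx' := h3 _ _ _ ex.1 (h2 (j + 1) (leaf x)).1 (by omega)
      have hx'' := hx'.trans (hxy ▸ (h2 (j + 1) (leaf y)).1)
      exact h4 _ _ (leaf y) hx'' ey.1 (by omega)
  · intro x y hxy
    rw [hself h _ (hh _), hself h _ (hh _)] at hxy
    exact hinj hxy
  · intro l x y hxy hne
    have hne' : x ≠ y := by rintro rfl; exact hne rfl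
    obtain ⟨hz, hx, hy⟩ := (hsome _ _ _ hxy).resolve_left hne'
    -- The least common ancestor is `anc l (leaf x)`: a deeper common ancestor would make the two
    -- leaves agree at level `l + 1`.
    refine hadj x y _ hne' ⟨(h2 l _).1, hxy ▸ (h2 l _).1, fun w hwx hwy => ?_⟩
    by_cases hw : dep w ≤ l
    · exact h3 _ _ _ hwx (h2 l _).1 (by omega)
    · refine (hne ?_).elim
      have hwx' := h5 _ _ hwx
      have hwy' := h5 _ _ hwy
      have ex := h2 (l + 1) (leaf x)
      have ey := h2 (l + 1) (leaf y)
      have hx' := (h3 _ _ _ ex.1 hwx (by omega)).trans hwy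
      exact h4 _ _ (leaf y) hx' ey.1 (by omega)

/-- Graphs of bounded shrubdepth are reduced to single vertices by a bounded number of flips. -/
theorem BoundedShrubdepth.exists_compGraph_eq_bot {𝓑 : Set FinGraph} (h𝓑 : BoundedShrubdepth 𝓑) :
    ∃ d, ∀ G ∈ 𝓑, ∃ W, compGraph G.graph W d = ⊥ := by
  obtain ⟨h, Λ, _, hG⟩ := h𝓑
  obtain ⟨n, hn⟩ := exists_oddCommon_iff Λ
  refine ⟨0 + h * (n + 1), fun G hGB => ?_⟩
  obtain ⟨N, anc, lab, C, h0, hanc, hinj, hC, hadj⟩ := (hG G hGB).exists_layers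
  have := flipReducible_of_layers hn anc lab hanc hinj h 0 (by omega) (fun _ _ => True)
    (fun _ => trivial) (fun _ _ _ _ _ => trivial) (fun x y _ => h0 x y) G.graph
    (fun l x => C (anc l x)) (fun l x => hC _) (fun l _ x y hxy => by rw [hxy])
    (fun l _ x y _ => hadj l x y)
  exact FlipReducible.exists_compGraph_eq_bot (W := fun _ => ∅) (this.mono fun _ _ _ => trivial)

/-! ### Guiding vertices to the roots of their components -/

/-- The adjacency of vertices of the graph `K` is determined by their labels and by the last of
the functions `g 0, …, g d` on which they agree. -/
structure IsLayered {V N Λ : Type} (K : SimpleGraph V) (g : ℕ → V → N) (d : ℕ) (lab : V → Λ)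
    (C : ℕ → Λ → Λ → Prop) : Prop where
  zero : ∀ x y, g 0 x = g 0 y
  anc : ∀ j x y, g (j + 1) x = g (j + 1) y → g j x = g j y
  inj : ∀ x y, g d x = g d y → x = y
  adj : ∀ j x y, g j x = g j y → g (j + 1) x ≠ g (j + 1) y →
    (K.Adj x y ↔ C j (lab x) (lab y))

namespace IsLayered

variable {V N Λ : Type} {K : SimpleGraph V} {g : ℕ → V → N} {d : ℕ} {lab : V → Λ}
  {C : ℕ → Λ → Λ → Prop}

theorem le (h : IsLayered K g d lab C) {i j : ℕ} (hij : i ≤ j) {x y : V} (hxy : g j x = g j y) :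
    g i x = g i y := by
  induction j, hij using Nat.le_induction with
  | base => exact hxy
  | succ j _ ih => exact ih (h.anc _ _ _ hxy)

theorem exists_level (h : IsLayered K g d lab C) {x y : V} (hxy : x ≠ y) :
    ∃ j < d, g j x = g j y ∧ g (j + 1) x ≠ g (j + 1) y := by
  classical
  have hex : ∃ j, g j x ≠ g j y := ⟨d, fun h' => hxy (h.inj x y h')⟩
  have h1 := Nat.find_spec hex
  have h2 : Nat.find hex ≤ d := Nat.find_min' hex fun h' => hxy (h.inj x y h')
  have h3 := fun m => Nat.find_min hex (m := m)
  revert h1 h2 h3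
  cases Nat.find hex with
  | zero => exact fun h1 _ _ => (h1 (h.zero x y)).elim
  | succ j => exact fun h1 h2 h3 => ⟨j, h2, not_not.1 (h3 j (Nat.lt_succ_self j)), h1⟩

/-- Boundedly many subsets of `B` suffice to make a neighbor in `B` unique. -/
theorem exists_guide (h : IsLayered K g d lab C) (B : Set V) :
    ∃ U : Λ × Fin d × Bool → Set V, (∀ q, U q ⊆ B) ∧
      ∀ a, (∃ b ∈ B, K.Adj a b) → ∃ q, ∃! y, y ∈ U q ∧ K.Adj a y := by
  classical
  rcases isEmpty_or_nonempty V with hV | hV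
  · exact ⟨fun _ => ∅, fun _ => Set.empty_subset _, fun a => isEmptyElim a⟩
  let P : Λ → ℕ → N → V → Prop := fun β j v y => y ∈ B ∧ lab y = β ∧ g j y = v
  -- In each class `v` of level `j`, one vertex `b₁` of `B` with label `β` is selected, and a second
  -- one `b₂` that is separated from `b₁` at level `j + 1`, if they exist. So each set `U q` has at
  -- most one vertex in each class of its level.
  let b₁ : Λ → ℕ → N → V := fun β j v => Classical.epsilon (P β j v)
  let P' : Λ → ℕ → N → V → Prop := fun β j v y =>
    P β j v y ∧ g (j + 1) y ≠ g (j + 1) (b₁ β j v)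
  let b₂ : Λ → ℕ → N → V := fun β j v => Classical.epsilon (P' β j v)
  let U : Λ × Fin d × Bool → Set V := fun q => {y | y ∈ B ∧ lab y = q.1 ∧
    y = (if q.2.2 then b₁ q.1 q.2.1 (g q.2.1 y) else b₂ q.1 q.2.1 (g q.2.1 y))}
  refine ⟨U, fun q y hy => hy.1, fun a ha => ?_⟩
  -- The level is chosen least among those at which `a` is separated from a neighbor in `B`. All
  -- neighbors of `a` in `B` then lie in the class of `a` at this level, which gives uniqueness.
  have hex : ∃ j, ∃ b ∈ B, K.Adj a b ∧ g j a = g j b ∧ g (j + 1) a ≠ g (j + 1) b := by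
    obtain ⟨b, hb, hab⟩ := ha
    obtain ⟨j, -, h1, h2⟩ := h.exists_level hab.ne
    exact ⟨j, b, hb, hab, h1, h2⟩
  have hmin := fun m => Nat.find_min hex (m := m)
  obtain ⟨b, hb, hab, h1, h2⟩ := Nat.find_spec hex
  revert hmin h1 h2
  generalize Nat.find hex = j
  intro hmin h1 h2
  have hjd : j < d := by
    by_contra hj
    exact hab.ne (h.inj _ _ (h.le (by omega) h1))
  have hC : C j (lab a) (lab b) := (h.adj j a b h1 h2).1 hab
  have hadj : ∀ y, lab y = lab b → g j a = g j y → g (j + 1) a ≠ g (j + 1) y → K.Adj a y :=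
    fun y hy h3 h4 => (h.adj j a y h3 h4).2 (hy ▸ hC)
  have hlev : ∀ y ∈ B, K.Adj a y → g j a = g j y := by
    intro y hy hay
    obtain ⟨i, -, h3, h4⟩ := h.exists_level hay.ne
    by_cases hij : i < j
    · exact (hmin i hij ⟨y, hy, hay, h3, h4⟩).elim
    · exact h.le (by omega) h3
  have hb₁ : P (lab b) j (g j b) (b₁ (lab b) j (g j b)) :=
    Classical.epsilon_spec (p := P (lab b) j (g j b)) ⟨b, hb, rfl, rfl⟩
  -- Whichever of `b₁` and `b₂` is separated from `a` at level `j + 1` is adjacent to `a`, since it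
  -- has the label of the neighbor `b`. If it is not `b₁`, then it is `b₂`, and `b` itself shows
  -- that `b₂` exists.
  by_cases hcase : g (j + 1) a = g (j + 1) (b₁ (lab b) j (g j b))
  · have hb₂ : P' (lab b) j (g j b) (b₂ (lab b) j (g j b)) :=
      Classical.epsilon_spec (p := P' (lab b) j (g j b))
        ⟨b, ⟨hb, rfl, rfl⟩, fun h' => h2 (hcase.trans h'.symm)⟩
    refine ⟨(lab b, ⟨j, hjd⟩, false), b₂ (lab b) j (g j b), ⟨⟨hb₂.1.1, hb₂.1.2.1, ?_⟩, ?_⟩, ?_⟩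
    · simp [hb₂.1.2.2]
    · exact hadj _ hb₂.1.2.1 (h1.trans hb₂.1.2.2.symm) fun h' => hb₂.2 (h'.symm.trans hcase)
    · rintro y ⟨⟨hy1, hy2, hy3⟩, hay⟩
      have := hlev y hy1 hay
      simp only [← this, h1, Bool.false_eq_true, if_false] at hy3
      exact hy3
  · refine ⟨(lab b, ⟨j, hjd⟩, true), b₁ (lab b) j (g j b), ⟨⟨hb₁.1, hb₁.2.1, ?_⟩, ?_⟩, ?_⟩
    · simp [hb₁.2.2]
    · exact hadj _ hb₁.2.1 (h1.trans hb₁.2.2.symm) hcase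
    · rintro y ⟨⟨hy1, hy2, hy3⟩, hay⟩
      have := hlev y hy1 hay
      simp only [← this, h1, if_true] at hy3
      exact hy3

/-- A bound for the length of geodesics. -/
def geodesicBound (T : ℕ) : ℕ → ℕ
  | 0 => 0
  | k + 1 => (2 * T + 1) * (geodesicBound T k + 4)

/-- The hypothesis `hp'` is the only property of geodesics that is used: a common neighbor bounds
the distance of positions by `2`. A long segment inside one class of level `j` is cut into `2 * T +
1` blocks. By induction each block contains an edge between different classes of level `j + 1`.
Three of these edges have the same pair of end labels, and equal labels force adjacencies that
shorten the path. In a block, `M + 1` edges force a crossing, and the rest keeps crossings of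
different blocks more than `2` apart. -/
theorem geodesic_le [Finite Λ] (h : IsLayered K g d lab C) {n : ℕ} {p : ℕ → V}
    (hp : ∀ i < n, K.Adj (p i) (p (i + 1)))
    (hp' : ∀ i ≤ n, ∀ k ≤ n, ∀ z, K.Adj (p i) z → K.Adj (p k) z → k ≤ i + 2) (k j : ℕ)
    (hjk : j + k = d) (s t : ℕ) (hst : s ≤ t) (ht : t ≤ n)
    (hc : ∀ i, s ≤ i → i ≤ t → g j (p i) = g j (p s)) :
    t - s ≤ geodesicBound (Nat.card (Λ × Λ)) k := by
  classical
  cases nonempty_fintype Λ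
  rw [Nat.card_eq_fintype_card]
  induction k generalizing j s t with
  | zero =>
    by_contra hlt
    rw [geodesicBound] at hlt
    obtain rfl : j = d := by omega
    exact (hp s (by omega)).ne (h.inj _ _ (hc (s + 1) (by omega) (by omega)).symm)
  | succ k ih =>
    set T := Fintype.card (Λ × Λ) with hT
    set M := geodesicBound T k with hM
    by_contra hlt
    rw [geodesicBound, ← hM, not_le] at hlt
    have hblock : ∀ b : Fin (2 * T + 1), s + b * (M + 4) + (M + 4) ≤ t := by
      intro b
      have : (b.val + 1) * (M + 4) ≤ (2 * T + 1) * (M + 4) := Nat.mul_le_mul_right _ b.2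
      have e : (b.val + 1) * (M + 4) = b * (M + 4) + (M + 4) := by ring
      omega
    have hcross : ∀ b : Fin (2 * T + 1), ∃ i, s + b * (M + 4) ≤ i ∧ i ≤ s + b * (M + 4) + M ∧
        g (j + 1) (p i) ≠ g (j + 1) (p (i + 1)) := by
      intro b
      by_contra hno
      push Not at hno
      have hb := hblock b
      have := ih (j + 1) (by omega) (s + b * (M + 4)) (s + b * (M + 4) + (M + 1)) (by omega)
        (by omega) (fun i hi hi' => by
          induction i, hi using Nat.le_induction with
          | base => rfl
          | succ i hi ih' => rw [← hno i hi (by omega), ih' (by omega)])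
      omega
    choose idx h1 h2 h3 using hcross
    -- If the two vertices were in different classes of level `j + 1`, their labels would make them
    -- adjacent, and `p (idx b + 1)` would be a common neighbor of vertices from distant blocks.
    have hpair : ∀ b b', b ≠ b' → lab (p (idx b)) = lab (p (idx b')) →
        lab (p (idx b + 1)) = lab (p (idx b' + 1)) →
        g (j + 1) (p (idx b')) = g (j + 1) (p (idx b + 1)) := by
      intro b b' hbb hl hl'
      by_contra hne
      have hb := hblock b
      have hb' := hblock b'
      have hi := h1 b
      have hi' := h2 b
      have hj := h1 b'
      have hj' := h2 b'
      have e1 := hc (idx b) (by omega) (by omega)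
      have e2 := hc (idx b + 1) (by omega) (by omega)
      have e3 := hc (idx b') (by omega) (by omega)
      have a1 := hp (idx b) (by omega)
      have a2 : K.Adj (p (idx b')) (p (idx b + 1)) := by
        rw [h.adj j _ _ (e3.trans e2.symm) hne, ← hl]
        exact (h.adj j _ _ (e1.trans e2.symm) (h3 b)).1 a1
      have d1 := hp' _ (by omega) _ (by omega) _ a1 a2
      have d2 := hp' _ (by omega) _ (by omega) _ a2 a1
      rcases lt_or_gt_of_ne hbb with hlt' | hlt'
      · have : (b.val + 1) * (M + 4) ≤ b'.val * (M + 4) := Nat.mul_le_mul_right _ hlt'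
        have e : (b.val + 1) * (M + 4) = b * (M + 4) + (M + 4) := by ring
        omega
      · have : (b'.val + 1) * (M + 4) ≤ b.val * (M + 4) := Nat.mul_le_mul_right _ hlt'
        have e : (b'.val + 1) * (M + 4) = b' * (M + 4) + (M + 4) := by ring
        omega
    -- There are `2 * T + 1` edges and `T` pairs of labels, so some pair occurs three times. With
    -- three edges, the equalities of `hpair` link both ends of the edge of `a` through the edges of
    -- `b` and `c`, although that edge joins different classes.
    obtain ⟨⟨α, β⟩, hτ⟩ := Fintype.exists_lt_card_fiber_of_mul_lt_card
      (fun b : Fin (2 * T + 1) => (lab (p (idx b)), lab (p (idx b + 1)))) (n := 2)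
      (by rw [Fintype.card_fin, ← hT]; omega)
    obtain ⟨a, ha, b, hb, c, hc', hab, hac, hbc⟩ := Finset.two_lt_card.1 hτ
    simp only [Finset.mem_filter, Finset.mem_univ, true_and, Prod.mk.injEq] at ha hb hc'
    have q1 := hpair a b hab (ha.1.trans hb.1.symm) (ha.2.trans hb.2.symm)
    have q2 := hpair a c hac (ha.1.trans hc'.1.symm) (ha.2.trans hc'.2.symm)
    have q3 := hpair b a hab.symm (hb.1.trans ha.1.symm) (hb.2.trans ha.2.symm)
    have q4 := hpair b c hbc (hb.1.trans hc'.1.symm) (hb.2.trans hc'.2.symm)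
    exact h3 a (q3.trans (q4.symm.trans q2))

/-- On a shortest walk, a common neighbor of two vertices more than two steps apart would give a
shortcut. All vertices agree at level `0`, so the bound for geodesics applies to the whole walk. -/
theorem dist_le [Finite Λ] (h : IsLayered K g d lab C) {x y : V} (hxy : K.Reachable x y) :
    K.dist x y ≤ geodesicBound (Nat.card (Λ × Λ)) d := by
  obtain ⟨w, hw⟩ := hxy.exists_walk_length_eq_dist
  have := h.geodesic_le (n := w.length) (p := w.getVert)
    (fun i hi => w.adj_getVert_succ hi) (fun i hi k hk z hiz hkz => by
      by_contra hlt
      have := SimpleGraph.dist_le (((w.take i).append (.cons hiz (.cons hkz.symm .nil))).append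
        (w.drop k))
      simp only [SimpleGraph.Walk.length_append, SimpleGraph.Walk.length_cons,
        SimpleGraph.Walk.length_nil, SimpleGraph.Walk.take_length,
        SimpleGraph.Walk.drop_length] at this
      omega) d 0 (by omega) 0 w.length (by omega) le_rfl (fun i _ _ => h.zero _ _)
  omega

/-- Boundedly many colors allow to find for each vertex a neighbor that is closer to the root
`ρ x` of the component. -/
theorem exists_parents [Finite Λ] (h : IsLayered K g d lab C) (ρ : V → V)
    (hρ : ∀ x, K.Reachable x (ρ x)) (hρ' : ∀ x y, K.Adj x y → ρ x = ρ y) {M : ℕ}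
    (hM : geodesicBound (Nat.card (Λ × Λ)) d ≤ M) :
    ∃ (X U : Fin M × Λ × Fin d × Bool → Set V) (f : V → V),
      (∀ x y, (ρ x = x ∧ x = y) ∨ (ρ x ≠ x ∧ ∃ q, x ∈ X q ∧ y ∈ U q ∧ K.Adj x y) ↔ f x = y) ∧
      ∀ x, f^[M] x = ρ x := by
  classical
  have hD : ∀ x, K.dist x (ρ x) ≤ M := fun x => (h.dist_le (hρ x)).trans hM
  -- A guide is taken for each sphere around the representatives: the neighbors sought are those at
  -- distance `k` from the representative. Only distances `k < M` occur, as the starting point is at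
  -- distance at most `M`.
  choose U hU hU' using fun k : Fin M => h.exists_guide {y | K.dist y (ρ y) = k}
  have key : ∀ x, ρ x ≠ x → ∃ (q : Fin M × Λ × Fin d × Bool),
      (∃! y, y ∈ U q.1 q.2 ∧ K.Adj x y) ∧ q.1 + 1 = K.dist x (ρ x) := by
    intro x hx
    obtain ⟨w, hw⟩ := (hρ x).exists_walk_length_eq_dist
    have hDx := hD x
    revert hw
    generalize hz : ρ x = z at w
    cases w with
    | nil => exact (hx hz).elim
    | @cons _ y _ hxy w =>
      intro hw
      rw [SimpleGraph.Walk.length_cons] at hw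
      have h1 := SimpleGraph.dist_le w
      have h2 : K.dist x z ≤ K.dist y z + 1 := by
        obtain ⟨w', hw'⟩ := (SimpleGraph.Walk.reachable w).exists_walk_length_eq_dist
        have := SimpleGraph.dist_le (.cons hxy w')
        rw [SimpleGraph.Walk.length_cons] at this
        omega
      have h3 : K.dist y (ρ y) = w.length := by
        rw [← hρ' x y hxy, hz]
        omega
      obtain ⟨q, hq⟩ := hU' ⟨w.length, by rw [hz] at hDx; omega⟩ x ⟨y, h3, hxy⟩
      exact ⟨(_, q), hq, hw⟩
  choose q hq hq' using key
  let f : V → V := fun x => if hx : ρ x = x then x else (hq x hx).choose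
  have hf : ∀ x, ρ x = x → f x = x := fun x hx => dif_pos hx
  have hf' : ∀ x (hx : ρ x ≠ x), f x = (hq x hx).choose := fun x hx => dif_neg hx
  refine ⟨fun q' => {x | ∃ hx, q x hx = q'}, fun q' => U q'.1 q'.2, f, fun x y => ?_, ?_⟩
  · by_cases hx : ρ x = x
    · simp [hx, hf x hx]
    · have hspec := (hq x hx).choose_spec
      rw [hf' x hx]
      refine (or_iff_right fun h => hx h.1).trans ((and_iff_right hx).trans ⟨?_, ?_⟩)
      · rintro ⟨_, ⟨_, rfl⟩, hy, hxy⟩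
        exact (hspec.2 y ⟨hy, hxy⟩).symm
      · rintro rfl
        exact ⟨_, ⟨hx, rfl⟩, hspec.1⟩
  · have hiter : ∀ m x, K.dist x (ρ x) ≤ m → f^[m] x = ρ x := by
      intro m
      induction m with
      | zero =>
        intro x hx
        exact (hρ x).dist_eq_zero_iff.1 (by omega)
      | succ m ih =>
        intro x hx
        rw [Function.iterate_succ_apply]
        by_cases hx' : ρ x = x
        -- Representatives are fixed by `f`, so iterating more often than the distance requires does
        -- no harm.
        · have hfix : ∀ m, f^[m] x = x := fun m => Function.iterate_fixed (hf x hx') m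
          rw [hf x hx', hfix, hx']
        · have hspec := (hq x hx').choose_spec.1
          rw [← hf' x hx'] at hspec
          have h1 := hU _ _ hspec.1
          have h2 := hq' x hx'
          simp only [Set.mem_ofPred_eq] at h1
          rw [ih (f x) (by omega), hρ' _ _ hspec.2]
    exact fun x => hiter M x (hD x)

end IsLayered

/-! ### The tree of iterated components -/

section Components

variable {V : Type} (G : SimpleGraph V) (W : ℕ → Set V)

/-- A representative of the component of `x` at level `j`. -/
noncomputable def compRep (j : ℕ) (x : V) : V :=
  Quot.out ((compGraph G W j).connectedComponentMk x)

variable {G W}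

theorem reachable_compRep (j : ℕ) (x : V) : (compGraph G W j).Reachable x (compRep G W j x) :=
  (SimpleGraph.ConnectedComponent.exact (Quot.out_eq _)).symm

theorem compRep_eq_iff {j : ℕ} {x y : V} :
    compRep G W j x = compRep G W j y ↔ (compGraph G W j).Reachable x y := by
  refine ⟨fun h => ?_, fun h => ?_⟩
  · exact (reachable_compRep j x).trans (h ▸ (reachable_compRep j y).symm)
  · exact congrArg Quot.out (SimpleGraph.ConnectedComponent.sound h)

theorem compRep_idem (j : ℕ) (x : V) : compRep G W j (compRep G W j x) = compRep G W j x :=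
  compRep_eq_iff.2 (reachable_compRep j x).symm

theorem compGraph_zero_reachable (x y : V) : (compGraph G W 0).Reachable x y := by
  by_cases h : x = y
  · exact h ▸ .refl x
  · exact SimpleGraph.Adj.reachable (G := ⊤) h

theorem compGraph_reachable_of_succ {j : ℕ} {x y : V}
    (h : (compGraph G W (j + 1)).Reachable x y) : (compGraph G W j).Reachable x y := by
  rw [SimpleGraph.reachable_iff_reflTransGen] at h
  induction h with
  | refl => exact .refl _
  | tail _ h ih => exact ih.trans h.1

theorem compGraph_reachable_of_le {i j : ℕ} (hij : i ≤ j) {x y : V}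
    (h : (compGraph G W j).Reachable x y) : (compGraph G W i).Reachable x y := by
  induction j, hij using Nat.le_induction with
  | base => exact h
  | succ j _ ih => exact ih (compGraph_reachable_of_succ h)

theorem eq_of_reachable_of_eq_bot {d : ℕ} (hd : compGraph G W d = ⊥) {x y : V}
    (h : (compGraph G W d).Reachable x y) : x = y := by
  rw [hd] at h
  exact SimpleGraph.reachable_bot.1 h

theorem compRep_of_eq_bot {d : ℕ} (hd : compGraph G W d = ⊥) (x : V) : compRep G W d x = x :=
  (eq_of_reachable_of_eq_bot hd (reachable_compRep d x)).symm

/-- The relation on labels that determines adjacency at level `i`, for pairs that are separated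
after level `j`. -/
def layerRel (d : ℕ) : ℕ → ℕ → (Fin d → Prop) → (Fin d → Prop) → Prop
  | 0, _, _, _ => True
  | i + 1, j, a, b => i ≤ j ∧ Xor (OddCommon (fun l => {a | ∃ h : l < d, a ⟨l, h⟩}) (j + 1) a b)
      (OddCommon (fun l => {a | ∃ h : l < d, a ⟨l, h⟩}) (i + 1) a b)

/-- A pair separated right after level `j` is not adjacent after `j + 1` flips, so its adjacency in
`G` is the parity of these flips, and hence a function of the labels recording membership in the
sets `W l`. Adjacency after `i + 1` flips follows by adding their parity, and the pair is together
at level `i` exactly if `i ≤ j`. -/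
theorem isLayered_compGraph {d : ℕ} (hd : compGraph G W d = ⊥) {i : ℕ} (hi : i ≤ d) :
    IsLayered (compGraph G W i) (compRep G W) d (fun x (l : Fin d) => x ∈ W l) (layerRel d i) where
  zero x y := compRep_eq_iff.2 (compGraph_zero_reachable x y)
  anc j x y h := compRep_eq_iff.2 (compGraph_reachable_of_succ (compRep_eq_iff.1 h))
  inj x y h := eq_of_reachable_of_eq_bot hd (compRep_eq_iff.1 h)
  adj j x y h1 h2 := by
    rw [compRep_eq_iff] at h1
    rw [Ne, compRep_eq_iff] at h2
    have hne : x ≠ y := by rintro rfl; exact h2 (.refl _)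
    have hj : j < d := by
      by_contra hj
      exact hne (eq_of_reachable_of_eq_bot hd (compGraph_reachable_of_le (not_lt.1 hj) h1))
    have hodd : ∀ m ≤ d, (OddCommon W m x y ↔
        OddCommon (fun l => {a : Fin d → Prop | ∃ h : l < d, a ⟨l, h⟩}) m (fun l => x ∈ W l)
          (fun l => y ∈ W l)) := fun m hm => by
      refine OddCommon.congr ?_ ?_ <;>
        exact fun l hl => ⟨fun h => ⟨by omega, h⟩, fun h => h.2⟩
    have hadj : G.Adj x y ↔ OddCommon W (j + 1) x y := by
      have : ¬ (compGraph G W (j + 1)).Adj x y := fun h => h2 h.reachable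
      simp only [compGraph, h1, true_and, flips_adj, ne_eq, hne, not_false_eq_true, Xor] at this
      by_cases ha : G.Adj x y <;> by_cases hb : OddCommon W (j + 1) x y <;> simp_all
    cases i with
    | zero => exact ⟨fun _ => trivial, fun _ => hne⟩
    | succ i =>
      have hij : (compGraph G W i).Reachable x y ↔ i ≤ j := by
        refine ⟨fun h => ?_, fun h => compGraph_reachable_of_le h h1⟩
        by_contra hlt
        exact h2 (compGraph_reachable_of_le (by omega) h)
      simp only [compGraph, layerRel, hij, flips_adj, hadj, hodd _ hi, hodd _ hj]
      exact and_congr_right fun _ => and_iff_right hne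

end Components

/-- The tree of iterated components. -/
noncomputable def compTree {V : Type} [Finite V] (d : ℕ) (G : SimpleGraph V) (W : ℕ → Set V) :
    Str (treeSig (d + 1)) :=
  treeStr (fun l : Fin (d + 1) => W l)
    (fun k => if k.val = 0 then id else compRep G W (d - k))

open Classical in
/-- After a suitable coloring, a deterministic transduction creates the tree of iterated
components. -/
theorem exists_compTree (d : ℕ) : ∃ (n : ℕ) (T : Transduction (colSig n 0) (treeSig (d + 1))),
    T.AlmostQuantifierFree ∧ T.Deterministic ∧
    ∀ (V : Type) [Finite V] (G : SimpleGraph V) (W : ℕ → Set V), compGraph G W d = ⊥ →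
      ∃ U : Fin n → Set V, Produces T (colStr G.Adj U Fin.elim0)
        ⟨compTree d G W, fun x => if x.1.2 = 0 then some x.1.1 else none⟩ := by
  let M := IsLayered.geodesicBound (Nat.card ((Fin d → Prop) × (Fin d → Prop))) d
  let Q := Fin M × (Fin d → Prop) × Fin d × Bool
  -- The four summands name the colors for the flipped sets, for the representatives of each level,
  -- for the guided vertices and for their targets.
  obtain ⟨n, ⟨e⟩⟩ := Finite.exists_equiv_fin
    (Fin (d + 1) ⊕ Fin (d + 1) ⊕ (Fin (d + 1) × Q) ⊕ (Fin (d + 1) × Q))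
  let c : ℕ → Fin (d + 1) := fun l => Fin.ofNat (d + 1) l
  have hc : ∀ l ≤ d, (c l).val = l := fun l hl => Nat.mod_eq_of_lt (by omega)
  obtain ⟨T, h1, h2, h3⟩ := exists_treeOfColors M (fun l => e (.inl (c l)))
    (fun l => e (.inr (.inl (c l)))) (fun l q => e (.inr (.inr (.inl (c l, q)))))
    (fun l q => e (.inr (.inr (.inr (c l, q))))) d
  refine ⟨n, T, h1, h2, fun V _ G W hd => ?_⟩
  have hpar : ∀ j : Fin (d + 1), ∃ (X U : Q → Set V) (f : V → V),
      (∀ x y, (compRep G W j x = x ∧ x = y) ∨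
        (compRep G W j x ≠ x ∧ ∃ q, x ∈ X q ∧ y ∈ U q ∧ (compGraph G W j).Adj x y) ↔ f x = y) ∧
      ∀ x, f^[M] x = compRep G W j x := fun j =>
    (isLayered_compGraph hd (Nat.le_of_lt_succ j.2)).exists_parents (compRep G W j)
      (reachable_compRep j) (fun x y hxy => compRep_eq_iff.2 hxy.reachable) le_rfl
  choose X U f hf hf' using hpar
  let col : Fin n → Set V := fun i => Sum.elim (fun l : Fin (d + 1) => W l)
    (Sum.elim (fun l : Fin (d + 1) => {x | compRep G W l x = x})
      (Sum.elim (fun q : Fin (d + 1) × Q => X q.1 q.2)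
        (fun q : Fin (d + 1) × Q => U q.1 q.2))) (e.symm i)
  refine ⟨col, ?_⟩
  have hW : ∀ l ≤ d, col (e (.inl (c l))) = W l := fun l hl => by simp [col, hc l hl]
  have hR : ∀ l ≤ d, col (e (.inr (.inl (c l)))) = {x | compRep G W l x = x} := fun l hl => by
    simp [col, hc l hl]
  have hX : ∀ l q, col (e (.inr (.inr (.inl (c l, q))))) = X (c l) q := fun l q => by simp [col]
  have hU : ∀ l q, col (e (.inr (.inr (.inr (c l, q))))) = U (c l) q := fun l q => by simp [col]
  have hit : ∀ l ≤ d, ∀ x, (f (c l))^[M] x = compRep G W l x := fun l hl x => by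
    rw [hf', hc l hl]
  have := h3 V G.Adj col (fun j => f (c j)) Fin.elim0 fun j hj x y => by
    rw [← hf, hc j hj.le]
    refine or_congr ?_ (and_congr ?_ (exists_congr fun q => ?_))
    · rw [hR j hj.le]
      rfl
    · rw [hR j hj.le]
      rfl
    · rw [hX, hU]
      refine and_congr_right fun _ => and_congr_right fun _ => ?_
      cases j with
      | zero => exact ⟨fun h => h.1, fun h => ⟨h, .inl rfl⟩⟩
      | succ j =>
        rw [Nat.add_sub_cancel, hit j (by omega), hit j (by omega), compRep_eq_iff,
          OddCommon.congr (W' := W) (x' := x) (y' := y) (fun l hl => by rw [hW l (by omega)])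
            (fun l hl => by rw [hW l (by omega)])]
        simp only [compGraph, flips_adj]
        exact ⟨fun ⟨h1, h2⟩ => (h2.resolve_left (by omega)).imp_right fun h => ⟨h1, h⟩,
          fun ⟨h1, h2, h3⟩ => ⟨h2, .inr ⟨h1, h3⟩⟩⟩
  have e1 : (fun l : Fin (d + 1) => col (e (.inl (c l)))) = fun l : Fin (d + 1) => W l :=
    funext fun l => hW l (Nat.le_of_lt_succ l.2)
  have e2 : (fun k : Fin (d + 1) => if k.val = 0 then id else (f (c (d - k)))^[M]) =
      fun k : Fin (d + 1) => if k.val = 0 then id else compRep G W (d - k) := by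
    funext k
    congr 1
    exact funext fun x => hit _ (by omega) x
  let O : (Fin (d + 1) → Set V) → (Fin (d + 1) → V → V) →
      Output (colStr G.Adj col Fin.elim0) (treeSig (d + 1)) := fun W g =>
    ⟨treeStr W g, fun x : {x : V × Fin (d + 1) // g x.2 x.1 = x.1} =>
      if x.1.2 = 0 then some x.1.1 else none⟩
  exact (congrArg₂ (fun W g => Produces T _ (O W g)) e1 e2).mp this

theorem uniqueValue_eq_some_iff {V : Type} {P : V → V → Prop} {x y : V}
    (h : ∀ y₁ y₂, P x y₁ → P x y₂ → y₁ = y₂) : uniqueValue P x = some y ↔ P x y := by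
  unfold uniqueValue
  split_ifs with hx
  · rw [Option.some_inj]
    refine ⟨fun hy => hy ▸ hx.choose_spec.1, fun hy => h _ _ hx.choose_spec.1 hy⟩
  · exact ⟨fun h => by simp at h, fun hy => (hx ⟨y, hy, fun y' hy' => h _ _ hy' hy⟩).elim⟩

/-! ### The tree of iterated components is an SC-decomposition -/

/-- The nodes of the tree with parent function `p` are the components: a component at level `dep x`
is represented by its vertex `z x`. The function `ρ i` maps each vertex to the representative of its
component. -/
structure IsCompTree {V N : Type} (d : ℕ) (G : SimpleGraph V) (W : ℕ → Set V) (ρ : ℕ → V → V) (p : N → Option N)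
    (dep : N → ℕ) (z : N → V) : Prop where
  eq_bot : compGraph G W d = ⊥
  rep_eq_iff : ∀ i x y, ρ i x = ρ i y ↔ (compGraph G W i).Reachable x y
  rep_rep : ∀ i x, ρ i (ρ i x) = ρ i x
  le : ∀ x, dep x ≤ d
  rep : ∀ x, ρ (dep x) (z x) = z x
  ext : ∀ x y, dep x = dep y → z x = z y → x = y
  exists_node : ∀ i ≤ d, ∀ v, ∃ x, dep x = i ∧ z x = ρ i v
  parent : ∀ x y, p x = some y ↔ dep x = dep y + 1 ∧ ρ (dep y) (z x) = z y

namespace IsCompTree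

variable {V N : Type} {d : ℕ} {G : SimpleGraph V} {W : ℕ → Set V} {ρ : ℕ → V → V}
  {p : N → Option N} {dep : N → ℕ} {z : N → V}

theorem rep_rep_of_le (h : IsCompTree d G W ρ p dep z) {i j : ℕ} (hij : i ≤ j) (x : V) :
    ρ i (ρ j x) = ρ i x :=
  (h.rep_eq_iff _ _ _).2 (compGraph_reachable_of_le hij ((h.rep_eq_iff _ _ _).1 (h.rep_rep j x)))

theorem ancestor_iff (h : IsCompTree d G W ρ p dep z) (m : ℕ) (x y : N) :
    ancestor p m x = some y ↔ dep x = dep y + m ∧ ρ (dep y) (z x) = z y := by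
  induction m generalizing x with
  | zero =>
    rw [ancestor_zero, Option.some_inj]
    constructor
    · rintro rfl
      exact ⟨rfl, h.rep x⟩
    · rintro ⟨h1, h2⟩
      rw [Nat.add_zero] at h1
      rw [← h1, h.rep] at h2
      exact h.ext _ _ h1 h2
  | succ m ih =>
    rw [ancestor_succ', Option.bind_eq_some_iff]
    constructor
    · rintro ⟨w, hw, hy⟩
      obtain ⟨h1, h2⟩ := (h.parent _ _).1 hw
      obtain ⟨h3, h4⟩ := (ih w).1 hy
      refine ⟨by omega, ?_⟩
      rw [← h4, ← h2, h.rep_rep_of_le (by omega)]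
    · rintro ⟨h1, h2⟩
      have hle := h.le x
      obtain ⟨w, hw, hw'⟩ := h.exists_node (dep y + m) (by omega) (z x)
      refine ⟨w, (h.parent _ _).2 ⟨by omega, by rw [hw, hw']⟩, (ih w).2 ⟨hw, ?_⟩⟩
      rw [hw', h.rep_rep_of_le (by omega), h2]

theorem isAncestor_iff (h : IsCompTree d G W ρ p dep z) (x y : N) :
    IsAncestor p y x ↔ dep y ≤ dep x ∧ ρ (dep y) (z x) = z y := by
  refine ⟨fun ⟨m, hm⟩ => ?_, fun ⟨h1, h2⟩ => ⟨dep x - dep y, ?_⟩⟩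
  · obtain ⟨h1, h2⟩ := (h.ancestor_iff m x y).1 hm
    exact ⟨by omega, h2⟩
  · exact (h.ancestor_iff _ x y).2 ⟨by omega, h2⟩

theorem isLeaf_iff (h : IsCompTree d G W ρ p dep z) (x : N) : IsLeaf p x ↔ dep x = d := by
  have hle := h.le x
  refine ⟨fun hx => ?_, fun hx y hy => ?_⟩
  · by_contra hne
    obtain ⟨y, hy, hy'⟩ := h.exists_node (dep x + 1) (by omega) (z x)
    refine hx y ((h.parent y x).2 ⟨hy, ?_⟩)
    rw [hy', h.rep_rep_of_le (by omega), h.rep]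
  · have := h.le y
    have := ((h.parent y x).1 hy).1
    omega

theorem exists_root [Nonempty V] (h : IsCompTree d G W ρ p dep z) :
    ∃ r, IsRootedTree p r ∧ dep r = 0 ∧ ∀ x, ρ 0 x = z r := by
  obtain ⟨r, hr, hr'⟩ := h.exists_node 0 (Nat.zero_le _) (Classical.arbitrary V)
  have hall : ∀ x, ρ 0 x = z r := fun x => by
    rw [hr', h.rep_eq_iff]
    exact compGraph_zero_reachable _ _
  refine ⟨r, ⟨?_, fun x => (h.isAncestor_iff x r).2 ⟨by omega, ?_⟩⟩, hr, hall⟩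
  · rw [Option.eq_none_iff_forall_ne_some]
    intro y hy
    have := ((h.parent _ _).1 hy).1
    omega
  · rw [hr, hall]

/-- Inside one component of level `i`, which is the range of `ι`, the edges of level `i + 1` are
simply those of the flipped graph, and no edge of level `i + 1` leaves the component. -/
theorem reachable_comap_iff (h : IsCompTree d G W ρ p dep z) {V' : Type} {ι : V' → V} {i : ℕ}
    {c : V} (hι : Set.range ι = {x | ρ i x = c}) (hinj : Function.Injective ι) (a b : V') :
    ((flips G W (i + 1)).comap ι).Reachable a b ↔
      (compGraph G W (i + 1)).Reachable (ι a) (ι b) := by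
  have hι' : ∀ a, ρ i (ι a) = c := fun a => hι.subset ⟨a, rfl⟩
  rw [SimpleGraph.reachable_iff_reflTransGen]
  constructor
  · intro h
    induction h with
    | refl => exact .refl _
    | @tail x y _ hxy ih =>
      refine ih.trans (SimpleGraph.Adj.reachable ⟨(h.rep_eq_iff _ _ _).1 ?_, hxy⟩)
      rw [hι', hι']
  · rw [SimpleGraph.reachable_iff_reflTransGen]
    generalize hy : ι b = y
    intro h
    induction h generalizing b with
    | refl => rw [hinj hy]
    | @tail x y _ hxy ih =>
      subst hy
      obtain ⟨x', rfl⟩ : x ∈ Set.range ι := by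
        rw [hι]
        exact ((h.rep_eq_iff _ _ _).2 hxy.1).trans (hι' b)
      exact .tail (ih x' rfl) hxy.2

theorem bijOn_leaf (h : IsCompTree d G W ρ p dep z) {leaf : V → N}
    (hleaf : ∀ v, dep (leaf v) = d ∧ z (leaf v) = v) (s : N) {V' : Type} {ι : V' → V}
    (hinj : Function.Injective ι) (hι : Set.range ι = {x | ρ (dep s) x = z s}) :
    Set.BijOn (fun v => leaf (ι v)) Set.univ {x | IsLeaf p x ∧ IsAncestor p s x} := by
  refine ⟨fun v _ => ⟨(h.isLeaf_iff _).2 (hleaf _).1, (h.isAncestor_iff _ _).2 ⟨?_, ?_⟩⟩,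
    fun v _ w _ hvw => hinj ?_, fun x ⟨hx, hx'⟩ => ?_⟩
  · rw [(hleaf _).1]
    exact h.le s
  · rw [(hleaf _).2]
    exact hι.subset ⟨v, rfl⟩
  · rw [← (hleaf (ι v)).2, ← (hleaf (ι w)).2]
    exact congrArg z hvw
  · rw [h.isLeaf_iff] at hx
    obtain ⟨v, hv⟩ : z x ∈ Set.range ι := by
      rw [hι]
      exact ((h.isAncestor_iff _ _).1 hx').2
    refine ⟨v, Set.mem_univ _, h.ext _ _ ((hleaf _).1.trans hx.symm) ?_⟩
    rw [(hleaf _).2, hv]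

/-- The definition of SC-decompositions passes to nested induced subgraphs on subtypes. Replacing
them by a graph pulled back along an injection `ι` onto the component of `s` makes the induction go
through. -/
theorem isSCSubtree (h : IsCompTree d G W ρ p dep z) {leaf : V → N}
    (hleaf : ∀ v, dep (leaf v) = d ∧ z (leaf v) = v) (m i : ℕ) (him : i + m = d)
    (C : Fin (m + 1) → Set N) (hC : ∀ l v, leaf v ∈ C l ↔ v ∈ W (i + l)) (s : N) (hs : dep s = i)
    (V' : Type) (ι : V' → V) (hinj : Function.Injective ι)
    (hι : Set.range ι = {x | ρ i x = z s}) :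
    IsSCSubtree p m C s V' ((flips G W i).comap ι) (fun v => leaf (ι v)) := by
  induction m generalizing i s V' with
  | zero => exact ⟨h.bijOn_leaf hleaf s hinj (hs ▸ hι), (h.isLeaf_iff s).2 (by omega)⟩
  | succ m ih =>
    refine ⟨h.bijOn_leaf hleaf s hinj (hs ▸ hι), ?_⟩
    have hH : flipWithin ((flips G W i).comap ι) ((fun v => leaf (ι v)) ⁻¹' C 0) =
        (flips G W (i + 1)).comap ι := by
      ext a b
      rw [flipWithin_adj, SimpleGraph.comap_adj, SimpleGraph.comap_adj, flips, flipWithin_adj,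
        hinj.ne_iff, Set.mem_preimage, Set.mem_preimage, hC, hC]
      rfl
    rw [hH]
    have hchild : ∀ a, ∃ t, p t = some s ∧ dep t = i + 1 ∧ z t = ρ (i + 1) (ι a) := by
      intro a
      obtain ⟨t, ht, ht'⟩ := h.exists_node (i + 1) (by omega) (ι a)
      refine ⟨t, (h.parent _ _).2 ⟨by omega, ?_⟩, ht, ht'⟩
      rw [ht', hs, h.rep_rep_of_le (by omega)]
      exact hι.subset ⟨a, rfl⟩
    choose t ht ht' ht'' using hchild
    have htt : ∀ a b, t a = t b ↔ ((flips G W (i + 1)).comap ι).Reachable a b := fun a b => by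
      rw [h.reachable_comap_iff hι hinj, ← h.rep_eq_iff, ← ht'', ← ht'']
      exact ⟨congrArg z, h.ext _ _ ((ht' a).trans (ht' b).symm)⟩
    -- Components correspond to children via the node of level `i + 1` whose representative is that
    -- of any vertex in the component.
    let E : ((flips G W (i + 1)).comap ι).ConnectedComponent → {t : N // p t = some s} :=
      Quot.lift (fun a => ⟨t a, ht a⟩) fun a b hab => Subtype.ext ((htt a b).2 hab)
    have hE : Function.Bijective E := by
      constructor
      · rintro ⟨a⟩ ⟨b⟩ hab
        exact SimpleGraph.ConnectedComponent.sound ((htt a b).1 (congrArg Subtype.val hab))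
      · rintro ⟨y, hy⟩
        obtain ⟨hy1, hy2⟩ := (h.parent _ _).1 hy
        rw [hs] at hy1 hy2
        obtain ⟨a, ha⟩ : z y ∈ Set.range ι := hι.superset hy2
        refine ⟨SimpleGraph.connectedComponentMk _ a, Subtype.ext (h.ext _ _ ?_ ?_)⟩
        · exact (ht' a).trans hy1.symm
        · refine (ht'' a).trans ?_
          rw [ha, ← hy1, h.rep]
    refine ⟨(Equiv.ofBijective E hE).symm, fun y => ?_⟩
    have hsupp : ∀ a, a ∈ ((Equiv.ofBijective E hE).symm y).supp ↔ t a = y.1 := fun a => by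
      rw [SimpleGraph.ConnectedComponent.mem_supp_iff, Equiv.eq_symm_apply]
      exact Subtype.ext_iff
    obtain ⟨hy1, hy2⟩ := (h.parent _ _).1 y.2
    rw [hs] at hy1 hy2
    have key : ∀ a, a ∈ ((Equiv.ofBijective E hE).symm y).supp ↔
        ρ (i + 1) (ι a) = z y.1 := fun a => by
      rw [hsupp, ← ht'']
      exact ⟨fun h => congrArg z h, h.ext _ _ ((ht' a).trans hy1.symm)⟩
    have hr : Set.range (fun a : ((Equiv.ofBijective E hE).symm y).supp => ι a.1) =
        {x | ρ (i + 1) x = z y.1} := by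
      ext x
      constructor
      · rintro ⟨a, rfl⟩
        exact (key a.1).1 a.2
      · intro hx
        obtain ⟨a, rfl⟩ : x ∈ Set.range ι := by
          refine hι.superset ?_
          rw [Set.mem_ofPred_eq] at hx ⊢
          rw [← hy2, ← hx, h.rep_rep_of_le (by omega)]
        exact ⟨⟨a, (key a).2 hx⟩, rfl⟩
    refine ih (i + 1) (by omega) _ (fun l v => ?_) y.1 hy1 _ _
      (hinj.comp Subtype.val_injective) hr
    rw [hC, Fin.val_succ, show i + (l + 1) = i + 1 + l by omega]

end IsCompTree

/-- The leaf of the tree of iterated components that corresponds to a vertex. -/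
def compLeaf {V : Type} [Finite V] (d : ℕ) (G : SimpleGraph V) (W : ℕ → Set V) (v : V) :
    (compTree d G W).V :=
  ⟨(v, 0), rfl⟩

theorem isCompTree_compTree {V : Type} [Finite V] {d : ℕ} {G : SimpleGraph V} {W : ℕ → Set V}
    (hd : compGraph G W d = ⊥) :
    IsCompTree (N := {x : V × Fin (d + 1) //
      (if x.2.val = 0 then id else compRep G W (d - x.2)) x.1 = x.1}) d G W (compRep G W)
      (compTree d G W).parent
      (fun x => d - x.1.2) (fun x => x.1.1) := by
  -- The case distinction at `k = 0` is immaterial: components of level `d` are single vertices, so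
  -- `compRep` is the identity there.
  have hg : ∀ (k : Fin (d + 1)) v, (if k.val = 0 then id else compRep G W (d - k)) v =
      compRep G W (d - k) v := fun k v => by
    split
    · rename_i hk
      rw [hk, Nat.sub_zero, compRep_of_eq_bot hd]
      rfl
    · rfl
  have hrep : ∀ x : {x : V × Fin (d + 1) //
      (if x.2.val = 0 then id else compRep G W (d - x.2)) x.1 = x.1},
      compRep G W (d - x.1.2) x.1.1 = x.1.1 := fun x => (hg _ _).symm.trans x.2
  have hext : ∀ x y : {x : V × Fin (d + 1) //
      (if x.2.val = 0 then id else compRep G W (d - x.2)) x.1 = x.1},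
      d - x.1.2.val = d - y.1.2 → x.1.1 = y.1.1 → x = y := fun x y h1 h2 =>
    Subtype.ext (Prod.ext h2 (Fin.ext (by omega)))
  refine ⟨hd, fun _ _ _ => compRep_eq_iff, compRep_idem, fun x => Nat.sub_le _ _, hrep, hext, fun i hi v => ?_, fun x y => ?_⟩
  · refine ⟨⟨(compRep G W i v, ⟨d - i, by omega⟩), ?_⟩, ?_, rfl⟩
    · rw [hg]
      simp only [Nat.sub_sub_self hi, compRep_idem]
    · exact Nat.sub_sub_self hi
  · have hP : ∀ y' : {x : V × Fin (d + 1) //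
        (if x.2.val = 0 then id else compRep G W (d - x.2)) x.1 = x.1},
        (y'.1.2.val = x.1.2.val + 1 ∧
          (if y'.1.2.val = 0 then id else compRep G W (d - y'.1.2)) x.1.1 = y'.1.1) ↔
        d - x.1.2 = d - y'.1.2 + 1 ∧ compRep G W (d - y'.1.2) x.1.1 = y'.1.1 := fun y' => by
      rw [hg]
      exact and_congr_left fun _ => by omega
    refine Iff.trans (uniqueValue_eq_some_iff (P := fun x y : {x : V × Fin (d + 1) //
      (if x.2.val = 0 then id else compRep G W (d - x.2)) x.1 = x.1} =>
        y.1.2.val = x.1.2.val + 1 ∧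
          (if y.1.2.val = 0 then id else compRep G W (d - y.1.2)) x.1.1 = y.1.1)
      fun y₁ y₂ h₁ h₂ => ?_) (hP y)
    have e : y₁.1.2 = y₂.1.2 := Fin.ext (by omega)
    exact Subtype.ext (Prod.ext (h₁.2.symm.trans (e ▸ h₂.2)) e)

/-- The colored tree `t` is a tree of iterated components of `G`, up to isomorphism, where `leaf`
identifies the vertices of `G` with the leaves of `t`. -/
def IsCompDecomposition {V : Type} (d : ℕ) (G : SimpleGraph V) (t : Str (treeSig (d + 1)))
    (leaf : V → t.V) : Prop :=
  ∃ (W : ℕ → Set V) (ρ : ℕ → V → V) (dep : t.V → ℕ) (z : t.V → V),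
    IsCompTree d G W ρ t.parent dep z ∧ (∀ v, dep (leaf v) = d ∧ z (leaf v) = v) ∧
    ∀ i x, x ∈ t.color i ↔ ∃ v ∈ W i, x = leaf v

theorem flips_comap {V V' : Type} (G : SimpleGraph V) (W : ℕ → Set V) (φ : V' ≃ V) (i : ℕ) :
    flips (G.comap φ) (fun l => φ ⁻¹' W l) i = (flips G W i).comap φ := by
  ext x y
  rw [flips_adj, SimpleGraph.comap_adj, SimpleGraph.comap_adj, flips_adj, φ.injective.ne_iff,
    OddCommon.congr (W := fun l => φ ⁻¹' W l) (W' := W) (x := x) (y := y) (x' := φ x) (y' := φ y)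
      (fun _ _ => Iff.rfl) (fun _ _ => Iff.rfl)]

theorem compGraph_comap {V V' : Type} (G : SimpleGraph V) (W : ℕ → Set V) (φ : V' ≃ V) (i : ℕ) :
    compGraph (G.comap φ) (fun l => φ ⁻¹' W l) i = (compGraph G W i).comap φ := by
  induction i with
  | zero =>
    ext x y
    exact φ.injective.ne_iff.symm
  | succ i ih =>
    ext x y
    change (_ ∧ _) ↔ (_ ∧ _)
    rw [ih, flips_comap]
    exact and_congr_left' (SimpleGraph.Iso.reachable_iff (φ := SimpleGraph.Iso.comap φ _)).symm

theorem IsCompTree.comap {V V' N N' : Type} {d : ℕ} {G : SimpleGraph V} {W : ℕ → Set V}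
    {ρ : ℕ → V → V} {p : N → Option N} {dep : N → ℕ} {z : N → V}
    (h : IsCompTree d G W ρ p dep z) (φ : V' ≃ V) (f : N' ≃ N) {p' : N' → Option N'}
    (hp : ∀ x, p (f x) = (p' x).map f) :
    IsCompTree d (G.comap φ) (fun l => φ ⁻¹' W l) (fun i v => φ.symm (ρ i (φ v))) p'
      (fun x => dep (f x)) (fun x => φ.symm (z (f x))) := by
  refine ⟨?_, fun i x y => ?_, fun i x => ?_, fun x => h.le _, fun x => ?_, fun x y h1 h2 => ?_,
    fun i hi v => ?_, fun x y => ?_⟩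
  · rw [compGraph_comap, h.eq_bot]
    rfl
  · rw [φ.symm.injective.eq_iff, h.rep_eq_iff, compGraph_comap]
    exact SimpleGraph.Iso.reachable_iff (φ := SimpleGraph.Iso.comap φ _)
  · simp only [Equiv.apply_symm_apply, h.rep_rep]
  · simp only [Equiv.apply_symm_apply, h.rep]
  · exact f.injective (h.ext _ _ h1 (φ.symm.injective h2))
  · obtain ⟨x, hx, hx'⟩ := h.exists_node i hi (φ v)
    exact ⟨f.symm x, by rw [Equiv.apply_symm_apply, hx],
      by rw [Equiv.apply_symm_apply, hx']⟩
  · simp only [Equiv.apply_symm_apply, φ.symm.injective.eq_iff]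
    rw [← h.parent, hp, ← Option.map_some, (Option.map_injective f.injective).eq_iff]

namespace IsCompDecomposition

variable {V : Type} {d : ℕ} {G : SimpleGraph V} {t : Str (treeSig (d + 1))} {leaf : V → t.V}

theorem of_iso (h : IsCompDecomposition d G t leaf) {V' : Type} {G' : SimpleGraph V'}
    (φ : V' ≃ V) (hφ : ∀ x y, G.Adj (φ x) (φ y) ↔ G'.Adj x y) {t' : Str (treeSig (d + 1))}
    (f : t'.Iso t) {leaf' : V' → t'.V} (hleaf : ∀ v, f.toEquiv (leaf' v) = leaf (φ v)) :
    IsCompDecomposition d G' t' leaf' := by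
  obtain ⟨W, ρ, dep, z, h1, h2, h3⟩ := h
  obtain rfl : G' = G.comap φ := by
    ext x y
    exact (hφ x y).symm
  refine ⟨_, _, _, _, h1.comap φ f.toEquiv (f.func_eq ()), fun v => ?_, fun i x => ?_⟩
  · rw [hleaf, (h2 _).1, (h2 _).2]
    exact ⟨rfl, φ.symm_apply_apply v⟩
  · have : x ∈ t'.color i ↔ f.toEquiv x ∈ t.color i := (f.rel_iff i fun _ => x).symm
    rw [this, h3]
    constructor
    · rintro ⟨v, hv, hx⟩
      refine ⟨φ.symm v, ?_, f.toEquiv.injective ?_⟩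
      · rwa [Set.mem_preimage, Equiv.apply_symm_apply]
      · rw [hx, hleaf, Equiv.apply_symm_apply]
    · rintro ⟨v, hv, rfl⟩
      exact ⟨_, hv, hleaf v⟩

theorem leaf_injective (h : IsCompDecomposition d G t leaf) : Function.Injective leaf := by
  obtain ⟨W, ρ, dep, z, h1, h2, h3⟩ := h
  intro v w hvw
  rw [← (h2 v).2, hvw, (h2 w).2]

theorem isColoredTree [Nonempty V] (h : IsCompDecomposition d G t leaf) : IsColoredTree d t := by
  obtain ⟨W, ρ, dep, z, h1, h2, h3⟩ := h
  obtain ⟨r, hr, hr', -⟩ := h1.exists_root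
  refine ⟨r, hr, fun x => ?_⟩
  obtain ⟨k, hk⟩ := hr.2 x
  have := ((h1.ancestor_iff _ _ _).1 hk).1
  have := h1.le x
  exact ⟨k, by omega, hk⟩

theorem isSCDecomposition {G : FinGraph} [Nonempty G.V] {leaf : G.V → t.V}
    (h : IsCompDecomposition d G.graph t leaf) : IsSCDecomposition d G t leaf := by
  obtain ⟨W, ρ, dep, z, h1, h2, h3⟩ := h
  refine ⟨fun i x hx => (h1.isLeaf_iff x).2 ?_, ?_⟩
  · obtain ⟨v, -, rfl⟩ := (h3 i x).1 hx
    exact (h2 v).1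
  · obtain ⟨r, hr, hr', hall⟩ := h1.exists_root
    refine ⟨r, hr, h1.isSCSubtree h2 d 0 (Nat.zero_add d) _ (fun l v => ?_) r hr' G.V id
      Function.injective_id ?_⟩
    · rw [Nat.zero_add, h3]
      constructor
      · rintro ⟨w, hw, hvw⟩
        rwa [← (h2 v).2, hvw, (h2 w).2]
      · exact fun hv => ⟨v, hv, rfl⟩
    · rw [Set.range_id]
      exact (Set.eq_univ_of_forall hall).symm

/-- All leaves have depth exactly `d`. This characterizes them by definedness of a term, whereas
having no children would need a quantifier. -/
theorem exists_ancestor_iff (h : IsCompDecomposition d G t leaf) (x : t.V) :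
    (∃ y, ancestor t.parent d x = some y) ↔ ∃ v, x = leaf v := by
  obtain ⟨W, ρ, dep, z, h1, h2, h3⟩ := h
  have hx := h1.le x
  constructor
  · rintro ⟨y, hy⟩
    have := ((h1.ancestor_iff _ _ _).1 hy).1
    exact ⟨z x, h1.ext _ _ ((h2 _).1 ▸ by omega) (h2 _).2.symm⟩
  · rintro ⟨v, rfl⟩
    obtain ⟨r, hr, hr'⟩ := h1.exists_node 0 (Nat.zero_le _) v
    refine ⟨r, (h1.ancestor_iff _ _ _).2 ⟨?_, ?_⟩⟩
    · rw [(h2 v).1, hr, Nat.zero_add]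
    · rw [hr, (h2 v).2, hr']

end IsCompDecomposition

/-! ### Adjacency read off from the decomposition -/

/-- The leaves `x` and `y` of `t` have the same ancestor at distance `k`. -/
def SameAncestor {n : ℕ} (t : Str (treeSig n)) (k : ℕ) (x y : t.V) : Prop :=
  ∃ z, ancestor t.parent k x = some z ∧ ancestor t.parent k y = some z

/-- Leaves are adjacent in the graph that is decomposed by `t`. -/
def TreeAdj {d : ℕ} (t : Str (treeSig (d + 1))) (x y : t.V) : Prop :=
  ∃ j : Fin d, SameAncestor t (d - j) x y ∧ ¬ SameAncestor t (d - (j + 1)) x y ∧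
    OddCommon (fun l => t.color (Fin.ofNat (d + 1) l)) (j + 1) x y

namespace IsCompDecomposition

variable {V : Type} {d : ℕ} {G : SimpleGraph V} {t : Str (treeSig (d + 1))} {leaf : V → t.V}

/-- Distinct vertices have a last common level `j`. They are not adjacent after `j + 1` flips, since
otherwise they would share a component at level `j + 1`; so the parity of the first `j + 1` flips on
the pair decides adjacency. -/
theorem treeAdj_iff (h : IsCompDecomposition d G t leaf) (v w : V) :
    TreeAdj t (leaf v) (leaf w) ↔ G.Adj v w := by
  obtain ⟨W, ρ, dep, z, h1, h2, h3⟩ := h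
  have hsame : ∀ i ≤ d, (SameAncestor t (d - i) (leaf v) (leaf w) ↔
      (compGraph G W i).Reachable v w) := by
    intro i hi
    rw [← h1.rep_eq_iff]
    constructor
    · rintro ⟨x, hx, hx'⟩
      obtain ⟨e1, e2⟩ := (h1.ancestor_iff _ _ _).1 hx
      obtain ⟨e3, e4⟩ := (h1.ancestor_iff _ _ _).1 hx'
      rw [(h2 _).1] at e1
      rw [(h2 _).2] at e2 e4
      obtain rfl : dep x = i := by omega
      rw [e2, e4]
    · intro hvw
      obtain ⟨x, hx, hx'⟩ := h1.exists_node i hi v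
      refine ⟨x, (h1.ancestor_iff _ _ _).2 ?_, (h1.ancestor_iff _ _ _).2 ?_⟩ <;>
        rw [(h2 _).1, (h2 _).2, hx, hx']
      · exact ⟨by omega, rfl⟩
      · exact ⟨by omega, hvw.symm⟩
  have hodd : ∀ j < d, (OddCommon (fun l => t.color (Fin.ofNat (d + 1) l)) (j + 1) (leaf v)
      (leaf w) ↔ OddCommon W (j + 1) v w) := by
    intro j hj
    have hcol : ∀ l < j + 1, ∀ v, leaf v ∈ t.color (Fin.ofNat (d + 1) l) ↔ v ∈ W l := by
      intro l hl v
      rw [h3, show ((Fin.ofNat (d + 1) l : Fin (d + 1)) : ℕ) = l from Nat.mod_eq_of_lt (by omega)]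
      constructor
      · rintro ⟨w, hw, hvw⟩
        rwa [← (h2 v).2, hvw, (h2 w).2]
      · exact fun hv => ⟨v, hv, rfl⟩
    exact OddCommon.congr (fun l hl => hcol l hl v) (fun l hl => hcol l hl w)
  have hadj : ∀ j, (compGraph G W j).Reachable v w → ¬ (compGraph G W (j + 1)).Reachable v w →
      (OddCommon W (j + 1) v w ↔ G.Adj v w) := by
    intro j hj hj'
    have hne : v ≠ w := by rintro rfl; exact hj' (.refl _)
    have : ¬ (compGraph G W (j + 1)).Adj v w := fun h => hj' h.reachable
    simp only [compGraph, hj, true_and, flips_adj, ne_eq, hne, not_false_eq_true, Xor] at this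
    by_cases ha : G.Adj v w <;> by_cases hb : OddCommon W (j + 1) v w <;> simp_all
  constructor
  · rintro ⟨j, hj1, hj2, hj3⟩
    rw [hsame _ j.2.le] at hj1
    rw [hsame _ j.2] at hj2
    rw [hodd _ j.2] at hj3
    exact (hadj _ hj1 hj2).1 hj3
  · intro hvw
    obtain ⟨j, hj, hj1, hj2⟩ := (isLayered_compGraph h1.eq_bot le_rfl).exists_level hvw.ne
    rw [compRep_eq_iff] at hj1
    rw [Ne, compRep_eq_iff] at hj2
    exact ⟨⟨j, hj⟩, (hsame _ hj.le).2 hj1, mt (hsame _ hj).1 hj2,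
      (hodd _ hj).2 ((hadj _ hj1 hj2).2 hvw)⟩

end IsCompDecomposition

theorem isCompDecomposition_compTree {V : Type} [Finite V] {G : SimpleGraph V} {d : ℕ}
    {W : ℕ → Set V} (hd : compGraph G W d = ⊥) :
    IsCompDecomposition d G (compTree d G W) (compLeaf d G W) := by
  refine ⟨W, _, _, _, isCompTree_compTree hd, fun v => ⟨rfl, rfl⟩, fun i x => ?_⟩
  constructor
  · exact fun ⟨h1, h2⟩ => ⟨x.1.1, h1, Subtype.ext (Prod.ext rfl h2)⟩
  · rintro ⟨v, hv, rfl⟩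
    exact ⟨hv, rfl⟩

/-! ### The transduction from trees to graphs -/

theorem qfDef_sameAncestor {n : ℕ} (k : ℕ) :
    QFDef (treeSig n) 2 (fun t v => SameAncestor t k (v 0) (v 1)) :=
  (QFDef.eq (S := treeSig n) (Term.iter () 0 k) (Term.iter () 1 k)).congr fun t v => by
    simp only [Term.eval_iter]
    rfl

theorem qfDef_color {n k : ℕ} (i : Fin n) (j : Fin k) :
    QFDef (treeSig n) k (fun t v => v j ∈ t.color i) :=
  QFDef.rel (S := treeSig n) i (fun _ => j)

theorem qfDef_treeOddCommon {n k : ℕ} (c : ℕ → Fin n) (m : ℕ) (i j : Fin k) :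
    QFDef (treeSig n) k (fun t v => OddCommon (fun l => t.color (c l)) m (v i) (v j)) := by
  induction m with
  | zero => exact .false
  | succ m ih => exact ih.xor ((qfDef_color _ i).and (qfDef_color _ j))

theorem qfDef_treeAdj {d : ℕ} :
    QFDef (treeSig (d + 1)) 2 (fun t v => TreeAdj t (v 0) (v 1)) :=
  .exists_finite fun _ => (qfDef_sameAncestor _).and ((qfDef_sameAncestor _).not.and
    (qfDef_treeOddCommon _ _ 0 1))

/-- A deterministic transduction recovers a graph from its decomposition. -/
theorem exists_leafGraph (d : ℕ) : ∃ B : Transduction (treeSig (d + 1)) graphSig,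
    B.AlmostQuantifierFree ∧ B.Deterministic ∧
    ∀ (G : FinGraph) (t : Str (treeSig (d + 1))) (leaf : G.V → t.V),
      IsCompDecomposition d G.graph t leaf → ∃ o, B.outputs t = {o} ∧
        ∃ e : o.str.Iso G.toStr, ∀ x, o.origin x = some (leaf (e.toEquiv x)) := by
  have h1 := realizable_interp (S := treeSig (d + 1)) (S' := graphSig.addRel 1)
    (r := fun t R => match R with
      | none => fun v => ∃ y, ancestor t.parent d (v (0 : Fin 1)) = some y
      | some _ => fun v => TreeAdj t (v (0 : Fin 2)) (v (1 : Fin 2)))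
    (f := fun _ g => g.elim) (fun R => by
      rcases R with _ | R
      · refine (QFDef.eq (S := treeSig (d + 1)) (k := 1) (Term.iter () 0 d)
          (Term.iter () 0 d)).congr fun t v => ?_
        simp only [Term.eval_iter, and_self]
        rfl
      · exact qfDef_treeAdj) (fun g => g.elim)
  have h2 := realizable_restrict (S := graphSig.addRel 1) (P := fun A x => A.rel none (fun _ => x))
    (QFDef.rel (S := graphSig.addRel 1) none (fun _ => 0))
  have h3 := realizable_pull (S := graphSig.addRel 1) (S' := graphSig)
    ⟨some, id, fun _ => rfl⟩ (Option.some_injective _) Function.injective_id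
  obtain ⟨B, hB⟩ := (h1.comp h2).comp h3
  refine ⟨B, hB.1, hB.2.1, fun G t leaf ht => ⟨_, hB.2.2 t, ?_⟩⟩
  let E : G.V ≃ {x : t.V // ∃ y, ancestor t.parent d x = some y} :=
    Equiv.ofBijective (fun v => ⟨leaf v, (ht.exists_ancestor_iff _).2 ⟨v, rfl⟩⟩)
      ⟨fun v w hvw => ht.leaf_injective (congrArg Subtype.val hvw), fun x => by
        obtain ⟨v, hv⟩ := (ht.exists_ancestor_iff _).1 x.2
        exact ⟨v, Subtype.ext hv.symm⟩⟩
  have hE : ∀ x, leaf (E.symm x) = x.1 := fun x => congrArg Subtype.val (E.apply_symm_apply x)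
  have hadj : ∀ x y, G.graph.Adj (E.symm x) (E.symm y) ↔ TreeAdj t x.1 y.1 := fun x y => by
    rw [← hE, ← hE, ht.treeAdj_iff]
  exact ⟨⟨E.symm, fun _ v => hadj (v (0 : Fin 2)) (v (1 : Fin 2)), fun g => g.elim⟩,
    fun x => congrArg some (hE x).symm⟩

/-! ### The transduction from graphs to trees -/

/-- The colored graph `A` is mapped by `D` to a tree of iterated components of the graph. -/
def IsGoodColoring {n d : ℕ} (D : Transduction (colSig n 0) (treeSig (d + 1)))
    (A : Str (colSig n 0)) : Prop :=
  ∃ G : SimpleGraph A.V, (∀ x y, G.Adj x y ↔ A.rel none ![x, y]) ∧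
    ∃ o ∈ D.outputs A, ∃ leaf : A.V → o.str.V, (∀ x v, o.origin x = some v ↔ x = leaf v) ∧
      IsCompDecomposition d G o.str leaf

/-- This invariance compensates for the freedom of `σ`: although unary lifts need not respect
isomorphisms, the ones that guess good colorings do. -/
theorem IsGoodColoring.of_iso {n d : ℕ} {D : Transduction (colSig n 0) (treeSig (d + 1))}
    (hD : D.Deterministic) {A A' : Str (colSig n 0)} (h : IsGoodColoring D A) (θ : A.Iso A') :
    IsGoodColoring D A' := by
  obtain ⟨G, hG, o, ho, leaf, hleaf, hdec⟩ := h
  obtain ⟨o', ho', e, he⟩ := D.outputs_iso hD θ ho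
  refine ⟨G.comap θ.toEquiv.symm, fun x y => ?_, o', ho',
    fun v => e.toEquiv (leaf (θ.toEquiv.symm v)), fun x v => ?_,
    hdec.of_iso θ.toEquiv.symm (fun _ _ => Iff.rfl) e.symm
      fun v => e.toEquiv.symm_apply_apply _⟩
  · refine (hG _ _).trans ((θ.rel_iff none _).symm.trans (iff_of_eq (congrArg _
      (funext fun i => ?_))))
    change Fin 2 at i
    fin_cases i <;> exact θ.toEquiv.apply_symm_apply _
  · obtain ⟨x, rfl⟩ := e.toEquiv.surjective x
    rw [he, e.toEquiv.injective.eq_iff, ← hleaf, Option.map_eq_some_iff]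
    constructor
    · rintro ⟨w, hw, rfl⟩
      rw [hw, Equiv.symm_apply_apply]
    · exact fun hx => ⟨_, hx, θ.toEquiv.apply_symm_apply v⟩

/-- The isomorphism of colored structures induced by an isomorphism. -/
def Str.Iso.colored {n : ℕ} {A A' : Str graphSig} (θ : A.Iso A') (U : Fin n → Set A.V) :
    (A.colored U).Iso (A'.colored fun c => θ.toEquiv.symm ⁻¹' U c) where
  toEquiv := θ.toEquiv
  rel_iff R v := by
    rcases R with _ | c
    · refine Iff.trans (iff_of_eq (congrArg (A'.rel ()) (funext fun i => ?_))) (θ.rel_iff () _)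
      change Fin 2 at i
      fin_cases i <;> rfl
    · exact iff_of_eq (congrArg (· ∈ U c) (θ.toEquiv.symm_apply_apply _))
  func_eq i := i.elim0

open Classical in
theorem compTree_origin_iff {V : Type} [Finite V] {d : ℕ} {G : SimpleGraph V} {W : ℕ → Set V}
    (x : {x : V × Fin (d + 1) // (if x.2.val = 0 then id else compRep G W (d - x.2)) x.1 = x.1})
    (v : V) : (if x.1.2 = 0 then some x.1.1 else none) = some v ↔ x = compLeaf d G W v := by
  constructor
  · intro h
    split_ifs at h with hx
    exact Subtype.ext (Prod.ext (Option.some_injective _ h) hx)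
  · rintro rfl
    exact if_pos rfl

/-- Exactly the good colorings are guessed, and a deterministic transduction builds the tree from
them. The last clause is what `t ∈ T(B(t))` requires, because `B` returns the graph only up to
isomorphism. -/
theorem exists_treeTransduction (d : ℕ) : ∃ T : Transduction graphSig (treeSig (d + 1)),
    T.AlmostQuantifierFree ∧ ∀ G : FinGraph, (∃ W, compGraph G.graph W d = ⊥) →
      (T.outputs G.toStr).Nonempty ∧
      (∀ o ∈ T.outputs G.toStr, ∃ leaf : G.V → o.str.V,
        (∀ x v, o.origin x = some v ↔ x = leaf v) ∧ IsCompDecomposition d G.graph o.str leaf) ∧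
      ∀ (A : Str graphSig) (θ : G.toStr.Iso A), ∀ o ∈ T.outputs G.toStr,
        ∃ o' ∈ T.outputs A, o.Equivalent θ.toEquiv o' := by
  classical
  obtain ⟨n, D, hD1, hD2, hD3⟩ := exists_compTree d
  obtain ⟨T, hT1, hT2⟩ := exists_coloring n (IsGoodColoring D)
  refine ⟨T.comp D, ⟨hT1, hD1⟩, fun G ⟨W, hW⟩ => ?_⟩
  have hex : ∃ U, IsGoodColoring D (G.toStr.colored U) := by
    obtain ⟨U, o, ho, e, he⟩ := hD3 G.V G.graph W hW
    refine ⟨U, G.graph, fun x y => Iff.rfl, o, ho,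
      fun v => e.toEquiv.symm (compLeaf d G.graph W v), fun x v => ?_,
      (isCompDecomposition_compTree hW).of_iso (.refl _) (fun _ _ => Iff.rfl) e
        fun v => e.toEquiv.apply_symm_apply _⟩
    have hx := (he x).trans (congrFun Option.map_id (o.origin x))
    exact (iff_of_eq (congrArg (· = some v) hx.symm)).trans
      ((compTree_origin_iff _ _).trans e.toEquiv.eq_symm_apply.symm)
  have hout := hT2 _ hex
  refine ⟨?_, fun o ho => ?_, fun A θ o ho => ?_⟩
  · obtain ⟨U, hU⟩ := hex
    obtain ⟨_, _, o, ho, _⟩ := id hU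
    exact ⟨_, ⟨_, hout.superset ⟨U, hU, rfl⟩, o, ho, rfl⟩⟩
  · obtain ⟨o₁, h₁, o₂, h₂, rfl⟩ := ho
    obtain ⟨U, hU, rfl⟩ := hout.subset h₁
    obtain ⟨G', hG', o, ho, leaf, hleaf, hdec⟩ := hU
    obtain ⟨o₃, h₃⟩ := D.exists_outputs_eq hD2 (G.toStr.colored U)
    obtain rfl : o = o₃ := h₃.subset ho
    obtain rfl : o₂ = o := h₃.subset h₂
    obtain rfl : G' = G.graph := SimpleGraph.ext (funext₂ fun x y => propext (hG' x y))
    refine ⟨leaf, fun x v => ?_, hdec⟩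
    refine Iff.trans ?_ (hleaf x v)
    exact iff_of_eq (congrArg (· = some v) (Option.bind_fun_some _))
  · obtain ⟨o₁, h₁, o₂, h₂, rfl⟩ := ho
    obtain ⟨U, hU, rfl⟩ := hout.subset h₁
    have hU' := hU.of_iso hD2 (θ.colored U)
    obtain ⟨o', ho', e, he⟩ := D.outputs_iso hD2 (θ.colored U) h₂
    refine ⟨⟨o'.str, fun x => (o'.origin x).bind some⟩,
      ⟨_, (hT2 A ⟨_, hU'⟩).superset ⟨_, hU', rfl⟩, o', ho', rfl⟩, e, fun x => ?_⟩
    change (o'.origin (e.toEquiv x)).bind some = ((o₂.origin x).bind some).map θ.toEquiv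
    rw [he]
    cases o₂.origin x <;> rfl

/-- A finite rooted tree has a leaf. -/
theorem IsRootedTree.exists_isLeaf {N : Type} [Finite N] {p : N → Option N} {r : N}
    (h : IsRootedTree p r) : ∃ x, IsLeaf p x := by
  obtain ⟨dep, h1, h2⟩ := h.exists_depth
  have : Nonempty N := ⟨r⟩
  obtain ⟨x, hx⟩ := Finite.exists_max dep
  refine ⟨x, fun y hy => ?_⟩
  have := h2 _ _ 1 ((ancestor_one y).trans hy)
  have := hx y
  omega

/-- The empty graph has no connection model, as a finite rooted tree always has a leaf. This is
needed because a tree of components has a root only if there is a vertex. -/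
theorem HasConnectionModel.nonempty {h : ℕ} {Λ : Type} {G : FinGraph}
    (hG : HasConnectionModel h Λ G) : Nonempty G.V := by
  obtain ⟨N, _, p, r, leaf, lab, C, htree, hdepth, hleaf, hC, hadj⟩ := hG
  obtain ⟨x, hx⟩ := htree.exists_isLeaf
  obtain ⟨v, -⟩ := hleaf.surjOn hx
  exact ⟨v⟩

end ShrubDepth

theorem mainTheorem5 (𝓑 : Set FinGraph) (h𝓑 : BoundedShrubdepth 𝓑) :
    ∃ (d : ℕ) (𝓣 : Set (Str (treeSig (d + 1))))
      (T : Transduction graphSig (treeSig (d + 1)))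
      (B : Transduction (treeSig (d + 1)) graphSig),
      T.AlmostQuantifierFree ∧
      B.AlmostQuantifierFree ∧ B.Deterministic ∧
      (∀ t ∈ 𝓣, IsColoredTree d t) ∧
      -- `T(𝓑) ⊆ 𝓣`
      (∀ G ∈ 𝓑, ∀ o ∈ T.outputs G.toStr, o.str ∈ 𝓣) ∧
      -- `B(𝓣) ⊆ 𝓑`, up to isomorphism
      (∀ t ∈ 𝓣, ∀ o ∈ B.outputs t, ∃ G ∈ 𝓑, Nonempty (o.str.Iso G.toStr)) ∧
      -- `B(T(G)) = {G}`: there is an output, and every output consists of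
      -- the vertices of `G`, with the edges of `G`
      (∀ G ∈ 𝓑, ((T.comp B).outputs G.toStr).Nonempty ∧
        ∀ o ∈ (T.comp B).outputs G.toStr,
          ∃ e : o.str.Iso G.toStr, ∀ x, o.origin x = some (e.toEquiv x)) ∧
      -- `t ∈ T(B(t))`: some output is `t`, up to the names of newly created elements
      (∀ t ∈ 𝓣, ∃ o ∈ (B.comp T).outputs t,
        ∃ e : o.str.Iso t, ∀ x y, o.origin x = some y → e.toEquiv x = y) ∧
      -- every output of `T` on `G` is an SC-decomposition of `G`, whose leaves are the
      -- vertices of `G`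
      (∀ G ∈ 𝓑, ∀ o ∈ T.outputs G.toStr, ∃ leaf : G.V → o.str.V,
        (∀ x v, o.origin x = some v ↔ x = leaf v) ∧ IsSCDecomposition d G o.str leaf) := by
  obtain ⟨d, hd⟩ := h𝓑.exists_compGraph_eq_bot
  have hne : ∀ G ∈ 𝓑, Nonempty G.V := fun G hG => by
    obtain ⟨h, Λ, _, h'⟩ := h𝓑
    exact (h' G hG).nonempty
  obtain ⟨T, hT, hT'⟩ := exists_treeTransduction d
  obtain ⟨B, hB1, hB2, hB3⟩ := exists_leafGraph d
  -- The class of trees consists precisely of the outputs of `T` on the class of graphs, so each of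
  -- its members comes with the graph that it decomposes.
  refine ⟨d, {t | ∃ G ∈ 𝓑, ∃ o ∈ T.outputs G.toStr, t = o.str}, T, B, hT, hB1, hB2, ?_, ?_, ?_,
    ?_, ?_, ?_⟩
  · rintro _ ⟨G, hG, o, ho, rfl⟩
    have := hne G hG
    obtain ⟨leaf, -, hdec⟩ := (hT' G (hd G hG)).2.1 o ho
    exact hdec.isColoredTree
  · exact fun G hG o ho => ⟨G, hG, o, ho, rfl⟩
  · rintro _ ⟨G, hG, o, ho, rfl⟩ o' ho'
    obtain ⟨leaf, -, hdec⟩ := (hT' G (hd G hG)).2.1 o ho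
    obtain ⟨o₂, ho₂, e, -⟩ := hB3 G o.str leaf hdec
    obtain rfl : o' = o₂ := ho₂.subset ho'
    exact ⟨G, hG, ⟨e⟩⟩
  · intro G hG
    obtain ⟨⟨o, ho⟩, hdec, -⟩ := hT' G (hd G hG)
    refine ⟨?_, ?_⟩
    · obtain ⟨leaf, -, hleaf⟩ := hdec o ho
      obtain ⟨o₂, ho₂, -⟩ := hB3 G o.str leaf hleaf
      exact ⟨_, o, ho, o₂, ho₂.superset rfl, rfl⟩
    · rintro _ ⟨o₁, h₁, o₂, h₂, rfl⟩
      obtain ⟨leaf, horigin, hleaf⟩ := hdec o₁ h₁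
      obtain ⟨o₃, ho₃, e, he⟩ := hB3 G o₁.str leaf hleaf
      obtain rfl : o₂ = o₃ := ho₃.subset h₂
      refine ⟨e, fun x => ?_⟩
      change (o₂.origin x).bind o₁.origin = _
      rw [he, Option.bind_some, horigin]
  · rintro _ ⟨G, hG, o, ho, rfl⟩
    obtain ⟨-, hdec, hiso⟩ := hT' G (hd G hG)
    obtain ⟨leaf, horigin, hleaf⟩ := hdec o ho
    obtain ⟨o₂, ho₂, e, he⟩ := hB3 G o.str leaf hleaf
    -- The run of `T` on `G` that produced `t` is transported along the isomorphism from `G` to the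
    -- output of `B` on `t`. The origins agree because both transductions identify the vertices with
    -- the leaves.
    obtain ⟨o', ho', ε, hε⟩ := hiso o₂.str e.symm o ho
    refine ⟨_, ⟨o₂, ho₂.superset rfl, o', ho', rfl⟩, ε.symm, fun x y hxy => ?_⟩
    obtain ⟨x, rfl⟩ := ε.toEquiv.surjective x
    obtain ⟨v, hv, hy⟩ := Option.bind_eq_some_iff.1 hxy
    rw [hε, Option.map_eq_some_iff] at hv
    obtain ⟨w, hw, rfl⟩ := hv
    rw [he, Option.some_inj] at hy
    refine (ε.toEquiv.symm_apply_apply x).trans (((horigin _ _).1 hw).trans (Eq.trans ?_ hy))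
    exact congrArg leaf (e.toEquiv.apply_symm_apply w).symm
  · intro G hG o ho
    have := hne G hG
    obtain ⟨leaf, horigin, hleaf⟩ := (hT' G (hd G hG)).2.1 o ho
    exact ⟨leaf, horigin, hleaf.isSCDecomposition⟩
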